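/- For $n\in\mathbb N$ and $A\in\mathbb C^*$ let $[n]=\sum_{k=0}^{n-1}A^{-2n+2+4k}$ be the quantum integer and $[n]!=[1]\cdots[n]$, $[0]!=1$. A triple $(a,b,c)\in\mathbb N^3$ is \emph{admissible} if it satisfies the triangle inequalities and $a+b+c$ is even; a 6-tuple $(a,b,c,d,e,f)\in\mathbb N^6$ is admissible if $(a,b,c),(a,e,f),(d,b,f),(d,e,c)$ are admissible. Put $\bigcirc_a=(-1)^a[a+1]$ and, for admissible triples and 6-tuples, $$\Theta_{a,b,c}=(-1)^{\frac{a+b+c}2}\frac{[\frac{a+b+c}2+1]!\,[\frac{a+b-c}2]!\,[\frac{b+c-a}2]!\,[\frac{c+a-b}2]!}{[a]!\,[b]!\,[c]!},$$ $$\mathrm{Tet}=\frac{\prod_{i=1}^3\prod_{j=1}^4[\Box_i-\triangle_j]!}{[a]!\,[b]!\,[c]!\,[d]!\,[e]!\,[f]!}\sum_{z=\max_j\triangle_j}^{\min_i\Box_i}\frac{(-1)^z[z+1]!}{\prod_{j=1}^4[z-\triangle_j]!\,\prod_{i=1}^3[\Box_i-z]!},$$ where $\triangle_1=\frac{a+b+c}2$,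 $\triangle_2=\frac{a+e+f}2$, $\triangle_3=\frac{d+b+f}2$, $\triangle_4=\frac{d+e+c}2$, $\Box_1=\frac{a+b+d+e}2$, $\Box_2=\frac{a+c+d+f}2$, $\Box_3=\frac{b+c+e+f}2$. Let $\mathbb D$ be the open unit disc, $S$ the set of all roots of unity except $\pm1,\pm i$, and $D=\overline{\mathbb D}\setminus S$. A function is called analytic on a subset of $\mathbb C$ if it is analytic in a neighbourhood of each of its points. The functions $\bigcirc_a$ and $\Theta_{a,b,c}$ (with $(a,b,c)$ admissible) have analytic square roots $\sqrt{\bigcirc_a}$, $\sqrt{\Theta_{a,b,c}}$ on $D\setminus\{0\}$ with $A^{a}\sqrt{\bigcirc_a}\to i^{a}$ and $A^{\frac{a+b+c}2}\sqrt{\Theta_{a,b,c}}\to i^{\frac{a+b+c}2}$ as $A\to0$. For an admissible 6-tuple the renormalized $6j$-symbol is $$\begin{Bmatrix}a&b&c\\d&e&f\end{Bmatrix}^R=\frac{\mathrm{Tet}\,\sqrt{\bigcirc_c}\,\sqrt{\bigcirc_f}}{\sqrt{\Theta_{a,b,c}}\sqrt{\Theta_{a,e,f}}\sqrt{\Theta_{d,b,f}}\sqrt{\Theta_{d,e,c}}}$$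 for $A\in D\setminus\{0\}$, extended to $A=0$ by its limit there; for a non-admissible 6-tuple it is set to $0$. Then the following hold. 1. Every renormalized $6j$-symbol is an analytic function on $D$. 2. (Orthogonality) For all $A\in D$ and $a,b,c,d,e,g\in\mathbb N$ with $(a,b,c)$ and $(d,e,c)$ admissible, $$\sum_{f\in\mathbb N}\begin{Bmatrix}a&b&c\\d&e&f\end{Bmatrix}^R\begin{Bmatrix}a&b&g\\d&e&f\end{Bmatrix}^R=\delta_{cg}.$$ 3. (Biedenharn–Elliott) For all $A\in D$ and $a,b,c,d,e,f,g,h,i\in\mathbb N$, $$\begin{Bmatrix}a&b&c\\d&e&f\end{Bmatrix}^R\begin{Bmatrix}b&f&d\\h&i&g\end{Bmatrix}^R=\sum_{l\in\mathbb N}\begin{Bmatrix}c&e&d\\h&i&l\end{Bmatrix}^R\begin{Bmatrix}b&a&c\\l&i&g\end{Bmatrix}^R\begin{Bmatrix}a&g&l\\h&e&f\end{Bmatrix}^R.$$ (In 2 and 3 only finitely many summands are non-zero.) 4. $\begin{Bmatrix}a&b&c\\d&e&f\end{Bmatrix}^R=\begin{Bmatrix}a&e&f\\d&b&c\end{Bmatrix}^R$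 on $D$. 5. $\begin{Bmatrix}a&b&c\\d&e&f\end{Bmatrix}^R(A)\in\mathbb R$ for every $A\in D\cap(\mathbb R\cup i\mathbb R)$. 6. For every admissible 6-tuple, $\begin{Bmatrix}a&b&c\\d&e&f\end{Bmatrix}^R(0)$ is $1$ if $c+f=\max\{a+d,b+e\}$ and $0$ otherwise. 7. There are a function $Q\colon\mathbb N^6\to\mathbb N$ and a continuous function $K\colon\mathbb D\to\mathbb R$ such that $$\left|\begin{Bmatrix}a&b&c\\d&e&f\end{Bmatrix}^R(A)\right|\le|A|^{Q(a,b,c,d,e,f)}K(A)\qquad\text{for all }a,b,c,d,e,f\in\mathbb N,\ A\in\mathbb D,$$ and $\#\{f\in\mathbb N\mid Q(a,b,c,d,e,f)=n\}\le12$ for all $a,b,c,d,e,n\in\mathbb N$. -/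

import Mathlib

open Filter Topology

/-- Roots of unity other than `1, -1, i, -i`. -/
def rootSetS : Set ℂ := {A | (∃ n : ℕ, 0 < n ∧ A ^ n = 1) ∧ A ^ 4 ≠ 1}

/-- The closed unit disc without `rootSetS`. -/
def discS : Set ℂ := Metric.closedBall (0 : ℂ) 1 \ rootSetS

/-- Admissible triples of colors: triangle inequalities and even sum. -/
def Adm (a b c : ℕ) : Prop := a ≤ b + c ∧ b ≤ a + c ∧ c ≤ a + b ∧ Even (a + b + c)

/-- Admissible colorings of the tetrahedron: the four triples of colors meeting at a vertex of
the planar tetrahedral graph are admissible. -/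
def TetAdm (a b c d e f : ℕ) : Prop := Adm a b c ∧ Adm a e f ∧ Adm d b f ∧ Adm d e c

noncomputable section

/-- The quantum integer `[n] = A^(-2n+2) + A^(-2n+6) + ... + A^(2n-2)`, that is
`(A^(2n) - A^(-2n)) / (A^2 - A^(-2))` when `A^4 ≠ 1`. It is used for `A ≠ 0`. -/
def qInt (n : ℕ) (A : ℂ) : ℂ :=
  ∑ k ∈ Finset.range n, A ^ (-2 * (n : ℤ) + 2 + 4 * (k : ℤ))

/-- The quantum factorial `[n]! = [1] ... [n]`. -/
def qFact (n : ℕ) (A : ℂ) : ℂ := ∏ k ∈ Finset.range n, qInt (k + 1) A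

/-- Evaluation of the unknot with color `a`. -/
def circleEval (a : ℕ) (A : ℂ) : ℂ := (-1) ^ a * qInt (a + 1) A

/-- Evaluation of the theta graph; meaningful for admissible `a, b, c`. -/
def thetaEval (a b c : ℕ) (A : ℂ) : ℂ :=
  (-1) ^ ((a + b + c) / 2) *
    (qFact ((a + b + c) / 2 + 1) A * qFact ((a + b - c) / 2) A *
      qFact ((b + c - a) / 2) A * qFact ((c + a - b) / 2) A) /
    (qFact a A * qFact b A * qFact c A)

/-- The half-sums of the colors of the triangles. -/
def tri (a b c d e f : ℕ) : Fin 4 → ℕ :=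
  ![(a + b + c) / 2, (a + e + f) / 2, (d + b + f) / 2, (d + e + c) / 2]

/-- The half-sums of the colors of the quadrilaterals. -/
def box (a b c d e f : ℕ) : Fin 3 → ℕ :=
  ![(a + b + d + e) / 2, (a + c + d + f) / 2, (b + c + e + f) / 2]

/-- Evaluation of the planar tetrahedron; meaningful for admissible colorings. The sum is over
`max tri ≤ z ≤ min box`. -/
def tetEval (a b c d e f : ℕ) (A : ℂ) : ℂ :=
  (∏ i : Fin 3, ∏ j : Fin 4, qFact (box a b c d e f i - tri a b c d e f j) A) /
      (qFact a A * qFact b A * qFact c A * qFact d A * qFact e A * qFact f A) *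
    ∑ z ∈ Finset.Icc (Finset.univ.sup (tri a b c d e f))
        (Finset.univ.inf' Finset.univ_nonempty (box a b c d e f)),
      (-1) ^ z * (qFact (z + 1) A /
        ((∏ j : Fin 4, qFact (z - tri a b c d e f j) A) *
          (∏ i : Fin 3, qFact (box a b c d e f i - z) A) * qFact 1 A))

/-- `s` is an analytic square root of `g` on the closed unit disc without `0` and `rootSetS`,
and `s` behaves as `κ A^(-m)` when `A → 0`. -/
def IsSqrtBranch (g : ℂ → ℂ) (κ : ℂ) (m : ℕ) (s : ℂ → ℂ) : Prop :=
  AnalyticOnNhd ℂ s (discS \ {0}) ∧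
  (∀ A ∈ discS \ {0}, s A ^ 2 = g A) ∧
  Tendsto (fun A : ℂ => s A * A ^ m) (𝓝[≠] 0) (𝓝 κ)

/-- The square root of the circle evaluation that behaves as `i^a A^(-a)` at `0`
(on `discS \ {0}` it is unique). -/
def sqrtCircle (a : ℕ) : ℂ → ℂ :=
  Classical.epsilon (IsSqrtBranch (circleEval a) (Complex.I ^ a) a)

/-- The square root of the theta evaluation that behaves as
`i^((a+b+c)/2) A^(-(a+b+c)/2)` at `0` (on `discS \ {0}` it is unique). -/
def sqrtTheta (a b c : ℕ) : ℂ → ℂ :=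
  Classical.epsilon
    (IsSqrtBranch (thetaEval a b c) (Complex.I ^ ((a + b + c) / 2)) ((a + b + c) / 2))

/-- The formula for the renormalized symbol at nonzero `A`. -/
def sixJFormula (a b c d e f : ℕ) (A : ℂ) : ℂ :=
  tetEval a b c d e f A * (sqrtCircle c A * sqrtCircle f A) /
    (sqrtTheta a b c A * sqrtTheta a e f A * sqrtTheta d b f A * sqrtTheta d e c A)

open Classical in
/-- The renormalized `6j`-symbol, extended to `A = 0` by its limit there, and set to zero for
colors that are not admissible (so that sums over admissible colors are sums over `ℕ`). -/
def sixJR (a b c d e f : ℕ) (A : ℂ) : ℂ :=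
  if TetAdm a b c d e f then
    if A = 0 then limUnder (𝓝[≠] (0 : ℂ)) (sixJFormula a b c d e f)
    else sixJFormula a b c d e f A
  else 0

end

/-! Up to square-root normalizations the symbol is an alternating Racah sum `racahS`, and the two
summation identities are identities between such sums at generic `A`. The central one is `pentagon`,
proved by induction on the color `a` of the edge joining the two apices. If an edge has color 1, a
Racah sum has a single term (`racahS_eq_term`). The identity for `a = 1` is therefore a three-term
contiguous relation between Racah sums with shifted parameters, and such relations hold because the
difference of the two sides telescopes (`sum_contiguous`). For `n + 1`, the edge is fused from edges
of colors 1 and `n` (`racahS_fusion`, itself a reading of the case `a = 1`); after this both sides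
become one and the same triple sum. Orthogonality is the degenerate case in which another edge has
color 0.

The passage to the symbols is a bookkeeping of normalizations. On the punctured open disc every
point is generic, and `sixJR_eq_racahS` writes the symbol as a Racah sum times vertex and edge
factors. A vertex on the summation edge occurs in two of the multiplied symbols, so its factor is
squared, and `triSq_eq_vertexFactor` identifies this square with the weight in `pentagon`. By
continuity (`eq_of_eq_on_ball`) the identities extend to 0 and to the boundary, including the points
with `A ^ 4 = 1`, where the quotient form of quantum integers breaks down.

The analytic part rests on `[n] = A^(-2n+2) * ∏ (1 - ζ A^4)`, the product being over the `n`-th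
roots of unity `ζ ≠ 1`. On `discS` each factor stays in the slit plane, so the product of principal
roots is an analytic square root; the behavior at 0 makes it the only one (`eqOn_of_isSqrtBranch`).
Collecting the powers of `A` gives `sixJExplicit`: a prefactor equal to 1 at 0, times a sum of terms
of order `2(u₀ + u₀u₁ + u₀u₂ + u₁u₂)`, where `uᵢ` is the distance of the summation index `z` from
the `i`-th quadrilateral half-sum. The order is smallest at the largest `z`. This gives analyticity
at 0, the value there and, with uniform bounds on partial Euler products, the estimate. On the real
and imaginary axes every root in the formula is real. -/

namespace QuantumSixJ

variable {A : ℂ}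

/-! ### Quantum integers and factorials at generic `A` -/

/-- `A` is neither zero nor a root of unity. -/
def IsGeneric (A : ℂ) : Prop := A ≠ 0 ∧ ∀ n : ℕ, 0 < n → A ^ n ≠ 1

/-- The quantum integer `[n]` for integral `n`. -/
noncomputable def qz (A : ℂ) (n : ℤ) : ℂ :=
  (A ^ (2 * n) - A ^ (-(2 * n))) / (A ^ (2 : ℤ) - A ^ (-2 : ℤ))

/-- The inverse quantum factorial, extended by zero to negative integers. -/
noncomputable def qInvFact (A : ℂ) (n : ℤ) : ℂ := if 0 ≤ n then (qFact n.toNat A)⁻¹ else 0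

lemma IsGeneric.zpow_ne_one (hA : IsGeneric A) {n : ℤ} (hn : n ≠ 0) : A ^ n ≠ 1 := by
  intro h
  have h2 : A ^ n.natAbs = 1 := by
    rcases Int.natAbs_eq n with h' | h'
    · rw [h', zpow_natCast] at h; exact h
    · rw [h', zpow_neg, zpow_natCast, inv_eq_one] at h; exact h
  exact hA.2 _ (Int.natAbs_pos.mpr hn) h2

lemma IsGeneric.sub_ne_zero (hA : IsGeneric A) {n : ℤ} (hn : n ≠ 0) :
    A ^ (2 * n) - A ^ (-(2 * n)) ≠ 0 := by
  intro h
  apply hA.zpow_ne_one (n := 4 * n) (by omega)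
  have h1 : A ^ (2 * n) = A ^ (-(2 * n)) := _root_.sub_eq_zero.mp h
  calc A ^ (4 * n) = A ^ (2 * n) * A ^ (2 * n) := by rw [← zpow_add₀ hA.1]; congr 1; ring
    _ = A ^ (-(2 * n)) * A ^ (2 * n) := by rw [← h1]
    _ = 1 := by rw [← zpow_add₀ hA.1]; simp

lemma qz_zero : qz A 0 = 0 := by simp [qz]

lemma qz_neg (n : ℤ) : qz A (-n) = -qz A n := by
  unfold qz
  rw [show 2 * -n = -(2 * n) by ring, neg_neg]; ring

lemma qz_ne_zero (hA : IsGeneric A) {n : ℤ} (hn : n ≠ 0) : qz A n ≠ 0 :=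
  div_ne_zero (hA.sub_ne_zero hn) (by simpa using hA.sub_ne_zero (n := 1) one_ne_zero)

lemma qInt_eq_qz (hA : IsGeneric A) (n : ℕ) : qInt n A = qz A n := by
  have h1 : A ^ (2 : ℤ) - A ^ (-2 : ℤ) ≠ 0 := by
    simpa using hA.sub_ne_zero (n := 1) one_ne_zero
  rw [qz, eq_div_iff h1, qInt, Finset.sum_mul]
  have : ∀ k ∈ Finset.range n, A ^ (-2 * (n : ℤ) + 2 + 4 * (k : ℤ)) *
      (A ^ (2 : ℤ) - A ^ (-2 : ℤ)) =
      (fun k : ℕ => A ^ (-2 * (n : ℤ) + 4 * (k : ℤ))) (k + 1) -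
      (fun k : ℕ => A ^ (-2 * (n : ℤ) + 4 * (k : ℤ))) k := by
    intro k _
    rw [mul_sub, ← zpow_add₀ hA.1, ← zpow_add₀ hA.1]
    congr 2 <;> push_cast <;> ring
  rw [Finset.sum_congr rfl this,
    Finset.sum_range_sub (fun k : ℕ => A ^ (-2 * (n : ℤ) + 4 * (k : ℤ)))]
  congr 2 <;> push_cast <;> ring

lemma qz_one (hA : IsGeneric A) : qz A 1 = 1 := by
  have := qInt_eq_qz hA 1
  simp [qInt] at this
  exact this.symm

lemma qFact_zero : qFact 0 A = 1 := by simp [qFact]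

lemma qFact_succ (hA : IsGeneric A) (n : ℕ) : qFact (n + 1) A = qFact n A * qz A (n + 1) := by
  rw [qFact, Finset.prod_range_succ, ← qFact, qInt_eq_qz hA]; push_cast; rfl

lemma qFact_one (hA : IsGeneric A) : qFact 1 A = 1 := by
  rw [qFact_succ hA 0, qFact_zero]; simp [qz_one hA]

lemma qFact_ne_zero (hA : IsGeneric A) (n : ℕ) : qFact n A ≠ 0 := by
  induction n with
  | zero => simp [qFact_zero]
  | succ n ih => rw [qFact_succ hA]; exact mul_ne_zero ih (qz_ne_zero hA (by omega))

lemma qInvFact_of_neg {n : ℤ} (hn : n < 0) : qInvFact A n = 0 := by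
  simp [qInvFact, not_le.mpr hn]

lemma qInvFact_of_eq {e : ℤ} {n : ℕ} (h : e = n) : qInvFact A e = (qFact n A)⁻¹ := by
  subst h; simp [qInvFact]

/-- The recursion of inverse factorials holds for all integers. -/
lemma qz_mul_qInvFact (hA : IsGeneric A) (n : ℤ) : qz A n * qInvFact A n = qInvFact A (n - 1) := by
  rcases lt_trichotomy n 0 with h | h | h
  · rw [qInvFact_of_neg h, qInvFact_of_neg (by omega), mul_zero]
  · subst h; rw [qz_zero, qInvFact_of_neg (n := 0 - 1) (by norm_num), zero_mul]
  · obtain ⟨k, rfl⟩ : ∃ k : ℕ, n = k + 1 := ⟨(n - 1).toNat, by omega⟩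
    rw [qInvFact_of_eq (n := k + 1) (by push_cast; rfl), qInvFact_of_eq (n := k) (by omega),
      qFact_succ hA, mul_inv]
    have := qz_ne_zero hA (n := (k : ℤ) + 1) (by omega)
    field_simp

lemma qz_mul_sub_mul (hA : IsGeneric A) (x y δ : ℤ) :
    qz A (x + δ) * qz A (y + δ) - qz A x * qz A y = qz A δ * qz A (x + y + δ) := by
  have h1 : A ^ (2 : ℤ) - A ^ (-2 : ℤ) ≠ 0 := by
    simpa using hA.sub_ne_zero (n := 1) one_ne_zero
  have hx : A ^ (2 * x) ≠ 0 := zpow_ne_zero _ hA.1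
  have hy : A ^ (2 * y) ≠ 0 := zpow_ne_zero _ hA.1
  have hd : A ^ (2 * δ) ≠ 0 := zpow_ne_zero _ hA.1
  simp only [qz, mul_add, zpow_neg, zpow_add₀ hA.1]
  rw [zpow_neg] at h1
  generalize A ^ (2 * x) = X at *
  generalize A ^ (2 * y) = Y at *
  generalize A ^ (2 * δ) = Z at *
  generalize A ^ (2 : ℤ) - (A ^ (2 : ℤ))⁻¹ = D at *
  field_simp
  ring

/-- Shift `a₃, a₄` by `b₂` and `b₃, b₄` by `a₁` with `qz_mul_sub_mul`. Both corrections contain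
`[a₁][b₂]`, and a third application of the same identity merges them. The coefficients involve only
sums in which a summation variable entering the `aᵢ` with a minus sign and the `bᵢ` with a plus sign
cancels, so they can be pulled out of a sum. -/
lemma qz_four_mul_sub (hA : IsGeneric A) (a₁ a₂ a₃ a₄ b₁ b₂ b₃ b₄ : ℤ)
    (h : a₁ + a₂ + a₃ + a₄ + b₁ + b₂ + b₃ + b₄ = 0) :
    qz A a₁ * qz A a₂ * qz A a₃ * qz A a₄ - qz A b₁ * qz A b₂ * qz A b₃ * qz A b₄ =
      qz A (a₃ + b₂) * qz A (a₄ + b₂) * (qz A a₁ * qz A a₂)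
      - qz A (a₂ + b₁) * qz A (a₃ + a₄ + b₁ + b₂) * (qz A a₁ * qz A b₂)
      - qz A (a₁ + b₃) * qz A (a₁ + b₄) * (qz A b₁ * qz A b₂) := by
  have h1 := qz_mul_sub_mul hA a₃ a₄ b₂
  have h2 := qz_mul_sub_mul hA b₃ b₄ a₁
  have h3 := qz_mul_sub_mul hA a₂ (a₃ + a₄ + b₂) b₁
  rw [show b₃ + b₄ + a₁ = -(a₂ + (a₃ + a₄ + b₂) + b₁) by linarith, qz_neg] at h2
  rw [show a₃ + a₄ + b₂ + b₁ = a₃ + a₄ + b₁ + b₂ by ring] at h3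
  rw [add_comm b₃ a₁, add_comm b₄ a₁] at h2
  linear_combination (-qz A a₁ * qz A a₂) * h1 + (qz A b₁ * qz A b₂) * h2
    + (qz A a₁ * qz A b₂) * h3

/-- The three-term relation behind the contiguous relations of the Racah sums: the difference of
the two sides of the recursion of `w` telescopes. -/
lemma sum_contiguous (hA : IsGeneric A) (w : ℕ → ℂ) (N : ℕ) (B₁ B₂ B₃ B₄ t₁ t₂ t₃ t₄ : ℤ)
    (h : B₁ + B₂ + B₃ + B₄ + 2 = t₁ + t₂ + t₃ + t₄)
    (hw : ∀ s : ℕ, w (s + 1) * (qz A (s + 1 - t₁) * qz A (s + 2 - t₂) * qz A (s + 1 - t₃) *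
      qz A (s + 1 - t₄)) =
      w s * (qz A (B₁ + 1 - s) * qz A (B₂ - s) * qz A (B₃ - s) * qz A (B₄ - s)))
    (h0 : w 0 * (qz A (0 - t₁) * qz A (0 + 1 - t₂) * qz A (0 - t₃) * qz A (0 - t₄)) = 0)
    (hN : w N * (qz A (N - t₁) * qz A (N + 1 - t₂) * qz A (N - t₃) * qz A (N - t₄)) = 0) :
    qz A (B₂ - t₁) * qz A (B₃ + B₄ + 1 - t₁ - t₂) *
        ∑ s ∈ Finset.range N, w s * (qz A (B₁ + 1 - s) * qz A (s + 1 - t₂)) +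
      qz A (B₁ + 1 - t₃) * qz A (B₁ + 1 - t₄) *
        ∑ s ∈ Finset.range N, w s * (qz A (s - t₁) * qz A (s + 1 - t₂)) =
      qz A (B₃ + 1 - t₂) * qz A (B₄ + 1 - t₂) *
        ∑ s ∈ Finset.range N, w s * (qz A (B₁ + 1 - s) * qz A (B₂ - s)) := by
  -- By the recursion `hw`, `G (s + 1)` is `w s` times the product of the upper factors, so `G (s +
  -- 1) - G s` is `w s` times the left side of `qz_four_mul_sub`.
  set G : ℕ → ℂ := fun s => w s * (qz A (s - t₁) * qz A (s + 1 - t₂) * qz A (s - t₃) *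
      qz A (s - t₄)) with hG
  have key : ∑ s ∈ Finset.range N, (G (s + 1) - G s) = 0 := by
    rw [Finset.sum_range_sub]
    simp only [hG]
    rw [hN, Nat.cast_zero, h0, sub_zero]
  have key2 : ∀ s ∈ Finset.range N, G (s + 1) - G s =
      qz A (B₃ + 1 - t₂) * qz A (B₄ + 1 - t₂) * (w s * (qz A (B₁ + 1 - s) * qz A (B₂ - s))) -
      qz A (B₂ - t₁) * qz A (B₃ + B₄ + 1 - t₁ - t₂) *
        (w s * (qz A (B₁ + 1 - s) * qz A (s + 1 - t₂))) -
      qz A (B₁ + 1 - t₃) * qz A (B₁ + 1 - t₄) *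
        (w s * (qz A (s - t₁) * qz A (s + 1 - t₂))) := by
    intro s _
    have e := qz_four_mul_sub hA (B₁ + 1 - s) (B₂ - s) (B₃ - s) (B₄ - s) (s - t₁) (s + 1 - t₂)
      (s - t₃) (s - t₄) (by linarith)
    rw [show B₃ - s + (s + 1 - t₂) = B₃ + 1 - t₂ by ring,
      show B₄ - s + (s + 1 - t₂) = B₄ + 1 - t₂ by ring,
      show B₂ - s + (s - t₁) = B₂ - t₁ by ring,
      show B₃ - s + (B₄ - s) + (s - t₁) + (s + 1 - t₂) = B₃ + B₄ + 1 - t₁ - t₂ by ring,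
      show B₁ + 1 - s + (s - t₃) = B₁ + 1 - t₃ by ring,
      show B₁ + 1 - s + (s - t₄) = B₁ + 1 - t₄ by ring] at e
    have hw' := hw s
    simp only [hG]
    push_cast
    rw [show (s : ℤ) + 1 + 1 - t₂ = s + 2 - t₂ by ring, hw']
    linear_combination w s * e
  rw [Finset.sum_congr rfl key2, Finset.sum_sub_distrib, Finset.sum_sub_distrib,
    ← Finset.mul_sum, ← Finset.mul_sum, ← Finset.mul_sum] at key
  linear_combination -key

/-! ### Racah sums and their contiguous relations -/

/-- The summand of the Racah sum. -/
noncomputable def racahTerm (A : ℂ) (t₁ t₂ t₃ t₄ B₁ B₂ B₃ : ℤ) (s : ℕ) : ℂ :=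
  (-1) ^ s * qFact (s + 1) A *
    (qInvFact A (s - t₁) * qInvFact A (s - t₂) * qInvFact A (s - t₃) * qInvFact A (s - t₄)) *
    (qInvFact A (B₁ - s) * qInvFact A (B₂ - s) * qInvFact A (B₃ - s))

/-- The Racah sum, truncated at `N`. -/
noncomputable def racahSum (A : ℂ) (t₁ t₂ t₃ t₄ B₁ B₂ B₃ : ℤ) (N : ℕ) : ℂ :=
  ∑ s ∈ Finset.range N, racahTerm A t₁ t₂ t₃ t₄ B₁ B₂ B₃ s

lemma racahTerm_eq_zero {t₁ t₂ t₃ t₄ B₁ B₂ B₃ : ℤ} {s : ℕ}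
    (h : (s : ℤ) < t₁ ∨ (s : ℤ) < t₂ ∨ (s : ℤ) < t₃ ∨ (s : ℤ) < t₄ ∨
      B₁ < s ∨ B₂ < s ∨ B₃ < s) : racahTerm A t₁ t₂ t₃ t₄ B₁ B₂ B₃ s = 0 := by
  unfold racahTerm
  rcases h with h | h | h | h | h | h | h
  · rw [qInvFact_of_neg (n := s - t₁) (by omega)]; ring
  · rw [qInvFact_of_neg (n := s - t₂) (by omega)]; ring
  · rw [qInvFact_of_neg (n := s - t₃) (by omega)]; ring
  · rw [qInvFact_of_neg (n := s - t₄) (by omega)]; ring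
  · rw [qInvFact_of_neg (n := B₁ - s) (by omega)]; ring
  · rw [qInvFact_of_neg (n := B₂ - s) (by omega)]; ring
  · rw [qInvFact_of_neg (n := B₃ - s) (by omega)]; ring

lemma racahSum_eq_of_le {t₁ t₂ t₃ t₄ B₁ B₂ B₃ : ℤ} {M N : ℕ} (hM : B₁ < M ∨ B₂ < M ∨ B₃ < M)
    (h : M ≤ N) :
    racahSum A t₁ t₂ t₃ t₄ B₁ B₂ B₃ N = racahSum A t₁ t₂ t₃ t₄ B₁ B₂ B₃ M := by
  symm
  apply Finset.sum_subset (Finset.range_subset_range.mpr h)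
  intro s _ hs
  rw [Finset.mem_range, not_lt] at hs
  exact racahTerm_eq_zero (by omega)

lemma racahSum_succ_shift {t₁ t₂ t₃ t₄ B₁ B₂ B₃ : ℤ} {N : ℕ}
    (h : 0 < t₁ ∨ 0 < t₂ ∨ 0 < t₃ ∨ 0 < t₄) :
    racahSum A t₁ t₂ t₃ t₄ B₁ B₂ B₃ (N + 1) =
      ∑ s ∈ Finset.range N, racahTerm A t₁ t₂ t₃ t₄ B₁ B₂ B₃ (s + 1) := by
  rw [racahSum, Finset.sum_range_succ', racahTerm_eq_zero (s := 0) (by push_cast; omega), add_zero]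

/-- Contiguous relation: raise two edges at the first vertex, with the third one varying. -/
lemma racahSum_contiguous_up (hA : IsGeneric A) {t₁ t₂ t₃ t₄ B₁ B₂ B₃ : ℤ} {N : ℕ}
    (h : B₁ + B₂ + B₃ = t₁ + t₂ + t₃ + t₄) (h₁ : 0 ≤ t₁) (hN : B₁ + 1 < N) :
    qz A (-2 - t₁) * qz A (B₂ + B₃ + 1 - t₁ - t₄) * racahSum A t₁ t₂ t₃ t₄ B₁ B₂ B₃ N +
      qz A (B₁ + 1 - t₂) * qz A (B₁ + 1 - t₃) * racahSum A (t₁ + 1) t₂ t₃ t₄ (B₁ + 1) B₂ B₃ N =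
    qz A (B₂ + 1 - t₄) * qz A (B₃ + 1 - t₄) *
      racahSum A (t₁ + 1) (t₂ + 1) (t₃ + 1) t₄ (B₁ + 1) (B₂ + 1) (B₃ + 1) (N + 1) := by
  -- `w` is the common part of the three summands: each is `w s` times two quantum integers, the
  -- last one after the shift `s ↦ s + 1`. The numerator `[s + 1]!` acts as a fourth upper parameter
  -- `-2`, because `[-2 - s] = -[s + 2]`.
  set w : ℕ → ℂ := fun s => (-1) ^ s * qFact (s + 1) A *
    (qInvFact A (s - t₁) * qInvFact A (s - t₂) * qInvFact A (s - t₃) * qInvFact A (s + 1 - t₄)) *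
    (qInvFact A (B₁ + 1 - s) * qInvFact A (B₂ - s) * qInvFact A (B₃ - s)) with hw
  have key := sum_contiguous hA w N B₁ (-2) B₂ B₃ t₁ t₄ t₂ t₃ (by omega) ?_ ?_ ?_
  · rw [racahSum_succ_shift (by omega)]
    simp only [racahSum]
    refine Eq.trans ?_ (key.trans ?_)
    · congr 2
      · refine Finset.sum_congr rfl fun s _ => ?_
        simp only [hw, racahTerm]
        rw [show B₁ - s = B₁ + 1 - s - 1 by ring, ← qz_mul_qInvFact hA (B₁ + 1 - s),
          show (s : ℤ) - t₄ = s + 1 - t₄ - 1 by ring, ← qz_mul_qInvFact hA (s + 1 - t₄)]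
        ring
      · refine Finset.sum_congr rfl fun s _ => ?_
        simp only [hw, racahTerm]
        rw [show (s : ℤ) - (t₁ + 1) = s - t₁ - 1 by ring, ← qz_mul_qInvFact hA (s - t₁),
          show (s : ℤ) - t₄ = s + 1 - t₄ - 1 by ring, ← qz_mul_qInvFact hA (s + 1 - t₄)]
        ring
    · congr 1
      refine Finset.sum_congr rfl fun s _ => ?_
      simp only [hw, racahTerm]
      rw [qFact_succ hA (s + 1), show (-2 : ℤ) - s = -((s + 1 : ℕ) + 1) by push_cast; ring, qz_neg]
      push_cast
      rw [show (s : ℤ) + 1 - (t₁ + 1) = s - t₁ by ring,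
        show (s : ℤ) + 1 - (t₂ + 1) = s - t₂ by ring,
        show (s : ℤ) + 1 - (t₃ + 1) = s - t₃ by ring,
        show B₁ + 1 - (s + 1) = B₁ + 1 - s - 1 by ring, ← qz_mul_qInvFact hA (B₁ + 1 - s),
        show B₂ + 1 - (s + 1) = B₂ - s by ring, show B₃ + 1 - (s + 1) = B₃ - s by ring]
      ring
  · intro s
    simp only [hw]
    rw [qFact_succ hA (s + 1), show (-2 : ℤ) - s = -((s + 1 : ℕ) + 1) by push_cast; ring, qz_neg]
    push_cast
    have e1 := qz_mul_qInvFact hA (s + 1 - t₁)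
    have e2 := qz_mul_qInvFact hA (s + 1 - t₂)
    have e3 := qz_mul_qInvFact hA (s + 1 - t₃)
    have e4 := qz_mul_qInvFact hA (s + 2 - t₄)
    rw [show (s : ℤ) + 1 - t₁ - 1 = s - t₁ by ring] at e1
    rw [show (s : ℤ) + 1 - t₂ - 1 = s - t₂ by ring] at e2
    rw [show (s : ℤ) + 1 - t₃ - 1 = s - t₃ by ring] at e3
    rw [show (s : ℤ) + 2 - t₄ - 1 = s + 1 - t₄ by ring] at e4
    rw [← e1, ← e2, ← e3, ← e4, show B₁ + 1 - (s + 1) = B₁ + 1 - s - 1 by ring,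
      ← qz_mul_qInvFact hA (B₁ + 1 - s),
      show B₂ - (s + 1) = B₂ - s - 1 by ring, ← qz_mul_qInvFact hA (B₂ - s),
      show B₃ - (s + 1) = B₃ - s - 1 by ring, ← qz_mul_qInvFact hA (B₃ - s),
      show (s : ℤ) + 1 + 1 - t₄ = s + 2 - t₄ by ring]
    ring
  -- The lower boundary term vanishes through an inverse factorial of a negative number if `t₁ > 0`,
  -- and through the factor `[0 - t₁] = 0` if `t₁ = 0`.
  · rcases h₁.lt_or_eq with h | h
    · simp only [hw]
      rw [qInvFact_of_neg (n := ((0 : ℕ) : ℤ) - t₁) (by push_cast; omega)]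
      ring
    · rw [show (0 : ℤ) - t₁ = 0 by omega, qz_zero]; ring
  · simp only [hw]
    rw [qInvFact_of_neg (n := B₁ + 1 - N) (by omega)]
    ring

/-- Contiguous relation: lower two edges at the first vertex, with the third one varying. -/
lemma racahSum_contiguous_down (hA : IsGeneric A) {t₁ t₂ t₃ t₄ B₁ B₂ B₃ : ℤ} {N : ℕ}
    (h : B₁ + B₂ + B₃ = t₁ + t₂ + t₃ + t₄) (h₄ : 0 ≤ t₄) (hN : B₁ < N) :
    qz A (B₁ - t₄) * qz A (B₂ + B₃ + 1 - t₄ - t₁) *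
        racahSum A t₁ t₂ t₃ t₄ B₁ B₂ B₃ (N + 1) +
      qz A (-1 - t₂) * qz A (-1 - t₃) *
        racahSum A (t₁ - 1) (t₂ - 1) (t₃ - 1) t₄ (B₁ - 1) (B₂ - 1) (B₃ - 1) N =
    qz A (B₂ + 1 - t₁) * qz A (B₃ + 1 - t₁) *
      racahSum A (t₁ - 1) t₂ t₃ t₄ (B₁ - 1) B₂ B₃ (N + 1) := by
  -- Here the parameter `-2` takes the distinguished upper place, the one shifted by 1, so the
  -- numerator is `[s]!`; the missing factor is restored by `[-1 - s] = -[s + 1]`.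
  set w : ℕ → ℂ := fun s => (-1) ^ (s + 1) * qFact s A *
    (qInvFact A (s + 1 - t₁) * qInvFact A (s - t₂) * qInvFact A (s - t₃) * qInvFact A (s - t₄)) *
    (qInvFact A (B₁ - s) * qInvFact A (B₂ - s) * qInvFact A (B₃ - s)) with hw
  have key := sum_contiguous hA w (N + 1) (-2) B₁ B₂ B₃ t₄ t₁ t₂ t₃ (by omega) ?_ ?_ ?_
  · simp only [show (-2 : ℤ) + 1 = -1 by norm_num] at key
    simp only [racahSum]
    refine Eq.trans ?_ (key.trans ?_)
    · congr 2
      · refine Finset.sum_congr rfl fun s _ => ?_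
        simp only [hw, racahTerm]
        rw [qFact_succ hA s, show (-1 : ℤ) - s = -(s + 1) by ring, qz_neg,
          show (s : ℤ) - t₁ = s + 1 - t₁ - 1 by ring, ← qz_mul_qInvFact hA (s + 1 - t₁)]
        ring
      · rw [Finset.sum_range_succ']
        have hz : w 0 * (qz A ((0 : ℕ) - t₄) * qz A ((0 : ℕ) + 1 - t₁)) = 0 := by
          rcases h₄.lt_or_eq with h | h
          · simp only [hw]
            rw [qInvFact_of_neg (n := ((0 : ℕ) : ℤ) - t₄) (by push_cast; omega)]
            ring
          · rw [show ((0 : ℕ) : ℤ) - t₄ = 0 by push_cast; omega, qz_zero]; ring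
        rw [hz, add_zero]
        refine Finset.sum_congr rfl fun s _ => ?_
        simp only [hw, racahTerm]
        push_cast
        rw [show (s : ℤ) - t₄ = s + 1 - t₄ - 1 by ring, ← qz_mul_qInvFact hA (s + 1 - t₄),
          show (s : ℤ) - (t₁ - 1) = s + 1 + 1 - t₁ - 1 by ring,
          ← qz_mul_qInvFact hA (s + 1 + 1 - t₁),
          show (s : ℤ) - (t₂ - 1) = s + 1 - t₂ by ring,
          show (s : ℤ) - (t₃ - 1) = s + 1 - t₃ by ring,
          show B₁ - 1 - s = B₁ - (s + 1) by ring,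
          show B₂ - 1 - s = B₂ - (s + 1) by ring,
          show B₃ - 1 - s = B₃ - (s + 1) by ring]
        ring
    · congr 1
      refine Finset.sum_congr rfl fun s _ => ?_
      simp only [hw, racahTerm]
      rw [qFact_succ hA s, show (-1 : ℤ) - s = -(s + 1) by ring, qz_neg,
        show (s : ℤ) - (t₁ - 1) = s + 1 - t₁ by ring,
        show B₁ - 1 - s = B₁ - s - 1 by ring, ← qz_mul_qInvFact hA (B₁ - s)]
      ring
  · intro s
    simp only [hw]
    rw [qFact_succ hA s, show (-2 : ℤ) + 1 - s = -(s + 1) by ring, qz_neg]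
    push_cast
    have e1 := qz_mul_qInvFact hA (s + 2 - t₁)
    have e2 := qz_mul_qInvFact hA (s + 1 - t₂)
    have e3 := qz_mul_qInvFact hA (s + 1 - t₃)
    have e4 := qz_mul_qInvFact hA (s + 1 - t₄)
    rw [show (s : ℤ) + 2 - t₁ - 1 = s + 1 - t₁ by ring] at e1
    rw [show (s : ℤ) + 1 - t₂ - 1 = s - t₂ by ring] at e2
    rw [show (s : ℤ) + 1 - t₃ - 1 = s - t₃ by ring] at e3
    rw [show (s : ℤ) + 1 - t₄ - 1 = s - t₄ by ring] at e4
    rw [← e1, ← e2, ← e3, ← e4, show B₁ - (s + 1) = B₁ - s - 1 by ring,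
      ← qz_mul_qInvFact hA (B₁ - s),
      show B₂ - (s + 1) = B₂ - s - 1 by ring, ← qz_mul_qInvFact hA (B₂ - s),
      show B₃ - (s + 1) = B₃ - s - 1 by ring, ← qz_mul_qInvFact hA (B₃ - s),
      show (s : ℤ) + 1 + 1 - t₁ = s + 2 - t₁ by ring]
    ring
  · rcases h₄.lt_or_eq with h | h
    · simp only [hw]
      rw [qInvFact_of_neg (n := ((0 : ℕ) : ℤ) - t₄) (by push_cast; omega)]
      ring
    · rw [show (0 : ℤ) - t₄ = 0 by omega, qz_zero]; ring
  · simp only [hw]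
    rw [qInvFact_of_neg (n := B₁ - (N + 1 : ℕ)) (by push_cast; omega)]
    ring

/-- Contiguous relation: raise one edge and lower another at the first vertex, with the third
one varying. -/
lemma racahSum_contiguous_mixed (hA : IsGeneric A) {t₁ t₂ t₃ t₄ B₁ B₂ B₃ : ℤ} {N : ℕ}
    (h : B₁ + B₂ + B₃ = t₁ + t₂ + t₃ + t₄) (h₁ : 0 ≤ t₁) (hN : B₁ < N) :
    qz A (B₃ - t₂) * qz A (B₁ - 1 - t₂ - t₃) * racahSum A t₁ t₂ t₃ t₄ B₁ B₂ B₃ N +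
      qz A (B₂ + 1 - t₁) * qz A (B₂ + 1 - t₄) * racahSum A t₁ (t₂ + 1) t₃ t₄ B₁ (B₂ + 1) B₃ N =
    qz A (B₁ + 1 - t₃) * qz A (-1 - t₃) * racahSum A t₁ t₂ (t₃ - 1) t₄ B₁ B₂ (B₃ - 1) N := by
  set w : ℕ → ℂ := fun s => (-1) ^ s * qFact (s + 1) A *
    (qInvFact A (s - t₁) * qInvFact A (s - t₂) * qInvFact A (s + 1 - t₃) * qInvFact A (s - t₄)) *
    (qInvFact A (B₁ - s) * qInvFact A (B₂ + 1 - s) * qInvFact A (B₃ - s)) with hw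
  have key := sum_contiguous hA w N B₂ B₃ B₁ (-2) t₂ t₃ t₁ t₄ (by omega) ?_ ?_ ?_
  · rw [show B₁ + -2 + 1 - t₂ - t₃ = B₁ - 1 - t₂ - t₃ by ring,
      show (-2 : ℤ) + 1 - t₃ = -1 - t₃ by ring] at key
    simp only [racahSum]
    refine Eq.trans ?_ (key.trans ?_)
    · congr 2
      · refine Finset.sum_congr rfl fun s _ => ?_
        simp only [hw, racahTerm]
        rw [show B₂ - s = B₂ + 1 - s - 1 by ring, ← qz_mul_qInvFact hA (B₂ + 1 - s),
          show (s : ℤ) - t₃ = s + 1 - t₃ - 1 by ring, ← qz_mul_qInvFact hA (s + 1 - t₃)]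
        ring
      · refine Finset.sum_congr rfl fun s _ => ?_
        simp only [hw, racahTerm]
        rw [show (s : ℤ) - (t₂ + 1) = s - t₂ - 1 by ring, ← qz_mul_qInvFact hA (s - t₂),
          show (s : ℤ) - t₃ = s + 1 - t₃ - 1 by ring, ← qz_mul_qInvFact hA (s + 1 - t₃)]
        ring
    · congr 1
      refine Finset.sum_congr rfl fun s _ => ?_
      simp only [hw, racahTerm]
      rw [show B₂ - s = B₂ + 1 - s - 1 by ring, ← qz_mul_qInvFact hA (B₂ + 1 - s),
        show B₃ - 1 - s = B₃ - s - 1 by ring, ← qz_mul_qInvFact hA (B₃ - s),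
        show (s : ℤ) - (t₃ - 1) = s + 1 - t₃ by ring]
      ring
  · intro s
    simp only [hw]
    rw [qFact_succ hA (s + 1), show (-2 : ℤ) - s = -((s + 1 : ℕ) + 1) by push_cast; ring, qz_neg]
    push_cast
    have e1 := qz_mul_qInvFact hA (s + 1 - t₁)
    have e2 := qz_mul_qInvFact hA (s + 1 - t₂)
    have e3 := qz_mul_qInvFact hA (s + 2 - t₃)
    have e4 := qz_mul_qInvFact hA (s + 1 - t₄)
    rw [show (s : ℤ) + 1 - t₁ - 1 = s - t₁ by ring] at e1
    rw [show (s : ℤ) + 1 - t₂ - 1 = s - t₂ by ring] at e2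
    rw [show (s : ℤ) + 2 - t₃ - 1 = s + 1 - t₃ by ring] at e3
    rw [show (s : ℤ) + 1 - t₄ - 1 = s - t₄ by ring] at e4
    rw [← e1, ← e2, ← e3, ← e4, show B₂ + 1 - (s + 1) = B₂ + 1 - s - 1 by ring,
      ← qz_mul_qInvFact hA (B₂ + 1 - s),
      show B₁ - (s + 1) = B₁ - s - 1 by ring, ← qz_mul_qInvFact hA (B₁ - s),
      show B₃ - (s + 1) = B₃ - s - 1 by ring, ← qz_mul_qInvFact hA (B₃ - s),
      show (s : ℤ) + 1 + 1 - t₃ = s + 2 - t₃ by ring]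
    ring
  · rcases h₁.lt_or_eq with h | h
    · simp only [hw]
      rw [qInvFact_of_neg (n := ((0 : ℕ) : ℤ) - t₁) (by push_cast; omega)]
      ring
    · rw [show (0 : ℤ) - t₁ = 0 by omega, qz_zero]; ring
  · simp only [hw]
    rw [qInvFact_of_neg (n := B₁ - N) (by omega)]
    ring

/-! ### Admissibility and the symmetries of Racah sums -/

lemma adm_iff {a b c : ℕ} :
    Adm a b c ↔ a ≤ b + c ∧ b ≤ a + c ∧ c ≤ a + b ∧ (a + b + c) % 2 = 0 := by
  rw [Adm, Nat.even_iff]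

lemma exists_eq_of_adm {a b c : ℕ} (h : Adm a b c) :
    ∃ p q r, a = p + q ∧ b = p + r ∧ c = q + r := by
  rw [adm_iff] at h
  exact ⟨(a + b - c) / 2, (a + c - b) / 2, (b + c - a) / 2, by omega, by omega, by omega⟩

lemma adm_of_eq {a b c p q r : ℕ} (ha : a = p + q) (hb : b = p + r) (hc : c = q + r) :
    Adm a b c := by
  rw [adm_iff]; omega

open Classical in
/-- The alternating sum in the tetrahedron evaluation, set to zero for colors that are not
admissible. -/
noncomputable def racahS (A : ℂ) (a b c d e f : ℕ) : ℂ :=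
  if TetAdm a b c d e f then
    racahSum A ((a + b + c) / 2 : ℕ) ((a + e + f) / 2 : ℕ) ((d + b + f) / 2 : ℕ)
      ((d + e + c) / 2 : ℕ) ((a + b + d + e) / 2 : ℕ) ((a + c + d + f) / 2 : ℕ)
      ((b + c + e + f) / 2 : ℕ) (a + b + c + d + e + f + 1)
  else 0

open Classical in
/-- The square of the triangle coefficient of Racah. -/
noncomputable def triSq (A : ℂ) (a b c : ℕ) : ℂ :=
  if Adm a b c then
    (-1) ^ ((a + b + c) / 2) * (qFact ((a + b - c) / 2) A * qFact ((b + c - a) / 2) A *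
      qFact ((c + a - b) / 2) A) / qFact ((a + b + c) / 2 + 1) A
  else 0

lemma racahS_of_not {a b c d e f : ℕ} (h : ¬ TetAdm a b c d e f) : racahS A a b c d e f = 0 :=
  if_neg h

lemma triSq_of_not {a b c : ℕ} (h : ¬ Adm a b c) : triSq A a b c = 0 := if_neg h

lemma triSq_eq {a b c p q r : ℕ} (ha : a = p + q) (hb : b = p + r) (hc : c = q + r) :
    triSq A a b c =
      (-1) ^ (p + q + r) * (qFact p A * qFact q A * qFact r A) / qFact (p + q + r + 1) A := by
  rw [triSq, if_pos (adm_of_eq ha hb hc), show (a + b + c) / 2 = p + q + r by omega,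
    show (a + b - c) / 2 = p by omega, show (b + c - a) / 2 = r by omega,
    show (c + a - b) / 2 = q by omega]
  ring

lemma adm_swap {a b c : ℕ} : Adm a b c ↔ Adm b a c := by simp only [adm_iff]; omega

lemma adm_rotate {a b c : ℕ} : Adm a b c ↔ Adm b c a := by simp only [adm_iff]; omega

lemma triSq_swap (a b c : ℕ) : triSq A a b c = triSq A b a c := by
  by_cases h : Adm a b c
  · obtain ⟨p, q, r, ha, hb, hc⟩ := exists_eq_of_adm h
    rw [triSq_eq ha hb hc, triSq_eq (p := p) (q := r) (r := q) hb ha (by omega),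
      show p + r + q = p + q + r by omega]
    ring
  · rw [triSq_of_not h, triSq_of_not (mt adm_swap.mpr h)]

lemma triSq_rotate (a b c : ℕ) : triSq A a b c = triSq A b c a := by
  by_cases h : Adm a b c
  · obtain ⟨p, q, r, ha, hb, hc⟩ := exists_eq_of_adm h
    rw [triSq_eq ha hb hc, triSq_eq (p := r) (q := p) (r := q) (by omega) (by omega) (by omega),
      show r + p + q = p + q + r by omega]
    ring
  · rw [triSq_of_not h, triSq_of_not (mt adm_rotate.mpr h)]

lemma triSq_swap_right (a b c : ℕ) : triSq A a b c = triSq A a c b := by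
  rw [triSq_rotate, triSq_swap, triSq_rotate, triSq_rotate]

lemma triSq_ne_zero (hA : IsGeneric A) {a b c : ℕ} (h : Adm a b c) : triSq A a b c ≠ 0 := by
  obtain ⟨p, q, r, ha, hb, hc⟩ := exists_eq_of_adm h
  rw [triSq_eq ha hb hc]
  have := qFact_ne_zero hA p
  have := qFact_ne_zero hA q
  have := qFact_ne_zero hA r
  have := qFact_ne_zero hA (p + q + r + 1)
  simp [*]

/-- The twelve differences `Bᵢ - tⱼ` are the twelve triangle inequalities, and integrality of the
`tⱼ` is the parity condition. Hence for a non-admissible coloring no index satisfies all bounds, and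
the sum agrees with the default value 0. Beyond any one `Bᵢ` all terms vanish, which frees the
choice of `N`. -/
lemma racahS_eq {a b c d e f N : ℕ} {t₁ t₂ t₃ t₄ B₁ B₂ B₃ : ℤ}
    (h₁ : 2 * t₁ = a + b + c) (h₂ : 2 * t₂ = a + e + f) (h₃ : 2 * t₃ = d + b + f)
    (h₄ : 2 * t₄ = d + e + c) (k₁ : 2 * B₁ = a + b + d + e) (k₂ : 2 * B₂ = a + c + d + f)
    (k₃ : 2 * B₃ = b + c + e + f) (hN : B₁ < N ∨ B₂ < N ∨ B₃ < N) :
    racahS A a b c d e f = racahSum A t₁ t₂ t₃ t₄ B₁ B₂ B₃ N := by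
  by_cases h : TetAdm a b c d e f
  · rw [racahS, if_pos h, show (((a + b + c) / 2 : ℕ) : ℤ) = t₁ by omega,
      show (((a + e + f) / 2 : ℕ) : ℤ) = t₂ by omega, show (((d + b + f) / 2 : ℕ) : ℤ) = t₃ by omega,
      show (((d + e + c) / 2 : ℕ) : ℤ) = t₄ by omega,
      show (((a + b + d + e) / 2 : ℕ) : ℤ) = B₁ by omega,
      show (((a + c + d + f) / 2 : ℕ) : ℤ) = B₂ by omega,
      show (((b + c + e + f) / 2 : ℕ) : ℤ) = B₃ by omega]
    rw [← racahSum_eq_of_le (N := max N (a + b + c + d + e + f + 1)) (by omega) (le_max_right _ _),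
      ← racahSum_eq_of_le (M := N) hN (le_max_left _ _)]
  · rw [racahS_of_not h]
    symm
    apply Finset.sum_eq_zero
    intro s _
    apply racahTerm_eq_zero
    by_contra hs
    simp only [not_or, not_lt] at hs
    obtain ⟨s1, s2, s3, s4, s5, s6, s7⟩ := hs
    apply h
    simp only [TetAdm, adm_iff]
    refine ⟨⟨?_, ?_, ?_, ?_⟩, ⟨?_, ?_, ?_, ?_⟩, ⟨?_, ?_, ?_, ?_⟩, ⟨?_, ?_, ?_, ?_⟩⟩ <;> omega

/-- A symmetry of the tetrahedron permutes the `tⱼ` among themselves and the `Bᵢ` among themselves,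
and the summand is symmetric in each family. The same reason gives `racahS_swap_right` and
`racahS_flip`. -/
lemma racahS_swap (a b c d e f : ℕ) : racahS A a b c d e f = racahS A b a c e d f := by
  by_cases h : TetAdm a b c d e f
  · simp only [TetAdm, adm_iff] at h
    rw [racahS_eq (a := a) (N := a + b + c + d + e + f + 1) (t₁ := (a + b + c) / 2)
      (t₂ := (a + e + f) / 2) (t₃ := (d + b + f) / 2) (t₄ := (d + e + c) / 2)
      (B₁ := (a + b + d + e) / 2) (B₂ := (a + c + d + f) / 2) (B₃ := (b + c + e + f) / 2)
      (by omega) (by omega) (by omega) (by omega) (by omega) (by omega) (by omega) (by omega),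
      racahS_eq (a := b) (N := a + b + c + d + e + f + 1) (t₁ := (a + b + c) / 2)
      (t₂ := (d + b + f) / 2) (t₃ := (a + e + f) / 2) (t₄ := (d + e + c) / 2)
      (B₁ := (a + b + d + e) / 2) (B₂ := (b + c + e + f) / 2) (B₃ := (a + c + d + f) / 2)
      (by omega) (by omega) (by omega) (by omega) (by omega) (by omega) (by omega) (by omega)]
    exact Finset.sum_congr rfl fun s _ => by unfold racahTerm; ring
  · rw [racahS_of_not h, racahS_of_not]
    contrapose! h
    simp only [TetAdm, adm_iff] at h ⊢
    omega

lemma racahS_swap_right (a b c d e f : ℕ) : racahS A a b c d e f = racahS A a c b d f e := by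
  by_cases h : TetAdm a b c d e f
  · simp only [TetAdm, adm_iff] at h
    rw [racahS_eq (a := a) (N := a + b + c + d + e + f + 1) (t₁ := (a + b + c) / 2)
      (t₂ := (a + e + f) / 2) (t₃ := (d + b + f) / 2) (t₄ := (d + e + c) / 2)
      (B₁ := (a + b + d + e) / 2) (B₂ := (a + c + d + f) / 2) (B₃ := (b + c + e + f) / 2)
      (by omega) (by omega) (by omega) (by omega) (by omega) (by omega) (by omega) (by omega),
      racahS_eq (b := c) (N := a + b + c + d + e + f + 1) (t₁ := (a + b + c) / 2)
      (t₂ := (a + e + f) / 2) (t₃ := (d + e + c) / 2) (t₄ := (d + b + f) / 2)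
      (B₁ := (a + c + d + f) / 2) (B₂ := (a + b + d + e) / 2) (B₃ := (b + c + e + f) / 2)
      (by omega) (by omega) (by omega) (by omega) (by omega) (by omega) (by omega) (by omega)]
    exact Finset.sum_congr rfl fun s _ => by unfold racahTerm; ring
  · rw [racahS_of_not h, racahS_of_not]
    contrapose! h
    simp only [TetAdm, adm_iff] at h ⊢
    omega

lemma racahS_flip (a b c d e f : ℕ) : racahS A a b c d e f = racahS A a e f d b c := by
  by_cases h : TetAdm a b c d e f
  · simp only [TetAdm, adm_iff] at h
    rw [racahS_eq (a := a) (N := a + b + c + d + e + f + 1) (t₁ := (a + b + c) / 2)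
      (t₂ := (a + e + f) / 2) (t₃ := (d + b + f) / 2) (t₄ := (d + e + c) / 2)
      (B₁ := (a + b + d + e) / 2) (B₂ := (a + c + d + f) / 2) (B₃ := (b + c + e + f) / 2)
      (by omega) (by omega) (by omega) (by omega) (by omega) (by omega) (by omega) (by omega),
      racahS_eq (b := e) (N := a + b + c + d + e + f + 1) (t₁ := (a + e + f) / 2)
      (t₂ := (a + b + c) / 2) (t₃ := (d + e + c) / 2) (t₄ := (d + b + f) / 2)
      (B₁ := (a + b + d + e) / 2) (B₂ := (a + c + d + f) / 2) (B₃ := (b + c + e + f) / 2)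
      (by omega) (by omega) (by omega) (by omega) (by omega) (by omega) (by omega) (by omega)]
    exact Finset.sum_congr rfl fun s _ => by unfold racahTerm; ring
  · rw [racahS_of_not h, racahS_of_not]
    contrapose! h
    simp only [TetAdm, adm_iff] at h ⊢
    omega

/-- Exchange of two edges at a vertex of a tetrahedron, relative to the opposite face. -/
lemma racahS_exchange (a x x' i z' z : ℕ) : racahS A a x x' i z' z = racahS A a z z' i x' x := by
  rw [racahS_flip, racahS_swap_right]

/-! ### Racah sums with an edge of color 1 -/

/-- A Racah sum all of whose inequalities hold and one of whose differences vanishes has only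
one term. -/
lemma racahSum_eq_term {t₁ t₂ t₃ t₄ B₁ B₂ B₃ : ℤ} {N : ℕ} (s : ℕ) (hs : s < N)
    (h : (s : ℤ) = t₁ ∨ (s : ℤ) = t₂ ∨ (s : ℤ) = t₃ ∨ (s : ℤ) = t₄)
    (h' : (s : ℤ) = B₁ ∨ (s : ℤ) = B₂ ∨ (s : ℤ) = B₃) :
    racahSum A t₁ t₂ t₃ t₄ B₁ B₂ B₃ N = racahTerm A t₁ t₂ t₃ t₄ B₁ B₂ B₃ s := by
  apply Finset.sum_eq_single_of_mem s (Finset.mem_range.mpr hs)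
  intro k _ hk
  apply racahTerm_eq_zero
  omega

lemma racahS_eq_term {a b c d e f s v₁ v₂ v₃ v₄ u₁ u₂ u₃ : ℕ}
    (h₁ : 2 * s = a + b + c + 2 * v₁) (h₂ : 2 * s = a + e + f + 2 * v₂)
    (h₃ : 2 * s = d + b + f + 2 * v₃) (h₄ : 2 * s = d + e + c + 2 * v₄)
    (k₁ : 2 * s + 2 * u₁ = a + b + d + e) (k₂ : 2 * s + 2 * u₂ = a + c + d + f)
    (k₃ : 2 * s + 2 * u₃ = b + c + e + f)
    (hv : v₁ = 0 ∨ v₂ = 0 ∨ v₃ = 0 ∨ v₄ = 0) (hu : u₁ = 0 ∨ u₂ = 0 ∨ u₃ = 0) :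
    racahS A a b c d e f = (-1) ^ s * qFact (s + 1) A /
      (qFact v₁ A * qFact v₂ A * qFact v₃ A * qFact v₄ A *
        (qFact u₁ A * qFact u₂ A * qFact u₃ A)) := by
  rw [racahS_eq (N := s + u₁ + 1) (t₁ := s - v₁) (t₂ := s - v₂) (t₃ := s - v₃) (t₄ := s - v₄)
    (B₁ := s + u₁) (B₂ := s + u₂) (B₃ := s + u₃)
    (by omega) (by omega) (by omega) (by omega) (by omega) (by omega) (by omega) (by omega),
    racahSum_eq_term s (by omega) (by omega) (by omega), racahTerm,
    qInvFact_of_eq (n := v₁) (by ring), qInvFact_of_eq (n := v₂) (by ring),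
    qInvFact_of_eq (n := v₃) (by ring), qInvFact_of_eq (n := v₄) (by ring),
    qInvFact_of_eq (n := u₁) (by ring), qInvFact_of_eq (n := u₂) (by ring),
    qInvFact_of_eq (n := u₃) (by ring)]
  simp only [div_eq_mul_inv, mul_inv]
  ring

lemma neg_one_pow_mul_self (n : ℕ) : ((-1 : ℂ)) ^ n * (-1) ^ n = 1 := by
  rw [← mul_pow]; simp

/-- The one-term Racah sum and the triangle coefficient cancel up to a single quantum integer. The
spectator `T` vanishes off admissible triples, which makes the evaluation unconditional. The three
lemmas that follow treat the other directions in which the two edges can move by 1. -/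
lemma triSq_mul_racahS_up_up (hA : IsGeneric A) {i x z : ℕ} {k : ℤ} (hk : 2 * k = x + z + 2 - i)
    {T : ℂ} (hT : ¬ Adm i (x + 1) (z + 1) → T = 0) :
    triSq A i (x + 1) (z + 1) * racahS A 1 x (x + 1) i (z + 1) z * T = qz A k * T := by
  by_cases h : Adm i (x + 1) (z + 1)
  · obtain ⟨p, q, r, h1, h2, h3⟩ := exists_eq_of_adm h
    congr 1
    -- For `r = 0` the lowered triple `(i, x, z)` violates a triangle inequality; this matches `[k]
    -- = [0] = 0`.
    rcases r with _ | r
    · rw [racahS_of_not, show k = 0 by omega, qz_zero, mul_zero]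
      simp only [TetAdm, adm_iff]; omega
    · rw [triSq_eq h1 h2 h3, racahS_eq_term (s := p + q + r + 1) (v₁ := q) (v₂ := p) (v₃ := 1)
        (v₄ := 0) (u₁ := 0) (u₂ := 0) (u₃ := r) (by omega) (by omega) (by omega) (by omega)
        (by omega) (by omega) (by omega) (by omega) (by omega), qFact_one hA, qFact_zero,
        qFact_succ hA r, show (r : ℤ) + 1 = k by omega, show p + q + (r + 1) = p + q + r + 1 by ring]
      have := qFact_ne_zero hA p
      have := qFact_ne_zero hA q
      have := qFact_ne_zero hA r
      have := qFact_ne_zero hA (p + q + r + 1 + 1)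
      have := neg_one_pow_mul_self (p + q + r + 1)
      field_simp
      linear_combination (qz A k) * this
  · rw [hT h, mul_zero, mul_zero]

lemma triSq_mul_racahS_down_down (hA : IsGeneric A) {i x z : ℕ} {k : ℤ}
    (hk : 2 * k = -(x + z + i + 4)) {T : ℂ} (hT : ¬ Adm i x z → T = 0) :
    triSq A i x z * racahS A 1 (x + 1) x i z (z + 1) * T = qz A k * T := by
  by_cases h : Adm i x z
  · obtain ⟨p, q, r, h1, h2, h3⟩ := exists_eq_of_adm h
    congr 1
    rw [triSq_eq h1 h2 h3, racahS_eq_term (s := p + q + r + 1) (v₁ := q) (v₂ := p) (v₃ := 0)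
        (v₄ := 1) (u₁ := 0) (u₂ := 0) (u₃ := r) (by omega) (by omega) (by omega) (by omega)
        (by omega) (by omega) (by omega) (by omega) (by omega), qFact_one hA, qFact_zero,
        qFact_succ hA (p + q + r + 1), show k = -((p + q + r + 1 : ℕ) + 1) by push_cast; omega,
        qz_neg]
    have := qFact_ne_zero hA p
    have := qFact_ne_zero hA q
    have := qFact_ne_zero hA r
    have := qFact_ne_zero hA (p + q + r + 1)
    have := neg_one_pow_mul_self (p + q + r)
    field_simp
    rw [pow_succ]
    linear_combination (-qz A ((p + q + r + 1 : ℕ) + 1)) * this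
  · rw [hT h, mul_zero, mul_zero]

lemma triSq_mul_racahS_up_down (hA : IsGeneric A) {i x z : ℕ} {k : ℤ}
    (hk : 2 * k = x + 1 + i - z) {T : ℂ} (hT : ¬ Adm i (x + 1) z → T = 0) :
    triSq A i (x + 1) z * racahS A 1 x (x + 1) i z (z + 1) * T = qz A k * T := by
  by_cases h : Adm i (x + 1) z
  · obtain ⟨p, q, r, h1, h2, h3⟩ := exists_eq_of_adm h
    congr 1
    rcases p with _ | p
    · rw [racahS_of_not, show k = 0 by omega, qz_zero, mul_zero]
      simp only [TetAdm, adm_iff]; omega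
    · rw [triSq_eq h1 h2 h3, racahS_eq_term (s := p + q + r + 1) (v₁ := q) (v₂ := p) (v₃ := 0)
        (v₄ := 0) (u₁ := 0) (u₂ := 1) (u₃ := r) (by omega) (by omega) (by omega) (by omega)
        (by omega) (by omega) (by omega) (by omega) (by omega), qFact_one hA, qFact_zero,
        qFact_succ hA p, show (p : ℤ) + 1 = k by omega, show p + 1 + q + r = p + q + r + 1 by ring]
      have := qFact_ne_zero hA p
      have := qFact_ne_zero hA q
      have := qFact_ne_zero hA r
      have := qFact_ne_zero hA (p + q + r + 1 + 1)
      have := neg_one_pow_mul_self (p + q + r + 1)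
      field_simp
      linear_combination (qz A k) * this
  · rw [hT h, mul_zero, mul_zero]

lemma triSq_mul_racahS_down_up (hA : IsGeneric A) {i x z : ℕ} {k : ℤ}
    (hk : 2 * k = z + 1 + i - x) {T : ℂ} (hT : ¬ Adm i x (z + 1) → T = 0) :
    triSq A i x (z + 1) * racahS A 1 (x + 1) x i (z + 1) z * T = qz A k * T := by
  rw [racahS_exchange, triSq_rotate, triSq_rotate, triSq_swap]
  refine triSq_mul_racahS_up_down hA hk fun h => hT ?_
  simp only [adm_iff] at h ⊢; omega

/-- Only `k = z + 1` and `k = z - 1` form an admissible triple with `1` and `z`; their weights are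
`1/[z + 1]` and `-1/[z + 1]`, and for `z = 0` the second index does not exist. -/
lemma sum_triSq_one (hA : IsGeneric A) (z N : ℕ) (hN : z + 1 < N) (G : ℕ → ℂ) :
    ∑ k ∈ Finset.range N, (-1) ^ k * qz A (k + 1) * triSq A 1 z k * G k =
      (qz A (z + 1))⁻¹ * (G (z + 1) - if z = 0 then 0 else G (z - 1)) := by
  have hup : (-1) ^ (z + 1) * qz A ((z + 1 : ℕ) + 1) * triSq A 1 z (z + 1) = (qz A (z + 1))⁻¹ := by
    rw [triSq_eq (p := 0) (q := 1) (r := z) (by omega) (by omega) (by omega),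
      show 0 + 1 + z = z + 1 by ring, qFact_succ hA (z + 1), qFact_succ hA z, qFact_zero,
      qFact_one hA]
    have := qFact_ne_zero hA z
    have := qz_ne_zero hA (n := (z : ℤ) + 1) (by omega)
    have := qz_ne_zero hA (n := ((z + 1 : ℕ) : ℤ) + 1) (by omega)
    have := neg_one_pow_mul_self (z + 1)
    field_simp
    linear_combination this
  have hdn : ∀ y, z = y + 1 → (-1) ^ y * qz A (y + 1) * triSq A 1 z y = -(qz A (z + 1))⁻¹ := by
    rintro y rfl
    rw [triSq_eq (p := 1) (q := 0) (r := y) (by omega) (by omega) (by omega),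
      show 1 + 0 + y = y + 1 by ring, qFact_succ hA (y + 1), qFact_succ hA y, qFact_zero,
      qFact_one hA]
    have := qFact_ne_zero hA y
    have := qz_ne_zero hA (n := (y : ℤ) + 1) (by omega)
    have := qz_ne_zero hA (n := ((y + 1 : ℕ) : ℤ) + 1) (by omega)
    have := neg_one_pow_mul_self y
    field_simp
    rw [pow_succ]
    linear_combination -this
  rcases z with _ | y
  · rw [Finset.sum_eq_single_of_mem 1 (Finset.mem_range.mpr hN)]
    · rw [if_pos rfl, sub_zero, ← hup]
    · intro k _ hk
      rw [triSq_of_not]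
      · ring
      · simp only [adm_iff]; omega
  · rw [← Finset.sum_subset (s₁ := {y + 1 + 1, y})]
    · rw [Finset.sum_pair (by omega), hup, hdn y rfl]
      simp; ring
    · intro k hk
      simp only [Finset.mem_insert, Finset.mem_singleton] at hk
      rw [Finset.mem_range]; omega
    · intro k _ hk
      simp only [Finset.mem_insert, Finset.mem_singleton, not_or] at hk
      rw [triSq_of_not]
      · ring
      · simp only [adm_iff]; omega

/-! ### The Biedenharn-Elliott identity for color 1 -/

/-- The summand of the right hand side of the Biedenharn-Elliott identity for Racah sums, without
the weight of the summation edge. -/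
noncomputable def pentagonTerm (A : ℂ) (a x x' y y' z d i h k : ℕ) : ℂ :=
  triSq A i x' k * racahS A a x x' i k z * (triSq A h y' k * racahS A a y y' h k z *
    racahS A x' y' d h i k)

/-- The Biedenharn-Elliott identity for Racah sums, for one fixed color `a` of an edge joining the
two apices. -/
def Pentagon (A : ℂ) (a : ℕ) : Prop :=
  ∀ x x' y y' z d i h N : ℕ, a + z < N ∨ x' + i < N ∨ y' + h < N →
    triSq A d x y * racahS A a x x' d y' y * racahS A x y d h i z =
      ∑ k ∈ Finset.range N, (-1) ^ k * qz A (k + 1) * triSq A a z k *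
        pentagonTerm A a x x' y y' z d i h k

section
variable {x y z d h i : ℕ}

/-- By the color-1 evaluations, the left side and the terms for `z + 1` and `z - 1` are multiples of
the three Racah sums in `racahSum_contiguous_up`; the one coefficient left over there is `[z + 1]`.
The patterns down/down and up/down correspond in the same way to the other two contiguous relations.
-/
lemma pentagon_one_up_up (hA : IsGeneric A) (h₁ : (x + y + d) % 2 = 0) (h₂ : (x + i + z) % 2 = 0)
    (h₃ : (h + y + z) % 2 = 0) (h₄ : (h + i + d) % 2 = 0) :
    triSq A d x y * racahS A 1 x (x + 1) d (y + 1) y * racahS A x y d h i z =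
      (qz A (z + 1))⁻¹ * (pentagonTerm A 1 x (x + 1) y (y + 1) z d i h (z + 1) -
        if z = 0 then 0 else pentagonTerm A 1 x (x + 1) y (y + 1) z d i h (z - 1)) := by
  obtain ⟨t₁, e₁⟩ : ∃ t : ℤ, 2 * t = x + y + d := ⟨(x + y + d) / 2, by omega⟩
  obtain ⟨t₂, e₂⟩ : ∃ t : ℤ, 2 * t = x + i + z := ⟨(x + i + z) / 2, by omega⟩
  obtain ⟨t₃, e₃⟩ : ∃ t : ℤ, 2 * t = h + y + z := ⟨(h + y + z) / 2, by omega⟩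
  obtain ⟨t₄, e₄⟩ : ∃ t : ℤ, 2 * t = h + i + d := ⟨(h + i + d) / 2, by omega⟩
  obtain ⟨B₁, f₁⟩ : ∃ t : ℤ, 2 * t = x + y + h + i := ⟨(x + y + h + i) / 2, by omega⟩
  obtain ⟨B₂, f₂⟩ : ∃ t : ℤ, 2 * t = x + d + h + z := ⟨(x + d + h + z) / 2, by omega⟩
  obtain ⟨B₃, f₃⟩ : ∃ t : ℤ, 2 * t = y + d + i + z := ⟨(y + d + i + z) / 2, by omega⟩
  have key := racahSum_contiguous_up hA (t₁ := t₁) (t₂ := t₂) (t₃ := t₃) (t₄ := t₄) (B₁ := B₁)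
    (B₂ := B₂) (B₃ := B₃) (N := x + y + h + i + 3) (by omega) (by omega) (by omega)
  have hL : triSq A d x y * racahS A 1 x (x + 1) d (y + 1) y * racahS A x y d h i z =
      qz A (-2 - t₁) *
        racahSum A t₁ t₂ t₃ t₄ B₁ B₂ B₃ (x + y + h + i + 3) := by
    rw [racahS_swap_right 1, triSq_mul_racahS_down_down hA (k := -2 - t₁) (by omega),
      racahS_eq (N := x + y + h + i + 3) e₁ e₂ e₃ e₄ f₁ f₂ f₃ (by omega)]
    exact fun hn => racahS_of_not fun ht => hn (adm_rotate.mpr ht.1)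
  have hU : pentagonTerm A 1 x (x + 1) y (y + 1) z d i h (z + 1) =
      qz A (B₂ + 1 - t₄) * qz A (B₃ + 1 - t₄) *
      racahSum A (t₁ + 1) (t₂ + 1) (t₃ + 1) t₄ (B₁ + 1) (B₂ + 1) (B₃ + 1)
        (x + y + h + i + 3 + 1) := by
    rw [pentagonTerm, triSq_mul_racahS_up_up hA (i := h) (k := B₃ + 1 - t₄) (by omega),
      triSq_mul_racahS_up_up hA (i := i) (k := B₂ + 1 - t₄) (by omega),
      racahS_eq (t₁ := t₁ + 1) (t₂ := t₂ + 1) (t₃ := t₃ + 1) (t₄ := t₄) (B₁ := B₁ + 1)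
        (B₂ := B₂ + 1) (B₃ := B₃ + 1) (N := x + y + h + i + 3 + 1) (by omega)
        (by omega) (by omega) (by omega) (by omega)
        (by omega) (by omega) (by omega)]
    · ring
    · intro hn; rw [racahS_of_not fun ht => hn (adm_swap.mp ht.2.1), mul_zero]
    · exact fun hn => racahS_of_not fun ht => hn ht.2.2.1
  have hD : (if z = 0 then 0 else pentagonTerm A 1 x (x + 1) y (y + 1) z d i h (z - 1)) =
      qz A (B₁ + 1 - t₂) * qz A (B₁ + 1 - t₃) *
        racahSum A (t₁ + 1) t₂ t₃ t₄ (B₁ + 1) B₂ B₃ (x + y + h + i + 3) := by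
    -- There is no color `-1`: for `z = 0` the bounds on the summation index are contradictory and
    -- the Racah sum is zero, in agreement with the default value.
    rcases z with _ | z
    · rw [if_pos rfl, racahSum, Finset.sum_eq_zero, mul_zero]
      intro s _
      apply racahTerm_eq_zero; omega
    · rw [if_neg (by omega), Nat.add_sub_cancel, pentagonTerm,
        triSq_mul_racahS_up_down hA (i := h) (k := B₁ + 1 - t₂) (by omega),
        triSq_mul_racahS_up_down hA (i := i) (k := B₁ + 1 - t₃) (by omega),
        racahS_eq (t₁ := t₁ + 1) (t₂ := t₂) (t₃ := t₃) (t₄ := t₄) (B₁ := B₁ + 1)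
          (B₂ := B₂) (B₃ := B₃) (N := x + y + h + i + 3) (by omega)
          (by omega) (by omega) (by omega) (by omega)
          (by omega) (by omega) (by omega)]
      · ring
      · intro hn; rw [racahS_of_not fun ht => hn (adm_swap.mp ht.2.1), mul_zero]
      · exact fun hn => racahS_of_not fun ht => hn ht.2.2.1
  rw [hL, hU, hD, ← key, show B₂ + B₃ + 1 - t₁ - t₄ = z + 1 by omega]
  have := qz_ne_zero hA (n := (z : ℤ) + 1) (by omega)
  field_simp
  ring

lemma pentagon_one_down_down (hA : IsGeneric A) (h₁ : (x + y + d) % 2 = 0)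
    (h₂ : (x + 1 + i + z) % 2 = 0) (h₃ : (h + y + 1 + z) % 2 = 0) (h₄ : (h + i + d) % 2 = 0) :
    triSq A d (x + 1) (y + 1) * racahS A 1 (x + 1) x d y (y + 1) *
        racahS A (x + 1) (y + 1) d h i z =
      (qz A (z + 1))⁻¹ * (pentagonTerm A 1 (x + 1) x (y + 1) y z d i h (z + 1) -
        if z = 0 then 0 else pentagonTerm A 1 (x + 1) x (y + 1) y z d i h (z - 1)) := by
  obtain ⟨t₁, e₁⟩ : ∃ t : ℤ, 2 * t = x + y + d + 2 := ⟨(x + y + d + 2) / 2, by omega⟩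
  obtain ⟨t₂, e₂⟩ : ∃ t : ℤ, 2 * t = x + 1 + i + z := ⟨(x + 1 + i + z) / 2, by omega⟩
  obtain ⟨t₃, e₃⟩ : ∃ t : ℤ, 2 * t = h + y + 1 + z := ⟨(h + y + 1 + z) / 2, by omega⟩
  obtain ⟨t₄, e₄⟩ : ∃ t : ℤ, 2 * t = h + i + d := ⟨(h + i + d) / 2, by omega⟩
  obtain ⟨B₁, f₁⟩ : ∃ t : ℤ, 2 * t = x + y + 2 + h + i := ⟨(x + y + 2 + h + i) / 2, by omega⟩
  obtain ⟨B₂, f₂⟩ : ∃ t : ℤ, 2 * t = x + 1 + d + h + z := ⟨(x + 1 + d + h + z) / 2, by omega⟩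
  obtain ⟨B₃, f₃⟩ : ∃ t : ℤ, 2 * t = y + 1 + d + i + z := ⟨(y + 1 + d + i + z) / 2, by omega⟩
  have key := racahSum_contiguous_down hA (t₁ := t₁) (t₂ := t₂) (t₃ := t₃) (t₄ := t₄) (B₁ := B₁)
    (B₂ := B₂) (B₃ := B₃) (N := x + y + h + i + 3) (by omega) (by omega) (by omega)
  have hL : triSq A d (x + 1) (y + 1) * racahS A 1 (x + 1) x d y (y + 1) *
        racahS A (x + 1) (y + 1) d h i z =
      qz A (B₁ - t₄) * racahSum A t₁ t₂ t₃ t₄ B₁ B₂ B₃ (x + y + h + i + 3 + 1) := by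
    rw [racahS_swap_right 1, triSq_mul_racahS_up_up hA (k := B₁ - t₄) (by omega),
      racahS_eq (t₁ := t₁) (t₂ := t₂) (t₃ := t₃) (t₄ := t₄) (B₁ := B₁)
        (B₂ := B₂) (B₃ := B₃) (N := x + y + h + i + 3 + 1) (by omega)
        (by omega) (by omega) (by omega) (by omega)
        (by omega) (by omega) (by omega)]
    exact fun hn => racahS_of_not fun ht => hn (adm_rotate.mpr ht.1)
  have hU : pentagonTerm A 1 (x + 1) x (y + 1) y z d i h (z + 1) =
      qz A (B₂ + 1 - t₁) * qz A (B₃ + 1 - t₁) *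
      racahSum A (t₁ - 1) t₂ t₃ t₄ (B₁ - 1) B₂ B₃ (x + y + h + i + 3 + 1) := by
    rw [pentagonTerm, triSq_mul_racahS_down_up hA (i := h) (k := B₂ + 1 - t₁) (by omega),
      triSq_mul_racahS_down_up hA (i := i) (k := B₃ + 1 - t₁) (by omega),
      racahS_eq (t₁ := t₁ - 1) (t₂ := t₂) (t₃ := t₃) (t₄ := t₄) (B₁ := B₁ - 1)
        (B₂ := B₂) (B₃ := B₃) (N := x + y + h + i + 3 + 1) (by omega)
        (by omega) (by omega) (by omega) (by omega)
        (by omega) (by omega) (by omega)]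
    · ring
    · intro hn; rw [racahS_of_not fun ht => hn (adm_swap.mp ht.2.1), mul_zero]
    · exact fun hn => racahS_of_not fun ht => hn ht.2.2.1
  have hD : (if z = 0 then 0 else pentagonTerm A 1 (x + 1) x (y + 1) y z d i h (z - 1)) =
      qz A (-1 - t₂) * qz A (-1 - t₃) * racahSum A (t₁ - 1) (t₂ - 1) (t₃ - 1) t₄
        (B₁ - 1) (B₂ - 1) (B₃ - 1) (x + y + h + i + 3) := by
    rcases z with _ | z
    · rw [if_pos rfl, racahSum, Finset.sum_eq_zero, mul_zero]
      intro s _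
      apply racahTerm_eq_zero; omega
    · rw [if_neg (by omega), Nat.add_sub_cancel, pentagonTerm,
        triSq_mul_racahS_down_down hA (i := h) (k := -1 - t₃) (by omega),
        triSq_mul_racahS_down_down hA (i := i) (k := -1 - t₂) (by omega),
        racahS_eq (t₁ := t₁ - 1) (t₂ := t₂ - 1) (t₃ := t₃ - 1) (t₄ := t₄) (B₁ := B₁ - 1)
          (B₂ := B₂ - 1) (B₃ := B₃ - 1) (N := x + y + h + i + 3) (by omega)
          (by omega) (by omega) (by omega) (by omega)
          (by omega) (by omega) (by omega)]
      · ring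
      · intro hn; rw [racahS_of_not fun ht => hn (adm_swap.mp ht.2.1), mul_zero]
      · exact fun hn => racahS_of_not fun ht => hn ht.2.2.1
  rw [hL, hU, hD, ← key, show B₂ + B₃ + 1 - t₄ - t₁ = z + 1 by omega]
  have := qz_ne_zero hA (n := (z : ℤ) + 1) (by omega)
  field_simp
  ring

lemma pentagon_one_up_down (hA : IsGeneric A) (h₁ : (x + y + 1 + d) % 2 = 0)
    (h₂ : (x + i + z) % 2 = 0) (h₃ : (h + y + 1 + z) % 2 = 0) (h₄ : (h + i + d) % 2 = 0) :
    triSq A d x (y + 1) * racahS A 1 x (x + 1) d y (y + 1) *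
        racahS A x (y + 1) d h i z =
      (qz A (z + 1))⁻¹ * (pentagonTerm A 1 x (x + 1) (y + 1) y z d i h (z + 1) -
        if z = 0 then 0 else pentagonTerm A 1 x (x + 1) (y + 1) y z d i h (z - 1)) := by
  obtain ⟨t₁, e₁⟩ : ∃ t : ℤ, 2 * t = x + y + 1 + d := ⟨(x + y + 1 + d) / 2, by omega⟩
  obtain ⟨t₂, e₂⟩ : ∃ t : ℤ, 2 * t = x + i + z := ⟨(x + i + z) / 2, by omega⟩
  obtain ⟨t₃, e₃⟩ : ∃ t : ℤ, 2 * t = h + y + 1 + z := ⟨(h + y + 1 + z) / 2, by omega⟩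
  obtain ⟨t₄, e₄⟩ : ∃ t : ℤ, 2 * t = h + i + d := ⟨(h + i + d) / 2, by omega⟩
  obtain ⟨B₁, f₁⟩ : ∃ t : ℤ, 2 * t = x + y + 1 + h + i := ⟨(x + y + 1 + h + i) / 2, by omega⟩
  obtain ⟨B₂, f₂⟩ : ∃ t : ℤ, 2 * t = x + d + h + z := ⟨(x + d + h + z) / 2, by omega⟩
  obtain ⟨B₃, f₃⟩ : ∃ t : ℤ, 2 * t = y + 1 + d + i + z := ⟨(y + 1 + d + i + z) / 2, by omega⟩
  have key := racahSum_contiguous_mixed hA (t₁ := t₁) (t₂ := t₂) (t₃ := t₃) (t₄ := t₄) (B₁ := B₁)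
    (B₂ := B₂) (B₃ := B₃) (N := x + y + h + i + 3) (by omega) (by omega) (by omega)
  have hL : triSq A d x (y + 1) * racahS A 1 x (x + 1) d y (y + 1) *
        racahS A x (y + 1) d h i z =
      qz A (B₃ - t₂) * racahSum A t₁ t₂ t₃ t₄ B₁ B₂ B₃ (x + y + h + i + 3) := by
    rw [racahS_swap_right 1, triSq_mul_racahS_down_up hA (k := B₃ - t₂) (by omega),
      racahS_eq (t₁ := t₁) (t₂ := t₂) (t₃ := t₃) (t₄ := t₄) (B₁ := B₁)
        (B₂ := B₂) (B₃ := B₃) (N := x + y + h + i + 3) (by omega)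
        (by omega) (by omega) (by omega) (by omega)
        (by omega) (by omega) (by omega)]
    exact fun hn => racahS_of_not fun ht => hn (adm_rotate.mpr ht.1)
  have hU : pentagonTerm A 1 x (x + 1) (y + 1) y z d i h (z + 1) =
      qz A (B₂ + 1 - t₁) * qz A (B₂ + 1 - t₄) *
      racahSum A t₁ (t₂ + 1) t₃ t₄ B₁ (B₂ + 1) B₃ (x + y + h + i + 3) := by
    rw [pentagonTerm, triSq_mul_racahS_down_up hA (i := h) (k := B₂ + 1 - t₁) (by omega),
      triSq_mul_racahS_up_up hA (i := i) (k := B₂ + 1 - t₄) (by omega),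
      racahS_eq (t₁ := t₁) (t₂ := t₂ + 1) (t₃ := t₃) (t₄ := t₄) (B₁ := B₁)
        (B₂ := B₂ + 1) (B₃ := B₃) (N := x + y + h + i + 3) (by omega)
        (by omega) (by omega) (by omega) (by omega)
        (by omega) (by omega) (by omega)]
    · ring
    · intro hn; rw [racahS_of_not fun ht => hn (adm_swap.mp ht.2.1), mul_zero]
    · exact fun hn => racahS_of_not fun ht => hn ht.2.2.1
  have hD : (if z = 0 then 0 else pentagonTerm A 1 x (x + 1) (y + 1) y z d i h (z - 1)) =
      qz A (B₁ + 1 - t₃) * qz A (-1 - t₃) * racahSum A t₁ t₂ (t₃ - 1) t₄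
        B₁ B₂ (B₃ - 1) (x + y + h + i + 3) := by
    rcases z with _ | z
    · rw [if_pos rfl, racahSum, Finset.sum_eq_zero, mul_zero]
      intro s _
      apply racahTerm_eq_zero; omega
    · rw [if_neg (by omega), Nat.add_sub_cancel, pentagonTerm,
        triSq_mul_racahS_down_down hA (i := h) (k := -1 - t₃) (by omega),
        triSq_mul_racahS_up_down hA (i := i) (k := B₁ + 1 - t₃) (by omega),
        racahS_eq (t₁ := t₁) (t₂ := t₂) (t₃ := t₃ - 1) (t₄ := t₄) (B₁ := B₁)
          (B₂ := B₂) (B₃ := B₃ - 1) (N := x + y + h + i + 3) (by omega)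
          (by omega) (by omega) (by omega) (by omega)
          (by omega) (by omega) (by omega)]
      · ring
      · intro hn; rw [racahS_of_not fun ht => hn (adm_swap.mp ht.2.1), mul_zero]
      · exact fun hn => racahS_of_not fun ht => hn ht.2.2.1
  rw [hL, hU, hD, ← key, show B₁ - 1 - t₂ - t₃ = -(z + 1) by omega, qz_neg]
  have := qz_ne_zero hA (n := (z : ℤ) + 1) (by omega)
  field_simp
  ring

end

lemma pentagonTerm_swap (a x x' y y' z d i h k : ℕ) :
    pentagonTerm A a x x' y y' z d i h k = pentagonTerm A a y y' x x' z d h i k := by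
  rw [pentagonTerm, pentagonTerm, racahS_swap x' y']
  ring

lemma pentagonTerm_of_not {a x x' y y' z d i h k : ℕ}
    (hn : ¬ (Adm a x x' ∧ Adm a y y' ∧ TetAdm x' y' d h i k ∧ Adm a k z)) :
    pentagonTerm A a x x' y y' z d i h k = 0 := by
  rw [pentagonTerm]
  by_cases h1 : TetAdm x' y' d h i k
  · by_cases h2 : TetAdm a x x' i k z
    · rw [racahS_of_not (a := a) (b := y)]
      · ring
      · contrapose! hn
        exact ⟨h2.1, hn.1, h1, h2.2.1⟩
    · rw [racahS_of_not h2]; ring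
  · rw [racahS_of_not h1]; ring

lemma sum_pentagonTerm_eq {a x x' y y' z d i h M N : ℕ}
    (hM : a + z < M ∨ x' + i < M ∨ y' + h < M) (hN : a + z < N ∨ x' + i < N ∨ y' + h < N) :
    ∑ k ∈ Finset.range M, (-1) ^ k * qz A (k + 1) * triSq A a z k *
        pentagonTerm A a x x' y y' z d i h k =
      ∑ k ∈ Finset.range N, (-1) ^ k * qz A (k + 1) * triSq A a z k *
        pentagonTerm A a x x' y y' z d i h k := by
  wlog hMN : M ≤ N generalizing M N
  · exact (this hN hM (by omega)).symm
  refine Finset.sum_subset (Finset.range_subset_range.mpr hMN) fun k _ hk => ?_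
  rw [Finset.mem_range, not_lt] at hk
  rcases hM with hM | hM | hM
  · rw [triSq_of_not]
    · ring
    · rw [adm_iff]; omega
  all_goals
    rw [pentagonTerm_of_not, mul_zero]
    simp only [TetAdm, adm_iff]; omega

lemma pentagon_one (hA : IsGeneric A) : Pentagon A 1 := by
  intro x x' y y' z d i h N hN
  rw [sum_pentagonTerm_eq hN (N := 1 + z + 1) (by omega), sum_triSq_one hA z _ (by omega)]
  by_cases hx : Adm 1 x x' ∧ Adm 1 y y' ∧ (x + y + d) % 2 = 0 ∧ (x + i + z) % 2 = 0 ∧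
      (h + y + z) % 2 = 0 ∧ (h + i + d) % 2 = 0
  · obtain ⟨hx, hy, h₁, h₂, h₃, h₄⟩ := hx
    rw [adm_iff] at hx hy
    obtain rfl | rfl : x' = x + 1 ∨ x = x' + 1 := by omega
    · obtain rfl | rfl : y' = y + 1 ∨ y = y' + 1 := by omega
      · exact pentagon_one_up_up hA h₁ h₂ h₃ h₄
      · exact pentagon_one_up_down hA (by omega) (by omega) (by omega) (by omega)
    · obtain rfl | rfl : y' = y + 1 ∨ y = y' + 1 := by omega
      -- Down/up is the mirror image of up/down, with `(x, x', i)` and `(y, y', h)` exchanged.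
      · rw [pentagonTerm_swap, pentagonTerm_swap (k := z - 1), racahS_swap (x' + 1) y,
          racahS_exchange, triSq_swap_right]
        exact pentagon_one_up_down hA (by omega) (by omega) (by omega) (by omega)
      · exact pentagon_one_down_down hA (by omega) (by omega) (by omega) (by omega)
  -- If a parity or one of the two triples containing the color 1 fails, both sides are zero.
  · have hz : ∀ k, (k + z) % 2 = 1 → pentagonTerm A 1 x x' y y' z d i h k = 0 := by
      intro k hk
      apply pentagonTerm_of_not
      contrapose! hx
      simp only [TetAdm, adm_iff] at hx ⊢
      omega
    rw [hz (z + 1) (by omega)]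
    have hz' : (if z = 0 then 0 else pentagonTerm A 1 x x' y y' z d i h (z - 1)) = 0 := by
      split_ifs with h0
      · rfl
      · exact hz _ (by omega)
    rw [hz', sub_zero, mul_zero]
    by_cases h1 : TetAdm 1 x x' d y' y
    · rw [racahS_of_not (a := x), mul_zero]
      contrapose! hx
      simp only [TetAdm, adm_iff] at hx h1 ⊢
      omega
    · rw [racahS_of_not h1]; ring

/-! ### Color 0, fusion and the induction on the color -/

lemma triSq_mul_racahS_zero (hA : IsGeneric A) {i x z : ℕ} {T : ℂ} (hT : ¬ Adm i x z → T = 0) :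
    triSq A i x z * racahS A 0 x x i z z * T = T := by
  by_cases h : Adm i x z
  · obtain ⟨p, q, r, h1, h2, h3⟩ := exists_eq_of_adm h
    rw [triSq_eq h1 h2 h3, racahS_eq_term (s := p + q + r) (v₁ := q) (v₂ := p) (v₃ := 0)
        (v₄ := 0) (u₁ := 0) (u₂ := 0) (u₃ := r) (by omega) (by omega) (by omega) (by omega)
        (by omega) (by omega) (by omega) (by omega) (by omega), qFact_zero]
    have := qFact_ne_zero hA p
    have := qFact_ne_zero hA q
    have := qFact_ne_zero hA r
    have := qFact_ne_zero hA (p + q + r + 1)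
    have := neg_one_pow_mul_self (p + q + r)
    field_simp
    linear_combination T * this
  · rw [hT h, mul_zero]

lemma triSq_zero_self (hA : IsGeneric A) (z : ℕ) :
    (-1) ^ z * qz A (z + 1) * triSq A 0 z z = 1 := by
  rw [triSq_eq (p := 0) (q := 0) (r := z) (by omega) (by omega) (by omega), qFact_zero,
    show 0 + 0 + z = z by ring, qFact_succ hA z]
  have := qFact_ne_zero hA z
  have := qz_ne_zero hA (n := (z : ℤ) + 1) (by omega)
  have := neg_one_pow_mul_self z
  field_simp
  linear_combination this

lemma pentagon_zero (hA : IsGeneric A) : Pentagon A 0 := by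
  intro x x' y y' z d i h N hN
  rw [sum_pentagonTerm_eq hN (N := 0 + z + 1) (by omega), Finset.sum_eq_single_of_mem z (by simp)]
  · by_cases hx : x = x' ∧ y = y'
    · obtain ⟨rfl, rfl⟩ := hx
      have hh : ¬ Adm h y z → racahS A x y d h i z = 0 :=
        fun hn => racahS_of_not fun ht => hn ht.2.2.1
      have hi : ¬ Adm i x z → racahS A x y d h i z = 0 :=
        fun hn => racahS_of_not fun ht => hn (adm_swap.mp ht.2.1)
      have hd : ¬ Adm d x y → racahS A x y d h i z = 0 :=
        fun hn => racahS_of_not fun ht => hn (adm_rotate.mpr ht.1)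
      rw [triSq_zero_self hA, one_mul, pentagonTerm, triSq_mul_racahS_zero hA hd,
        triSq_mul_racahS_zero hA hh, triSq_mul_racahS_zero hA hi]
    · rw [pentagonTerm_of_not, racahS_of_not (a := 0)]
      · ring
      · simp only [TetAdm, adm_iff]; omega
      · simp only [adm_iff]; omega
  · intro k _ hk
    rw [triSq_of_not]
    · ring
    · rw [adm_iff]; omega

/-- A one-term sum leaves no room for cancellation. This permits dividing by the fusion coefficient
in the induction step. -/
lemma racahS_one_ne_zero (hA : IsGeneric A) {y y' y'' n : ℕ} (h : TetAdm 1 y y'' y' n (n + 1)) :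
    racahS A 1 y y'' y' n (n + 1) ≠ 0 := by
  simp only [TetAdm, adm_iff] at h
  have hq := fun k => qFact_ne_zero hA k
  obtain rfl | rfl : y'' = y + 1 ∨ y = y'' + 1 := by omega
  · rw [racahS_eq_term (s := (y' + y + n + 1) / 2) (v₁ := (y' + n - y - 1) / 2)
      (v₂ := (y' + y - n - 1) / 2) (v₃ := 0) (v₄ := 0) (u₁ := 0) (u₂ := 1)
      (u₃ := (y + n + 1 - y') / 2) (by omega) (by omega) (by omega) (by omega)
        (by omega) (by omega) (by omega) (by omega) (by omega)]
    simp [hq]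
  · rw [racahS_eq_term (s := (y' + y'' + n + 2) / 2) (v₁ := (y' + n - y'') / 2)
      (v₂ := (y' + y'' - n) / 2) (v₃ := 0) (v₄ := 1) (u₁ := 0) (u₂ := 0)
      (u₃ := (y'' + n - y') / 2) (by omega) (by omega) (by omega) (by omega)
        (by omega) (by omega) (by omega) (by omega) (by omega)]
    simp [hq]

/-- The Racah sums with color `n + 1` are fused from those with colors `1` and `n`. -/
lemma racahS_fusion (hA : IsGeneric A) {n x x' y y' y'' d N : ℕ}
    (hN : 1 + x < N ∨ y'' + d < N ∨ n + x' < N) :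
    triSq A y' y (n + 1) * racahS A 1 y y'' y' n (n + 1) * racahS A (n + 1) x x' d y' y =
      ∑ k ∈ Finset.range N, (-1) ^ k * qz A (k + 1) * triSq A 1 x k *
        (triSq A d y'' k * racahS A 1 y y'' d k x *
          (triSq A x' n k * racahS A 1 x k x' n (n + 1) * racahS A n k x' d y' y'')) := by
  have h := pentagon_one hA y y'' (n + 1) n x y' d x' N hN
  rw [racahS_swap y, racahS_flip (n + 1), racahS_swap_right (n + 1)] at h
  rw [h]
  refine Finset.sum_congr rfl fun k _ => ?_
  rw [pentagonTerm, racahS_exchange 1 (n + 1), racahS_swap y'' n, racahS_flip n y'',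
    racahS_swap_right n x']

/-- The edge of color `n + 1` is split into edges of colors 1 and `n` through an intermediate color
`y''`. On the left, one fusion followed by the identities for 1 and for `n` introduces sums over
`k`, `l`, `m`; on the right, the sum over `m` is present and two fusions introduce `l` and `k`. -/
lemma pentagon_succ (hA : IsGeneric A) {n : ℕ} (hn : Pentagon A n) : Pentagon A (n + 1) := by
  intro x x' y y' z d i h N' hN'
  by_cases hy : Adm (n + 1) y y'
  swap
  · rw [racahS_of_not (a := n + 1)]
    · rw [mul_zero, zero_mul]
      symm
      refine Finset.sum_eq_zero fun k _ => ?_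
      rw [pentagonTerm_of_not fun h => hy h.2.1, mul_zero]
    · simp only [TetAdm, adm_iff] at hy ⊢; omega
  -- `y''` is one step from `y` towards `y'`. For `y = y'` the step goes down, which is possible
  -- because `2y ≥ n + 1 > 0`.
  obtain ⟨y'', hV⟩ : ∃ y'', TetAdm 1 y y'' y' n (n + 1) := by
    rw [adm_iff] at hy
    rcases lt_or_ge y y' with hlt | hge
    · refine ⟨y + 1, ?_⟩
      simp only [TetAdm, adm_iff]; omega
    · refine ⟨y - 1, ?_⟩
      simp only [TetAdm, adm_iff]; omega
  have hc : triSq A y' y (n + 1) * racahS A 1 y y'' y' n (n + 1) ≠ 0 :=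
    mul_ne_zero (triSq_ne_zero hA (adm_swap.mp (adm_rotate.mp hy))) (racahS_one_ne_zero hA hV)
  set c := triSq A y' y (n + 1) * racahS A 1 y y'' y' n (n + 1) with hcdef
  apply mul_left_cancel₀ hc
  obtain ⟨N, hNdef⟩ : ∃ N, N = n + x' + y' + y'' + h + z + 2 := ⟨_, rfl⟩
  rw [sum_pentagonTerm_eq hN' (N := N) (by omega)]
  -- The common triple summand: a weight for each summation edge, eight triangle coefficients and
  -- six Racah sums.
  set F : ℕ → ℕ → ℕ → ℂ := fun k l m =>
    ((-1) ^ k * qz A (k + 1)) * ((-1) ^ l * qz A (l + 1)) * ((-1) ^ m * qz A (m + 1)) *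
    (triSq A 1 x k * triSq A x' n k * triSq A 1 z l * triSq A i k l * triSq A h y'' l *
      triSq A n l m * triSq A i x' m * triSq A h y' m) *
    (racahS A 1 x k x' n (n + 1) * racahS A 1 x k i l z * racahS A 1 y y'' h l z *
      racahS A n k x' i m l * racahS A n y'' y' h m l * racahS A x' y' d h i m) with hF
  have hL : c * (triSq A d x y * racahS A (n + 1) x x' d y' y * racahS A x y d h i z) =
      ∑ k ∈ Finset.range N, ∑ l ∈ Finset.range N, ∑ m ∈ Finset.range N, F k l m := by
    have hf := racahS_fusion hA (n := n) (x := x) (x' := x') (y := y) (y' := y') (y'' := y'')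
      (d := d) (N := N) (by omega)
    rw [← hcdef] at hf
    rw [show c * (triSq A d x y * racahS A (n + 1) x x' d y' y * racahS A x y d h i z) =
      triSq A d x y * racahS A x y d h i z * (c * racahS A (n + 1) x x' d y' y) by ring, hf,
      Finset.mul_sum]
    refine Finset.sum_congr rfl fun k _ => ?_
    have h1 := pentagon_one hA x k y y'' z d i h N (by omega)
    rw [racahS_exchange 1 y y'' d k x, triSq_swap_right d y'' k]
    trans ((-1) ^ k * qz A (k + 1) * triSq A 1 x k * triSq A d k y'' * triSq A x' n k *
      racahS A 1 x k x' n (n + 1) * racahS A n k x' d y' y'') *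
      (triSq A d x y * racahS A 1 x k d y'' y * racahS A x y d h i z)
    · ring
    rw [h1, Finset.mul_sum]
    refine Finset.sum_congr rfl fun l _ => ?_
    have h2 := hn k x' y'' y' l d i h N (by omega)
    rw [pentagonTerm]
    trans ((-1) ^ k * qz A (k + 1) * triSq A 1 x k * triSq A x' n k *
      racahS A 1 x k x' n (n + 1) * ((-1) ^ l * qz A (l + 1) * triSq A 1 z l) *
      (triSq A i k l * racahS A 1 x k i l z * triSq A h y'' l * racahS A 1 y y'' h l z)) *
      (triSq A d k y'' * racahS A n k x' d y' y'' * racahS A k y'' d h i l)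
    · ring
    rw [h2, Finset.mul_sum]
    refine Finset.sum_congr rfl fun m _ => ?_
    rw [pentagonTerm, hF]
    ring
  rw [hL, Finset.mul_sum, Finset.sum_comm, Finset.sum_congr rfl fun l _ => Finset.sum_comm,
    Finset.sum_comm]
  refine Finset.sum_congr rfl fun m _ => ?_
  have hf := racahS_fusion hA (n := n) (x := z) (x' := m) (y := y) (y' := y') (y'' := y'')
      (d := h) (N := N) (by omega)
  rw [← hcdef] at hf
  symm
  rw [pentagonTerm, racahS_exchange (n + 1) y y' h m z]
  trans ((-1) ^ m * qz A (m + 1) * triSq A (n + 1) z m * (triSq A i x' m *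
    racahS A (n + 1) x x' i m z * triSq A h y' m * racahS A x' y' d h i m)) *
    (c * racahS A (n + 1) z m h y' y)
  · ring
  rw [hf, Finset.mul_sum]
  refine Finset.sum_congr rfl fun l _ => ?_
  have hg := racahS_fusion hA (n := n) (x := x) (x' := x') (y := z) (y' := m) (y'' := l)
      (d := i) (N := N) (by omega)
  rw [triSq_rotate (n + 1), triSq_swap z m]
  trans ((-1) ^ m * qz A (m + 1) * triSq A i x' m * triSq A h y' m * racahS A x' y' d h i m *
    ((-1) ^ l * qz A (l + 1) * triSq A 1 z l * triSq A h y'' l * racahS A 1 y y'' h l z *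
    triSq A m n l * racahS A n l m h y' y'')) *
    (triSq A m z (n + 1) * racahS A 1 z l m n (n + 1) * racahS A (n + 1) x x' i m z)
  · ring
  rw [hg, Finset.mul_sum]
  refine Finset.sum_congr rfl fun k _ => ?_
  rw [hF, racahS_exchange 1 z l i k x, racahS_exchange n l m h y' y'', triSq_rotate m n l,
    triSq_swap_right i l k]
  ring

/-- The Biedenharn-Elliott identity for Racah sums. -/
theorem pentagon (hA : IsGeneric A) (a : ℕ) : Pentagon A a := by
  induction a with
  | zero => exact pentagon_zero hA
  | succ n ih => exact pentagon_succ hA ih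

/-! ### Orthogonality of Racah sums -/

/-- Orthogonality of the Racah sums. -/
theorem racahS_orthogonality (hA : IsGeneric A) {a b c d e g N : ℕ} (h₁ : Adm a b c)
    (h₂ : Adm d e c) (hN : a + e < N) :
    ∑ f ∈ Finset.range N, (-1) ^ f * qz A (f + 1) * (triSq A a e f * triSq A d b f) *
      (racahS A a b c d e f * racahS A a b g d e f) * (triSq A a b c * triSq A d e c) *
        ((-1) ^ c * qz A (c + 1)) = if c = g then 1 else 0 := by
  -- With color 0 in the place of `y`, one Racah sum on the right is absorbed by its triangle
  -- coefficient, and the left side contains `triSq A c g 0`, which vanishes unless `c = g`.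
  have h := pentagon hA a g b 0 a e c d e N (by omega)
  have hR : ∀ k : ℕ, (-1) ^ k * qz A (k + 1) * triSq A a e k *
      pentagonTerm A a g b 0 a e c d e k =
      (-1) ^ k * qz A (k + 1) * (triSq A a e k * triSq A d b k) *
      (racahS A a b c d e k * racahS A a b g d e k) := by
    intro k
    have hz := triSq_mul_racahS_zero hA (i := k) (x := a) (z := e) (T := racahS A b a c e d k)
      fun hn => racahS_of_not fun ht => hn (adm_swap.mp (adm_rotate.mp ht.2.2.1))
    have hs : triSq A e a k = triSq A k a e := by rw [triSq_rotate, triSq_swap]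
    rw [pentagonTerm, racahS_swap a 0, hs, hz, racahS_swap b a, racahS_swap_right a g]
    ring
  simp only [hR] at h
  rw [← Finset.sum_mul, ← Finset.sum_mul, ← h]
  split_ifs with hcg
  · subst hcg
    have e1 : triSq A a b c * racahS A a c b c a 0 = 1 := by
      have := triSq_mul_racahS_zero hA (i := b) (x := a) (z := c) (T := 1)
        (fun hn => absurd (by simp only [adm_iff] at h₁ ⊢; omega) hn)
      rw [racahS_flip, racahS_swap_right, racahS_swap, triSq_rotate]
      rw [triSq_swap_right] at this
      simpa using this
    have e2 : triSq A d e c * racahS A c 0 c e d e = 1 := by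
      have := triSq_mul_racahS_zero hA (i := d) (x := c) (z := e) (T := 1)
        (fun hn => absurd (by simp only [adm_iff] at h₂ ⊢; omega) hn)
      rw [racahS_swap, triSq_swap_right]
      simpa using this
    have e3 := triSq_zero_self hA c
    rw [triSq_rotate c c 0, triSq_rotate c 0 c]
    linear_combination (triSq A a b c * racahS A a c b c a 0) * (triSq A d e c * racahS A c 0 c e d e) * e3 + (triSq A d e c * racahS A c 0 c e d e) * e1 + e2
  · rw [triSq_of_not]
    · ring
    · rw [adm_iff]; omega

/-! ### Analytic square roots of quantum factorials -/

/-- The quantum integer `[n]` normalized to a polynomial with constant term `1`. -/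
noncomputable def qPoly (n : ℕ) (A : ℂ) : ℂ := ∑ k ∈ Finset.range n, A ^ (4 * k)

/-- A square root of `qPoly n` on the disc. -/
noncomputable def qRoot (n : ℕ) (A : ℂ) : ℂ :=
  ∏ ζ ∈ (Polynomial.nthRootsFinset n (1 : ℂ)).erase 1, (1 - ζ * A ^ 4) ^ (((2 : ℕ) : ℂ)⁻¹)

/-- The normalized quantum factorial. -/
noncomputable def qPolyFact (n : ℕ) (A : ℂ) : ℂ := ∏ k ∈ Finset.range n, qPoly (k + 1) A

/-- A square root of the normalized quantum factorial. -/
noncomputable def qRootFact (n : ℕ) (A : ℂ) : ℂ := ∏ k ∈ Finset.range n, qRoot (k + 1) A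

/-- Cancel `1 - q` from the factorization of `1 - q ^ n`; the value at `q = 1` follows by density.
-/
lemma prod_one_sub_root_mul {n : ℕ} (hn : 0 < n) (q : ℂ) :
    ∏ ζ ∈ (Polynomial.nthRootsFinset n (1 : ℂ)).erase 1, (1 - ζ * q) =
      ∑ k ∈ Finset.range n, q ^ k := by
  have h : Set.EqOn (fun q : ℂ => ∏ ζ ∈ (Polynomial.nthRootsFinset n (1 : ℂ)).erase 1, (1 - ζ * q))
      (fun q => ∑ k ∈ Finset.range n, q ^ k) {1}ᶜ := by
    intro q hq
    have h1 := (Complex.isPrimitiveRoot_exp n hn.ne').pow_sub_pow_eq_prod_sub_mul (1 : ℂ) q hn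
    have hmem : (1 : ℂ) ∈ Polynomial.nthRootsFinset n (1 : ℂ) := by
      simp [Polynomial.mem_nthRootsFinset hn]
    rw [← Finset.mul_prod_erase _ _ hmem, one_mul, one_pow] at h1
    have h2 := geom_sum_mul q n
    have h3 : 1 - q ≠ 0 := sub_ne_zero.mpr (Ne.symm hq)
    apply mul_left_cancel₀ h3
    simp only
    linear_combination -h1 + h2
  exact congrFun (Continuous.ext_on (dense_compl_singleton 1) (by fun_prop) (by fun_prop) h) q

lemma qRoot_sq {n : ℕ} (hn : 0 < n) (A : ℂ) : qRoot n A ^ 2 = qPoly n A := by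
  rw [qRoot, ← Finset.prod_pow, qPoly,
    Finset.prod_congr rfl fun ζ _ => Complex.cpow_nat_inv_pow _ two_ne_zero,
    prod_one_sub_root_mul hn]
  simp only [pow_mul]

lemma qRootFact_sq (n : ℕ) (A : ℂ) : qRootFact n A ^ 2 = qPolyFact n A := by
  rw [qRootFact, ← Finset.prod_pow, qPolyFact,
    Finset.prod_congr rfl fun _ _ => qRoot_sq (Nat.succ_pos _) A]

/-- Since `|ζ A^4| ≤ 1`, the number `1 - ζ A^4` has nonnegative real part and meets the cut only if
`ζ A^4 = 1`. Then `A` would be a root of unity with `A ^ 4 ≠ 1` because `ζ ≠ 1`, and such points are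
removed. Taking roots factor by factor is essential, as the product itself need not avoid the cut.
-/
lemma one_sub_mem_slitPlane (hA : A ∈ discS) {n : ℕ} {ζ : ℂ}
    (hζ : ζ ∈ (Polynomial.nthRootsFinset n (1 : ℂ)).erase 1) :
    1 - ζ * A ^ 4 ∈ Complex.slitPlane := by
  rw [Finset.mem_erase] at hζ
  have hn : 0 < n := by
    rcases Nat.eq_zero_or_pos n with rfl | h
    · simp at hζ
    · exact h
  rw [Polynomial.mem_nthRootsFinset hn] at hζ
  obtain ⟨hζ1, hζn⟩ := hζ
  have hne : ζ * A ^ 4 ≠ 1 := by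
    intro h
    apply hA.2
    refine ⟨⟨4 * n, by omega, ?_⟩, ?_⟩
    · have := congrArg (· ^ n) h
      simp only [mul_pow, hζn, one_mul, one_pow] at this
      rw [pow_mul, this]
    · intro h4
      rw [h4, mul_one] at h
      exact hζ1 h
  have hnorm : ‖ζ * A ^ 4‖ ≤ 1 := by
    rw [norm_mul, Complex.norm_eq_one_of_pow_eq_one hζn hn.ne', one_mul, norm_pow]
    exact pow_le_one₀ (norm_nonneg _) (by simpa using hA.1)
  rw [Complex.mem_slitPlane_iff]
  by_contra hcon
  push Not at hcon
  obtain ⟨h1, h2⟩ := hcon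
  rw [Complex.sub_re, Complex.one_re] at h1
  rw [Complex.sub_im, Complex.one_im] at h2
  have h3 := (Complex.re_le_norm (ζ * A ^ 4)).trans hnorm
  exact hne (Complex.ext (by rw [Complex.one_re]; linarith) (by rw [Complex.one_im]; linarith))

lemma analyticAt_qRoot (hA : A ∈ discS) (n : ℕ) : AnalyticAt ℂ (qRoot n) A := by
  unfold qRoot
  apply Finset.analyticAt_fun_prod
  intro ζ hζ
  exact AnalyticAt.cpow (by fun_prop) (by fun_prop) (one_sub_mem_slitPlane hA hζ)

lemma qRoot_ne_zero (hA : A ∈ discS) (n : ℕ) : qRoot n A ≠ 0 := by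
  unfold qRoot
  rw [Finset.prod_ne_zero_iff]
  intro ζ hζ
  rw [Complex.cpow_ne_zero_iff]
  exact Or.inl (Complex.slitPlane_ne_zero (one_sub_mem_slitPlane hA hζ))

lemma qRoot_zero (n : ℕ) : qRoot n 0 = 1 := by simp [qRoot]

lemma analyticAt_qRootFact (hA : A ∈ discS) (n : ℕ) : AnalyticAt ℂ (qRootFact n) A := by
  unfold qRootFact
  exact Finset.analyticAt_fun_prod _ fun _ _ => analyticAt_qRoot hA _

lemma qRootFact_ne_zero (hA : A ∈ discS) (n : ℕ) : qRootFact n A ≠ 0 :=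
  Finset.prod_ne_zero_iff.mpr fun _ _ => qRoot_ne_zero hA _

lemma qRootFact_zero (n : ℕ) : qRootFact n 0 = 1 := by simp [qRootFact, qRoot_zero]

lemma qPolyFact_ne_zero (hA : A ∈ discS) (n : ℕ) : qPolyFact n A ≠ 0 := by
  rw [← qRootFact_sq]; exact pow_ne_zero 2 (qRootFact_ne_zero hA n)

lemma qInt_eq_qPoly (hA : A ≠ 0) (n : ℕ) : qInt n A = A ^ (-2 * (n : ℤ) + 2) * qPoly n A := by
  rw [qInt, qPoly, Finset.mul_sum]
  refine Finset.sum_congr rfl fun k _ => ?_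
  rw [zpow_add₀ hA]; norm_cast

lemma qFact_eq_qPolyFact (hA : A ≠ 0) (n : ℕ) :
    qFact n A = A ^ (-((n : ℤ) * (n - 1))) * qPolyFact n A := by
  induction n with
  | zero => simp [qFact, qPolyFact]
  | succ n ih =>
    rw [qFact, Finset.prod_range_succ, ← qFact, ih, qPolyFact, qPolyFact, Finset.prod_range_succ,
      qInt_eq_qPoly hA, mul_mul_mul_comm, ← zpow_add₀ hA]
    congr 2
    push_cast; ring

lemma qFact_ne_zero_of_mem (hA : A ∈ discS) (hA0 : A ≠ 0) (n : ℕ) : qFact n A ≠ 0 := by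
  rw [qFact_eq_qPolyFact hA0]
  exact mul_ne_zero (zpow_ne_zero _ hA0) (qPolyFact_ne_zero hA n)

/-! ### Square roots of circle and theta evaluations, and their uniqueness -/

/-- The square root of the circle evaluation. -/
noncomputable def circleRoot (a : ℕ) (A : ℂ) : ℂ :=
  Complex.I ^ a * A ^ (-(a : ℤ)) * qRoot (a + 1) A

/-- The square root of the theta evaluation. -/
noncomputable def thetaRoot (a b c : ℕ) (A : ℂ) : ℂ :=
  Complex.I ^ ((a + b + c) / 2) * A ^ (-(((a + b + c) / 2 : ℕ) : ℤ)) *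
    ((qRootFact ((a + b + c) / 2 + 1) A * qRootFact ((a + b - c) / 2) A *
      qRootFact ((b + c - a) / 2) A * qRootFact ((c + a - b) / 2) A) /
    (qRootFact a A * qRootFact b A * qRootFact c A))

lemma zero_mem_discS : (0 : ℂ) ∈ discS := by
  refine ⟨by simp, fun h => ?_⟩
  obtain ⟨⟨n, hn, h⟩, _⟩ := h
  rw [zero_pow hn.ne'] at h
  exact zero_ne_one h

lemma ball_subset_discS : Metric.ball (0 : ℂ) 1 ⊆ discS := by
  intro A hA
  refine ⟨Metric.ball_subset_closedBall hA, fun h => ?_⟩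
  obtain ⟨⟨n, hn, h⟩, _⟩ := h
  rw [mem_ball_zero_iff, Complex.norm_eq_one_of_pow_eq_one h hn.ne'] at hA
  exact lt_irrefl _ hA

lemma isGeneric_of_mem_ball (hA : A ∈ Metric.ball (0 : ℂ) 1) (hA0 : A ≠ 0) : IsGeneric A := by
  refine ⟨hA0, fun n hn h => ?_⟩
  rw [mem_ball_zero_iff, Complex.norm_eq_one_of_pow_eq_one h hn.ne'] at hA
  exact lt_irrefl _ hA

lemma neg_one_eq_I_sq : (-1 : ℂ) = Complex.I ^ 2 := Complex.I_sq.symm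

lemma tendsto_of_root {g : ℂ → ℂ} {κ : ℂ} {m : ℕ} (hg : AnalyticAt ℂ g 0) (h1 : g 0 = 1) :
    Tendsto (fun A : ℂ => κ * A ^ (-(m : ℤ)) * g A * A ^ m) (𝓝[≠] 0) (𝓝 κ) := by
  have h : Tendsto (fun A : ℂ => κ * g A) (𝓝[≠] 0) (𝓝 κ) := by
    have := (hg.continuousAt.tendsto.const_mul κ).mono_left (nhdsWithin_le_nhds (s := {0}ᶜ))
    rwa [h1, mul_one] at this
  refine h.congr' ?_
  filter_upwards [self_mem_nhdsWithin] with A hA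
  have : A ^ m ≠ 0 := pow_ne_zero m hA
  rw [zpow_neg, zpow_natCast]
  field_simp

lemma isSqrtBranch_circleRoot (a : ℕ) :
    IsSqrtBranch (circleEval a) (Complex.I ^ a) a (circleRoot a) := by
  refine ⟨fun A hA => ?_, fun A hA => ?_, ?_⟩
  · exact (analyticAt_const.mul (analyticAt_id.zpow hA.2)).mul (analyticAt_qRoot hA.1 _)
  · rw [circleRoot, circleEval, mul_pow, mul_pow, qRoot_sq a.succ_pos, qInt_eq_qPoly hA.2,
      neg_one_eq_I_sq, ← pow_mul, ← pow_mul, mul_comm a 2, ← zpow_natCast (A ^ _), ← zpow_mul]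
    rw [show -(a : ℤ) * (2 : ℕ) = -2 * (a + 1 : ℕ) + 2 by push_cast; ring]
    ring
  · exact tendsto_of_root (analyticAt_qRoot zero_mem_discS _) (qRoot_zero _)

lemma isSqrtBranch_thetaRoot {a b c : ℕ} (h : Adm a b c) :
    IsSqrtBranch (thetaEval a b c) (Complex.I ^ ((a + b + c) / 2)) ((a + b + c) / 2)
      (thetaRoot a b c) := by
  have han : ∀ A ∈ discS, AnalyticAt ℂ (fun A => (qRootFact ((a + b + c) / 2 + 1) A *
      qRootFact ((a + b - c) / 2) A *
      qRootFact ((b + c - a) / 2) A * qRootFact ((c + a - b) / 2) A) /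
    (qRootFact a A * qRootFact b A * qRootFact c A)) A := fun A hA =>
      ((((analyticAt_qRootFact hA _).mul (analyticAt_qRootFact hA _)).mul
        (analyticAt_qRootFact hA _)).mul (analyticAt_qRootFact hA _)).div
      (((analyticAt_qRootFact hA _).mul (analyticAt_qRootFact hA _)).mul
        (analyticAt_qRootFact hA _)) (mul_ne_zero (mul_ne_zero (qRootFact_ne_zero hA _)
          (qRootFact_ne_zero hA _)) (qRootFact_ne_zero hA _))
  refine ⟨fun A hA => ?_, fun A hA => ?_, ?_⟩
  · exact (analyticAt_const.mul (analyticAt_id.zpow hA.2)).mul (han A hA.1)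
  · obtain ⟨p, q, r, ha, hb, hc⟩ := exists_eq_of_adm h
    rw [thetaRoot, thetaEval, show (a + b + c) / 2 = p + q + r by omega,
      show (a + b - c) / 2 = p by omega, show (b + c - a) / 2 = r by omega,
      show (c + a - b) / 2 = q by omega]
    simp only [qFact_eq_qPolyFact hA.2, mul_pow, div_pow, qRootFact_sq]
    have hpow : A ^ (-(((p + q + r + 1 : ℕ) : ℤ) * (((p + q + r + 1 : ℕ) : ℤ) - 1))) *
        A ^ (-((p : ℤ) * (p - 1))) * A ^ (-((r : ℤ) * (r - 1))) * A ^ (-((q : ℤ) * (q - 1))) =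
        (A ^ (-((p + q + r : ℕ) : ℤ))) ^ 2 * (A ^ (-((a : ℤ) * (a - 1))) *
        A ^ (-((b : ℤ) * (b - 1))) * A ^ (-((c : ℤ) * (c - 1)))) := by
      subst ha hb hc
      rw [← zpow_natCast (A ^ (-((p + q + r : ℕ) : ℤ))), ← zpow_mul]
      simp only [← zpow_add₀ (show A ≠ 0 from hA.2)]
      congr 1
      push_cast; ring
    rw [neg_one_eq_I_sq, ← pow_mul, ← pow_mul, mul_comm (p + q + r) 2]
    have ea := zpow_ne_zero (-((a : ℤ) * (a - 1))) (show A ≠ 0 from hA.2)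
    have eb := zpow_ne_zero (-((b : ℤ) * (b - 1))) (show A ≠ 0 from hA.2)
    have ec := zpow_ne_zero (-((c : ℤ) * (c - 1))) (show A ≠ 0 from hA.2)
    have fa := qPolyFact_ne_zero hA.1 a
    have fb := qPolyFact_ne_zero hA.1 b
    have fc := qPolyFact_ne_zero hA.1 c
    rw [eq_div_iff (mul_ne_zero (mul_ne_zero (mul_ne_zero ea fa) (mul_ne_zero eb fb))
      (mul_ne_zero ec fc)), mul_div_assoc', div_mul_eq_mul_div,
      div_eq_iff (by simp [fa, fb, fc])]
    linear_combination -(Complex.I ^ (2 * (p + q + r)) * qPolyFact (p + q + r + 1) A *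
      qPolyFact p A * qPolyFact q A * qPolyFact r A *
      (qPolyFact a A * qPolyFact b A * qPolyFact c A)) * hpow
  · refine tendsto_of_root (han 0 zero_mem_discS) ?_
    simp [qRootFact_zero]

lemma smul_mem_discS (hA : A ∈ discS \ {0}) {t : ℝ} (ht : t ∈ Set.Ioc (0 : ℝ) 1) :
    (t : ℂ) * A ∈ discS \ {0} := by
  refine ⟨?_, mul_ne_zero (by exact_mod_cast ht.1.ne') hA.2⟩
  rcases ht.2.lt_or_eq with h | h
  · apply ball_subset_discS
    rw [mem_ball_zero_iff, norm_mul, Complex.norm_real, Real.norm_of_nonneg ht.1.le]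
    have : ‖A‖ ≤ 1 := by simpa using hA.1.1
    nlinarith [norm_nonneg A, ht.1]
  · rw [h]; simpa using hA.1

/-- Analytic square roots with the same leading term at the origin agree. -/
lemma eqOn_of_isSqrtBranch {g : ℂ → ℂ} {κ : ℂ} {m : ℕ} {s s' : ℂ → ℂ} (hκ : κ ≠ 0)
    (hs : IsSqrtBranch g κ m s) (hs' : IsSqrtBranch g κ m s')
    (hne : ∀ A ∈ discS \ {0}, s' A ≠ 0) : Set.EqOn s s' (discS \ {0}) := by
  intro A hA
  have hc : ∀ {f : ℂ → ℂ}, AnalyticOnNhd ℂ f (discS \ {0}) →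
      ContinuousOn (fun t : ℝ => f (t * A)) (Set.Ioc 0 1) := fun hf =>
    hf.continuousOn.comp (by fun_prop) fun t ht => smul_mem_discS hA ht
  have h1 : (1 : ℝ) ∈ Set.Ioc (0 : ℝ) 1 := by simp
  -- On the segment from 0 (excluded) to `A` the two roots differ by a constant sign, and the
  -- nonzero limit `κ` at 0 rules out the minus sign.
  have := isPreconnected_Ioc.eq_or_eq_neg_of_sq_eq (hc hs.1) (hc hs'.1)
    (fun t ht => by
      have := smul_mem_discS hA ht
      simp only [Pi.pow_apply]
      rw [hs.2.1 _ this, hs'.2.1 _ this])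
    (fun ht => hne _ (smul_mem_discS hA ht))
  rcases this with h | h
  · simpa using h h1
  · exfalso
    have hray : Tendsto (fun t : ℝ => (t : ℂ) * A) (𝓝[>] 0) (𝓝[≠] 0) := by
      apply tendsto_nhdsWithin_of_tendsto_nhds_of_eventually_within
      · have : Tendsto (fun t : ℝ => (t : ℂ) * A) (𝓝 0) (𝓝 (((0 : ℝ) : ℂ) * A)) :=
          (by fun_prop : Continuous fun t : ℝ => (t : ℂ) * A).tendsto 0
        rw [Complex.ofReal_zero, zero_mul] at this
        exact this.mono_left nhdsWithin_le_nhds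
      · filter_upwards [self_mem_nhdsWithin] with t ht
        exact mul_ne_zero (by exact_mod_cast (ne_of_gt ht)) hA.2
    have l1 := hs.2.2.comp hray
    have l2 := (hs'.2.2.comp hray).neg
    have hev : (fun A => s A * A ^ m) ∘ (fun t : ℝ => (t : ℂ) * A) =ᶠ[𝓝[>] 0]
        fun t : ℝ => -((fun A => s' A * A ^ m) ∘ fun t : ℝ => (t : ℂ) * A) t := by
      filter_upwards [Ioc_mem_nhdsGT (show (0 : ℝ) < 1 by norm_num)] with t ht
      have := h ht
      simp only [Pi.neg_apply] at this
      simp only [Function.comp, this, neg_mul]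
    have := tendsto_nhds_unique (l1.congr' hev) l2
    exact hκ (self_eq_neg.mp this)

lemma circleRoot_ne_zero (a : ℕ) (hA : A ∈ discS \ {0}) : circleRoot a A ≠ 0 :=
  mul_ne_zero (mul_ne_zero (pow_ne_zero _ Complex.I_ne_zero) (zpow_ne_zero _ hA.2))
    (qRoot_ne_zero hA.1 _)

lemma thetaRoot_ne_zero (a b c : ℕ) (hA : A ∈ discS \ {0}) : thetaRoot a b c A ≠ 0 := by
  have := fun n => qRootFact_ne_zero hA.1 n
  exact mul_ne_zero (mul_ne_zero (pow_ne_zero _ Complex.I_ne_zero) (zpow_ne_zero _ hA.2))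
    (by simp [this])

lemma isSqrtBranch_sqrtCircle (a : ℕ) :
    IsSqrtBranch (circleEval a) (Complex.I ^ a) a (sqrtCircle a) :=
  Classical.epsilon_spec (p := IsSqrtBranch (circleEval a) (Complex.I ^ a) a)
    ⟨_, isSqrtBranch_circleRoot a⟩

lemma isSqrtBranch_sqrtTheta {a b c : ℕ} (h : Adm a b c) :
    IsSqrtBranch (thetaEval a b c) (Complex.I ^ ((a + b + c) / 2)) ((a + b + c) / 2)
      (sqrtTheta a b c) :=
  Classical.epsilon_spec
    (p := IsSqrtBranch (thetaEval a b c) (Complex.I ^ ((a + b + c) / 2)) ((a + b + c) / 2))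
    ⟨_, isSqrtBranch_thetaRoot h⟩

lemma sqrtCircle_eq (a : ℕ) (hA : A ∈ discS \ {0}) : sqrtCircle a A = circleRoot a A :=
  eqOn_of_isSqrtBranch (pow_ne_zero _ Complex.I_ne_zero) (isSqrtBranch_sqrtCircle a)
    (isSqrtBranch_circleRoot a)
    (fun _ h => circleRoot_ne_zero a h) hA

lemma sqrtTheta_eq {a b c : ℕ} (h : Adm a b c) (hA : A ∈ discS \ {0}) :
    sqrtTheta a b c A = thetaRoot a b c A :=
  eqOn_of_isSqrtBranch (pow_ne_zero _ Complex.I_ne_zero) (isSqrtBranch_sqrtTheta h)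
    (isSqrtBranch_thetaRoot h)
    (fun _ h => thetaRoot_ne_zero a b c h) hA

/-! ### The explicit formula for the symbol -/

/-- The order at `A = 0` of the summands of the renormalized symbol, in terms of the distances
to the half-sums of the quadrilaterals. -/
def sixJOrder (u : Fin 3 → ℕ) : ℕ := 2 * (u 0 + (u 0 * u 1 + u 0 * u 2 + u 1 * u 2))

/-- The summand of the explicit formula for the renormalized symbol. -/
noncomputable def sixJTerm (u : Fin 3 → ℕ) (v : Fin 4 → ℕ) (z : ℕ) (A : ℂ) : ℂ :=
  (-1) ^ u 0 * A ^ sixJOrder u *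
    (qPolyFact (z + 1) A / ((∏ j, qPolyFact (v j) A) * ∏ i, qPolyFact (u i) A))

/-- The prefactor of the explicit formula for the renormalized symbol. -/
noncomputable def sixJPrefactor (B : Fin 3 → ℕ) (t : Fin 4 → ℕ) (c f : ℕ) (A : ℂ) : ℂ :=
  (∏ i, ∏ j, qRootFact (B i - t j) A) * (qRoot (c + 1) A * qRoot (f + 1) A) /
    ∏ j, qRootFact (t j + 1) A

/-- The range of summation of the tetrahedron evaluation. -/
def tetRange (a b c d e f : ℕ) : Finset ℕ :=
  Finset.Icc (Finset.univ.sup (tri a b c d e f))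
    (Finset.univ.inf' Finset.univ_nonempty (box a b c d e f))

/-- An explicit formula for the renormalized symbol. -/
noncomputable def sixJExplicit (a b c d e f : ℕ) (A : ℂ) : ℂ :=
  sixJPrefactor (box a b c d e f) (tri a b c d e f) c f A *
    ∑ z ∈ tetRange a b c d e f,
      sixJTerm (fun i => box a b c d e f i - z) (fun j => z - tri a b c d e f j) z A

lemma mem_tetRange {a b c d e f z : ℕ} :
    z ∈ tetRange a b c d e f ↔
      (∀ j, tri a b c d e f j ≤ z) ∧ ∀ i, z ≤ box a b c d e f i := by
  simp [tetRange, Finset.mem_Icc, Finset.sup_le_iff, Finset.le_inf'_iff]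

/-- The distances `u`, `v` of `z` from the quadrilateral and triangle half-sums are linear
coordinates for the colors. The formula for `z` comes from the equality of the sum of the three
`box` values with the sum of the four `tri` values. -/
lemma exists_of_mem_tetRange {a b c d e f z : ℕ} (h : TetAdm a b c d e f)
    (hz : z ∈ tetRange a b c d e f) : ∃ (u : Fin 3 → ℕ) (v : Fin 4 → ℕ),
      (∀ i, box a b c d e f i = z + u i) ∧ (∀ j, tri a b c d e f j + v j = z) ∧
      z = u 0 + u 1 + u 2 + (v 0 + v 1 + v 2 + v 3) ∧
      a = u 0 + u 1 + v 2 + v 3 ∧ b = u 0 + u 2 + v 1 + v 3 ∧ c = u 1 + u 2 + v 1 + v 2 ∧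
      d = u 0 + u 1 + v 0 + v 1 ∧ e = u 0 + u 2 + v 0 + v 2 ∧ f = u 1 + u 2 + v 0 + v 3 := by
  rw [mem_tetRange] at hz
  refine ⟨fun i => box a b c d e f i - z, fun j => z - tri a b c d e f j,
    fun i => by have := hz.2 i; simp only; omega, fun j => by have := hz.1 j; simp only; omega, ?_⟩
  simp only [TetAdm, adm_iff] at h
  simp only [Fin.forall_fin_succ, tri, box] at hz ⊢
  simp at hz ⊢
  omega

lemma thetaRoot_eq {a b c p q r : ℕ} (ha : a = p + q) (hb : b = p + r) (hc : c = q + r) :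
    thetaRoot a b c A = Complex.I ^ (p + q + r) * A ^ (-((p + q + r : ℕ) : ℤ)) *
      (qRootFact (p + q + r + 1) A * ((qRootFact p A * qRootFact q A * qRootFact r A) /
      (qRootFact a A * qRootFact b A * qRootFact c A))) := by
  rw [thetaRoot, show (a + b + c) / 2 = p + q + r by omega,
    show (a + b - c) / 2 = p by omega, show (b + c - a) / 2 = r by omega,
    show (c + a - b) / 2 = q by omega]
  ring

/-- The product of factorials in a summand of the tetrahedron evaluation, for an arbitrary
function in place of the factorial. -/
noncomputable def tetShape (φ : ℕ → ℂ) (u₁ u₂ u₃ v₁ v₂ v₃ v₄ : ℕ) : ℂ :=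
  ((φ (u₁ + v₁) * φ (u₁ + v₂) * φ (u₁ + v₃) * φ (u₁ + v₄)) *
    (φ (u₂ + v₁) * φ (u₂ + v₂) * φ (u₂ + v₃) * φ (u₂ + v₄)) *
    (φ (u₃ + v₁) * φ (u₃ + v₂) * φ (u₃ + v₃) * φ (u₃ + v₄))) /
    (φ (u₁ + u₂ + v₃ + v₄) * φ (u₁ + u₃ + v₂ + v₄) * φ (u₂ + u₃ + v₂ + v₃) *
      φ (u₁ + u₂ + v₁ + v₂) * φ (u₁ + u₃ + v₁ + v₃) * φ (u₂ + u₃ + v₁ + v₄)) *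
  (φ (u₁ + u₂ + u₃ + (v₁ + v₂ + v₃ + v₄) + 1) /
    ((φ v₁ * φ v₂ * φ v₃ * φ v₄) * (φ u₁ * φ u₂ * φ u₃)))

section
variable (u₁ u₂ u₃ v₁ v₂ v₃ v₄ : ℕ)

/-- Multiplicativity allows powers of `A` and normalized factorials to be treated separately. -/
lemma tetShape_mul (φ ψ : ℕ → ℂ) :
    tetShape (fun n => φ n * ψ n) u₁ u₂ u₃ v₁ v₂ v₃ v₄ =
      tetShape φ u₁ u₂ u₃ v₁ v₂ v₃ v₄ * tetShape ψ u₁ u₂ u₃ v₁ v₂ v₃ v₄ := by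
  unfold tetShape
  simp only [div_eq_mul_inv, mul_inv]
  ring

/-- Together with the powers from the circle roots on the left and the theta roots on the right, all
dependence on `v` cancels, and an exponent quadratic in `u` remains. -/
lemma tetShape_zpow (hA : A ≠ 0) :
    tetShape (fun n => A ^ (-((n : ℤ) * (n - 1)))) u₁ u₂ u₃ v₁ v₂ v₃ v₄ *
      (A ^ (-((u₂ + u₃ + v₂ + v₃ : ℕ) : ℤ)) * A ^ (-((u₂ + u₃ + v₁ + v₄ : ℕ) : ℤ))) =
    A ^ (2 * (u₁ + (u₁ * u₂ + u₁ * u₃ + u₂ * u₃))) *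
      (A ^ (-((u₁ + u₂ + u₃ + v₂ + v₃ + v₄ : ℕ) : ℤ)) *
      A ^ (-((u₁ + u₂ + u₃ + v₁ + v₃ + v₄ : ℕ) : ℤ)) *
      A ^ (-((u₁ + u₂ + u₃ + v₁ + v₂ + v₄ : ℕ) : ℤ)) *
      A ^ (-((u₁ + u₂ + u₃ + v₁ + v₂ + v₃ : ℕ) : ℤ))) := by
  rw [← zpow_natCast A (2 * (u₁ + (u₁ * u₂ + u₁ * u₃ + u₂ * u₃)))]
  unfold tetShape
  simp only [div_eq_mul_inv, mul_inv, ← zpow_neg]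
  simp only [← zpow_add₀ hA]
  congr 1
  push_cast; ring

lemma tetShape_sign :
    (-1 : ℂ) ^ (u₁ + u₂ + u₃ + (v₁ + v₂ + v₃ + v₄)) *
      (Complex.I ^ (u₂ + u₃ + v₂ + v₃) * Complex.I ^ (u₂ + u₃ + v₁ + v₄)) =
      (-1) ^ u₁ * (Complex.I ^ (u₁ + u₂ + u₃ + v₂ + v₃ + v₄) *
        Complex.I ^ (u₁ + u₂ + u₃ + v₁ + v₃ + v₄) * Complex.I ^ (u₁ + u₂ + u₃ + v₁ + v₂ + v₄) *
        Complex.I ^ (u₁ + u₂ + u₃ + v₁ + v₂ + v₃)) := by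
  have h1 := neg_one_pow_mul_self u₁
  have h2 : (-1 : ℂ) ^ u₁ * (-1 : ℂ) ^ (u₁ + u₂ + u₃ + (v₁ + v₂ + v₃ + v₄)) *
      (Complex.I ^ (u₂ + u₃ + v₂ + v₃) * Complex.I ^ (u₂ + u₃ + v₁ + v₄)) =
    (Complex.I ^ (u₁ + u₂ + u₃ + v₂ + v₃ + v₄) *
      Complex.I ^ (u₁ + u₂ + u₃ + v₁ + v₃ + v₄) * Complex.I ^ (u₁ + u₂ + u₃ + v₁ + v₂ + v₄) *
      Complex.I ^ (u₁ + u₂ + u₃ + v₁ + v₂ + v₃)) := by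
    rw [neg_one_eq_I_sq, ← pow_mul, ← pow_mul]
    simp only [← pow_add]
    congr 1
    omega
  rw [← h2]
  linear_combination -((-1 : ℂ) ^ (u₁ + u₂ + u₃ + (v₁ + v₂ + v₃ + v₄)) *
    (Complex.I ^ (u₂ + u₃ + v₂ + v₃) * Complex.I ^ (u₂ + u₃ + v₁ + v₄))) * h1

/-- Each normalized factorial is the square of its root. For the twelve numerators one root stays in
the prefactor and the other goes to a theta evaluation; each color lies on two theta graphs, which
accounts for its squared root in the denominator. -/
lemma tetShape_qPolyFact :
    tetShape (qPolyFact · A) u₁ u₂ u₃ v₁ v₂ v₃ v₄ =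
    ((qRootFact (u₁ + v₁) A * qRootFact (u₁ + v₂) A * qRootFact (u₁ + v₃) A *
        qRootFact (u₁ + v₄) A) *
      (qRootFact (u₂ + v₁) A * qRootFact (u₂ + v₂) A * qRootFact (u₂ + v₃) A *
        qRootFact (u₂ + v₄) A) *
      (qRootFact (u₃ + v₁) A * qRootFact (u₃ + v₂) A * qRootFact (u₃ + v₃) A *
        qRootFact (u₃ + v₄) A)) *
    (qPolyFact (u₁ + u₂ + u₃ + (v₁ + v₂ + v₃ + v₄) + 1) A / ((qPolyFact v₁ A * qPolyFact v₂ A *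
      qPolyFact v₃ A * qPolyFact v₄ A) * (qPolyFact u₁ A * qPolyFact u₂ A * qPolyFact u₃ A))) *
    (((qRootFact (u₁ + v₄) A * qRootFact (u₂ + v₃) A * qRootFact (u₃ + v₂) A) /
      (qRootFact (u₁ + u₂ + v₃ + v₄) A * qRootFact (u₁ + u₃ + v₂ + v₄) A *
        qRootFact (u₂ + u₃ + v₂ + v₃) A)) *
    ((qRootFact (u₁ + v₃) A * qRootFact (u₂ + v₄) A * qRootFact (u₃ + v₁) A) /
      (qRootFact (u₁ + u₂ + v₃ + v₄) A * qRootFact (u₁ + u₃ + v₁ + v₃) A *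
        qRootFact (u₂ + u₃ + v₁ + v₄) A)) *
    ((qRootFact (u₁ + v₂) A * qRootFact (u₂ + v₁) A * qRootFact (u₃ + v₄) A) /
      (qRootFact (u₁ + u₂ + v₁ + v₂) A * qRootFact (u₁ + u₃ + v₂ + v₄) A *
        qRootFact (u₂ + u₃ + v₁ + v₄) A)) *
    ((qRootFact (u₁ + v₁) A * qRootFact (u₂ + v₂) A * qRootFact (u₃ + v₃) A) /
      (qRootFact (u₁ + u₂ + v₁ + v₂) A * qRootFact (u₁ + u₃ + v₁ + v₃) A *
        qRootFact (u₂ + u₃ + v₂ + v₃) A))) := by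
  unfold tetShape
  simp only [← qRootFact_sq, div_eq_mul_inv, mul_inv]
  ring

lemma sixJ_summand (hA : A ∈ discS \ {0}) :
    tetShape (qFact · A) u₁ u₂ u₃ v₁ v₂ v₃ v₄ *
      (-1) ^ (u₁ + u₂ + u₃ + (v₁ + v₂ + v₃ + v₄)) *
      (circleRoot (u₂ + u₃ + v₂ + v₃) A * circleRoot (u₂ + u₃ + v₁ + v₄) A) /
      (thetaRoot (u₁ + u₂ + v₃ + v₄) (u₁ + u₃ + v₂ + v₄) (u₂ + u₃ + v₂ + v₃) A *
        thetaRoot (u₁ + u₂ + v₃ + v₄) (u₁ + u₃ + v₁ + v₃) (u₂ + u₃ + v₁ + v₄) A *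
        thetaRoot (u₁ + u₂ + v₁ + v₂) (u₁ + u₃ + v₂ + v₄) (u₂ + u₃ + v₁ + v₄) A *
        thetaRoot (u₁ + u₂ + v₁ + v₂) (u₁ + u₃ + v₁ + v₃) (u₂ + u₃ + v₂ + v₃) A) =
    (((qRootFact (u₁ + v₁) A * qRootFact (u₁ + v₂) A * qRootFact (u₁ + v₃) A *
        qRootFact (u₁ + v₄) A) *
      (qRootFact (u₂ + v₁) A * qRootFact (u₂ + v₂) A * qRootFact (u₂ + v₃) A *
        qRootFact (u₂ + v₄) A) *
      (qRootFact (u₃ + v₁) A * qRootFact (u₃ + v₂) A * qRootFact (u₃ + v₃) A *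
        qRootFact (u₃ + v₄) A)) *
        (qRoot (u₂ + u₃ + v₂ + v₃ + 1) A * qRoot (u₂ + u₃ + v₁ + v₄ + 1) A) /
      (qRootFact (u₁ + u₂ + u₃ + v₂ + v₃ + v₄ + 1) A *
        qRootFact (u₁ + u₂ + u₃ + v₁ + v₃ + v₄ + 1) A *
        qRootFact (u₁ + u₂ + u₃ + v₁ + v₂ + v₄ + 1) A *
        qRootFact (u₁ + u₂ + u₃ + v₁ + v₂ + v₃ + 1) A)) *
      ((-1) ^ u₁ * A ^ (2 * (u₁ + (u₁ * u₂ + u₁ * u₃ + u₂ * u₃))) *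
        (qPolyFact (u₁ + u₂ + u₃ + (v₁ + v₂ + v₃ + v₄) + 1) A /
          ((qPolyFact v₁ A * qPolyFact v₂ A * qPolyFact v₃ A * qPolyFact v₄ A) *
            (qPolyFact u₁ A * qPolyFact u₂ A * qPolyFact u₃ A)))) := by
  have hA0 : A ≠ 0 := hA.2
  have hR := fun n => qRootFact_ne_zero hA.1 n
  rw [thetaRoot_eq (p := u₁ + v₄) (q := u₂ + v₃) (r := u₃ + v₂) (by ring) (by ring) (by ring),
    thetaRoot_eq (p := u₁ + v₃) (q := u₂ + v₄) (r := u₃ + v₁) (by ring) (by ring) (by ring),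
    thetaRoot_eq (p := u₁ + v₂) (q := u₂ + v₁) (r := u₃ + v₄) (by ring) (by ring) (by ring),
    thetaRoot_eq (p := u₁ + v₁) (q := u₂ + v₂) (r := u₃ + v₃) (by ring) (by ring) (by ring),
    circleRoot, circleRoot]
  rw [show u₁ + v₄ + (u₂ + v₃) + (u₃ + v₂) = u₁ + u₂ + u₃ + v₂ + v₃ + v₄ by ring,
    show u₁ + v₃ + (u₂ + v₄) + (u₃ + v₁) = u₁ + u₂ + u₃ + v₁ + v₃ + v₄ by ring,
    show u₁ + v₂ + (u₂ + v₁) + (u₃ + v₄) = u₁ + u₂ + u₃ + v₁ + v₂ + v₄ by ring,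
    show u₁ + v₁ + (u₂ + v₂) + (u₃ + v₃) = u₁ + u₂ + u₃ + v₁ + v₂ + v₃ by ring]
  have hs := tetShape_sign u₁ u₂ u₃ v₁ v₂ v₃ v₄
  have hz := tetShape_zpow u₁ u₂ u₃ v₁ v₂ v₃ v₄ hA0
  have hq := tetShape_qPolyFact (A := A) u₁ u₂ u₃ v₁ v₂ v₃ v₄
  have hsplit : tetShape (qFact · A) u₁ u₂ u₃ v₁ v₂ v₃ v₄ =
      tetShape (fun n => A ^ (-((n : ℤ) * (n - 1)))) u₁ u₂ u₃ v₁ v₂ v₃ v₄ *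
      tetShape (qPolyFact · A) u₁ u₂ u₃ v₁ v₂ v₃ v₄ := by
    rw [← tetShape_mul]
    simp only [qFact_eq_qPolyFact hA0]
  have hI := fun n : ℕ => pow_ne_zero n Complex.I_ne_zero
  have hAz := fun n : ℤ => zpow_ne_zero n hA0
  have hne : ∀ (n : ℕ) (m : ℤ) (k k₁ k₂ k₃ k₄ k₅ k₆ : ℕ), Complex.I ^ n * A ^ m *
      (qRootFact k A * ((qRootFact k₁ A * qRootFact k₂ A * qRootFact k₃ A) /
      (qRootFact k₄ A * qRootFact k₅ A * qRootFact k₆ A))) ≠ 0 :=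
    fun n m k k₁ k₂ k₃ k₄ k₅ k₆ => mul_ne_zero (mul_ne_zero (hI n) (hAz m)) (by simp [hR])
  rw [div_eq_iff (mul_ne_zero (mul_ne_zero (mul_ne_zero (hne _ _ _ _ _ _ _ _ _)
    (hne _ _ _ _ _ _ _ _ _)) (hne _ _ _ _ _ _ _ _ _)) (hne _ _ _ _ _ _ _ _ _)), hsplit]
  -- The roots of the largest factorials occur in the theta roots and inverted in the prefactor.
  -- Inserting this product equal to 1 leaves an identity without cancellation of inverses.
  have hS : (qRootFact (u₁ + u₂ + u₃ + v₂ + v₃ + v₄ + 1) A *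
        qRootFact (u₁ + u₂ + u₃ + v₁ + v₃ + v₄ + 1) A *
        qRootFact (u₁ + u₂ + u₃ + v₁ + v₂ + v₄ + 1) A *
        qRootFact (u₁ + u₂ + u₃ + v₁ + v₂ + v₃ + 1) A) *
      (qRootFact (u₁ + u₂ + u₃ + v₂ + v₃ + v₄ + 1) A *
        qRootFact (u₁ + u₂ + u₃ + v₁ + v₃ + v₄ + 1) A *
        qRootFact (u₁ + u₂ + u₃ + v₁ + v₂ + v₄ + 1) A *
        qRootFact (u₁ + u₂ + u₃ + v₁ + v₂ + v₃ + 1) A)⁻¹ = 1 :=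
    mul_inv_cancel₀ (by simp [hR])
  trans (tetShape (fun n => A ^ (-((n : ℤ) * (n - 1)))) u₁ u₂ u₃ v₁ v₂ v₃ v₄ *
      (A ^ (-((u₂ + u₃ + v₂ + v₃ : ℕ) : ℤ)) * A ^ (-((u₂ + u₃ + v₁ + v₄ : ℕ) : ℤ)))) *
      ((-1 : ℂ) ^ (u₁ + u₂ + u₃ + (v₁ + v₂ + v₃ + v₄)) *
      (Complex.I ^ (u₂ + u₃ + v₂ + v₃) * Complex.I ^ (u₂ + u₃ + v₁ + v₄))) *
      (tetShape (qPolyFact · A) u₁ u₂ u₃ v₁ v₂ v₃ v₄ *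
        (qRoot (u₂ + u₃ + v₂ + v₃ + 1) A * qRoot (u₂ + u₃ + v₁ + v₄ + 1) A))
  · ring
  rw [hz, hs, hq, div_eq_mul_inv (_ * (qRoot _ A * qRoot _ A))]
  refine (mul_one _).symm.trans ((congrArg (_ * ·) hS.symm).trans ?_)
  generalize (qRootFact (u₁ + u₂ + u₃ + v₂ + v₃ + v₄ + 1) A *
        qRootFact (u₁ + u₂ + u₃ + v₁ + v₃ + v₄ + 1) A *
        qRootFact (u₁ + u₂ + u₃ + v₁ + v₂ + v₄ + 1) A *
        qRootFact (u₁ + u₂ + u₃ + v₁ + v₂ + v₃ + 1) A)⁻¹ = Sinv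
  ring

end

lemma sixJFormula_eq {a b c d e f : ℕ} (h : TetAdm a b c d e f) (hA : A ∈ discS \ {0}) :
    sixJFormula a b c d e f A = sixJExplicit a b c d e f A := by
  rw [sixJFormula, sqrtCircle_eq _ hA, sqrtCircle_eq _ hA, sqrtTheta_eq h.1 hA,
    sqrtTheta_eq h.2.1 hA, sqrtTheta_eq h.2.2.1 hA, sqrtTheta_eq h.2.2.2 hA, tetEval, sixJExplicit,
    ← tetRange, Finset.mul_sum, Finset.mul_sum, Finset.sum_mul, Finset.sum_div]
  refine Finset.sum_congr rfl fun z hz => ?_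
  obtain ⟨u, v, hu, hv, hz, ha, hb, hc, hd, he, hf⟩ := exists_of_mem_tetRange h hz
  have h1 : qFact 1 A = 1 := by simp [qFact, qInt]
  have hu' : ∀ i, box a b c d e f i - z = u i := fun i => by have := hu i; omega
  have hv' : ∀ j, z - tri a b c d e f j = v j := fun j => by have := hv j; omega
  have huv : ∀ i j, box a b c d e f i - tri a b c d e f j = u i + v j := fun i j => by
    have := hu i; have := hv j; omega
  simp only [sixJTerm, sixJPrefactor, hu', hv', huv, h1, mul_one]
  have ht : ∀ j, tri a b c d e f j = z - v j := fun j => by have := hv j; omega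
  simp only [ht, Fin.prod_univ_three, Fin.prod_univ_four, sixJOrder]
  have key := sixJ_summand (u 0) (u 1) (u 2) (v 0) (v 1) (v 2) (v 3) hA
  rw [tetShape, ← ha, ← hb, ← hc, ← hd, ← he, ← hf, ← hz] at key
  rw [show z - v 0 = u 0 + u 1 + u 2 + v 1 + v 2 + v 3 by omega,
    show z - v 1 = u 0 + u 1 + u 2 + v 0 + v 2 + v 3 by omega,
    show z - v 2 = u 0 + u 1 + u 2 + v 0 + v 1 + v 3 by omega,
    show z - v 3 = u 0 + u 1 + u 2 + v 0 + v 1 + v 2 by omega]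
  refine Eq.trans ?_ key
  ring

/-! ### Analyticity -/

lemma analyticAt_sixJExplicit (a b c d e f : ℕ) (hA : A ∈ discS) :
    AnalyticAt ℂ (sixJExplicit a b c d e f) A := by
  have hP : ∀ n, AnalyticAt ℂ (qPolyFact n) A := fun n => by
    unfold qPolyFact qPoly; fun_prop
  unfold sixJExplicit sixJPrefactor sixJTerm
  refine AnalyticAt.fun_mul (AnalyticAt.fun_div (AnalyticAt.fun_mul ?_ ?_) ?_ ?_) ?_
  · exact Finset.analyticAt_fun_prod _ fun i _ => Finset.analyticAt_fun_prod _ fun j _ =>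
      analyticAt_qRootFact hA _
  · exact (analyticAt_qRoot hA _).fun_mul (analyticAt_qRoot hA _)
  · exact Finset.analyticAt_fun_prod _ fun j _ => analyticAt_qRootFact hA _
  · exact Finset.prod_ne_zero_iff.mpr fun j _ => qRootFact_ne_zero hA _
  · refine Finset.analyticAt_fun_sum _ fun z _ => ?_
    refine AnalyticAt.fun_mul (by fun_prop) (AnalyticAt.fun_div (hP _) (AnalyticAt.fun_mul ?_ ?_) ?_)
    · exact Finset.analyticAt_fun_prod _ fun i _ => hP _
    · exact Finset.analyticAt_fun_prod _ fun i _ => hP _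
    · exact mul_ne_zero (Finset.prod_ne_zero_iff.mpr fun j _ => qPolyFact_ne_zero hA _)
        (Finset.prod_ne_zero_iff.mpr fun j _ => qPolyFact_ne_zero hA _)

lemma sixJR_of_not {a b c d e f : ℕ} (h : ¬ TetAdm a b c d e f) : sixJR a b c d e f A = 0 :=
  if_neg h

lemma sixJR_eq_explicit {a b c d e f : ℕ} (h : TetAdm a b c d e f) (hA : A ∈ discS) :
    sixJR a b c d e f A = sixJExplicit a b c d e f A := by
  rw [sixJR, if_pos h]
  split_ifs with h0
  · subst h0
    apply Tendsto.limUnder_eq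
    have hc := (analyticAt_sixJExplicit a b c d e f zero_mem_discS).continuousAt.tendsto.mono_left
      (nhdsWithin_le_nhds (s := {0}ᶜ))
    refine hc.congr' ?_
    filter_upwards [self_mem_nhdsWithin,
      mem_nhdsWithin_of_mem_nhds (Metric.ball_mem_nhds (0 : ℂ) one_pos)] with B hB hB1
    exact (sixJFormula_eq h ⟨ball_subset_discS hB1, hB⟩).symm
  · exact sixJFormula_eq h ⟨hA, h0⟩

lemma analyticOnNhd_sixJR (a b c d e f : ℕ) : AnalyticOnNhd ℂ (sixJR a b c d e f) discS := by
  intro A hA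
  by_cases h : TetAdm a b c d e f
  swap
  · have : sixJR a b c d e f = fun _ => 0 := funext fun B => sixJR_of_not h
    rw [this]; exact analyticAt_const
  by_cases h0 : A = 0
  · subst h0
    refine (analyticAt_sixJExplicit a b c d e f hA).congr ?_
    filter_upwards [Metric.ball_mem_nhds (0 : ℂ) one_pos] with B hB
    exact (sixJR_eq_explicit h (ball_subset_discS hB)).symm
  · have hA' : A ∈ discS \ {0} := ⟨hA, h0⟩
    -- A neighborhood of a boundary point leaves `discS`, where the chosen square roots are not
    -- known to agree with the explicit ones. Analyticity is therefore read off the chosen roots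
    -- themselves; the comparison serves only to show that the theta roots are nonzero at `A`.
    have hF : AnalyticAt ℂ (sixJFormula a b c d e f) A := by
      have hqI : ∀ n, AnalyticAt ℂ (qInt n) A := fun n => by
        unfold qInt
        exact Finset.analyticAt_fun_sum _ fun k _ => analyticAt_id.zpow h0
      have hq : ∀ n, AnalyticAt ℂ (qFact n) A := fun n => by
        unfold qFact
        exact Finset.analyticAt_fun_prod _ fun k _ => hqI _
      have hn := fun n => qFact_ne_zero_of_mem hA h0 n
      have hT : ∀ a b c, Adm a b c → AnalyticAt ℂ (sqrtTheta a b c) A ∧ sqrtTheta a b c A ≠ 0 :=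
        fun a b c h => ⟨(isSqrtBranch_sqrtTheta h).1 A hA', by
          rw [sqrtTheta_eq h hA']; exact thetaRoot_ne_zero a b c hA'⟩
      have hC : ∀ a, AnalyticAt ℂ (sqrtCircle a) A := fun a => (isSqrtBranch_sqrtCircle a).1 A hA'
      obtain ⟨T1, N1⟩ := hT _ _ _ h.1
      obtain ⟨T2, N2⟩ := hT _ _ _ h.2.1
      obtain ⟨T3, N3⟩ := hT _ _ _ h.2.2.1
      obtain ⟨T4, N4⟩ := hT _ _ _ h.2.2.2
      unfold sixJFormula tetEval
      refine AnalyticAt.fun_div (AnalyticAt.fun_mul (AnalyticAt.fun_mul (AnalyticAt.fun_div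
        (Finset.analyticAt_fun_prod _ fun i _ => Finset.analyticAt_fun_prod _ fun j _ => hq _)
        (((((hq _).fun_mul (hq _)).fun_mul (hq _)).fun_mul (hq _)).fun_mul (hq _) |>.fun_mul (hq _))
        (by simp [hn])) ?_) ((hC _).fun_mul (hC _)))
        (((T1.fun_mul T2).fun_mul T3).fun_mul T4) (by simp [N1, N2, N3, N4])
      refine Finset.analyticAt_fun_sum _ fun z _ => analyticAt_const.fun_mul ((hq _).fun_div
        (((Finset.analyticAt_fun_prod _ fun i _ => hq _).fun_mul
          (Finset.analyticAt_fun_prod _ fun i _ => hq _)).fun_mul (hq _)) ?_)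
      exact mul_ne_zero (mul_ne_zero (Finset.prod_ne_zero_iff.mpr fun _ _ => hn _)
        (Finset.prod_ne_zero_iff.mpr fun _ _ => hn _)) (hn _)
    refine hF.congr ?_
    filter_upwards [isOpen_ne.mem_nhds h0] with B hB
    rw [sixJR, if_pos h, if_neg hB]

/-! ### The symbol as a normalized Racah sum -/

open Classical in
/-- The contribution of a vertex to the renormalized symbol. -/
noncomputable def vertexFactor (a b c : ℕ) (A : ℂ) : ℂ :=
  if Adm a b c then
    qFact ((a + b - c) / 2) A * qFact ((b + c - a) / 2) A * qFact ((c + a - b) / 2) A /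
      thetaRoot a b c A
  else 0

lemma vertexFactor_of_not {a b c : ℕ} (h : ¬ Adm a b c) : vertexFactor a b c A = 0 := if_neg h

lemma vertexFactor_eq {a b c p q r : ℕ} (ha : a = p + q) (hb : b = p + r) (hc : c = q + r) :
    vertexFactor a b c A = qFact p A * qFact q A * qFact r A / thetaRoot a b c A := by
  rw [vertexFactor, if_pos (adm_of_eq ha hb hc),
    show (a + b - c) / 2 = p by omega, show (b + c - a) / 2 = r by omega,
    show (c + a - b) / 2 = q by omega]
  ring

lemma vertexFactor_swap (a b c : ℕ) : vertexFactor a b c A = vertexFactor b a c A := by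
  by_cases h : Adm a b c
  · obtain ⟨p, q, r, ha, hb, hc⟩ := exists_eq_of_adm h
    rw [vertexFactor_eq ha hb hc,
      vertexFactor_eq (a := b) (p := p) (q := r) (r := q) (by omega) (by omega) (by omega),
      thetaRoot_eq ha hb hc,
      thetaRoot_eq (a := b) (p := p) (q := r) (r := q) (by omega) (by omega) (by omega),
      show p + r + q = p + q + r by omega]
    simp only [div_eq_mul_inv, mul_inv]; ring
  · rw [vertexFactor_of_not h, vertexFactor_of_not (mt adm_swap.mpr h)]

lemma vertexFactor_rotate (a b c : ℕ) : vertexFactor a b c A = vertexFactor b c a A := by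
  by_cases h : Adm a b c
  · obtain ⟨p, q, r, ha, hb, hc⟩ := exists_eq_of_adm h
    rw [vertexFactor_eq ha hb hc,
      vertexFactor_eq (a := b) (p := r) (q := p) (r := q) (by omega) (by omega) (by omega),
      thetaRoot_eq ha hb hc,
      thetaRoot_eq (a := b) (p := r) (q := p) (r := q) (by omega) (by omega) (by omega),
      show r + p + q = p + q + r by omega]
    simp only [div_eq_mul_inv, mul_inv]; ring
  · rw [vertexFactor_of_not h, vertexFactor_of_not (mt adm_rotate.mpr h)]

/-- The square of the theta root is the theta evaluation. Vertices on a summation edge occur in two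
symbols of each product, so the weights of the Racah identities are supplied by these squares. -/
lemma triSq_eq_vertexFactor (hA : A ∈ Metric.ball (0 : ℂ) 1) (hA0 : A ≠ 0) (a b c : ℕ) :
    triSq A a b c = vertexFactor a b c A ^ 2 / (qFact a A * qFact b A * qFact c A) := by
  have hq := fun n => qFact_ne_zero (isGeneric_of_mem_ball hA hA0) n
  by_cases h : Adm a b c
  · obtain ⟨p, q, r, ha, hb, hc⟩ := exists_eq_of_adm h
    rw [vertexFactor_eq ha hb hc, triSq_eq ha hb hc, div_pow,
      (isSqrtBranch_thetaRoot h).2.1 A ⟨ball_subset_discS hA, hA0⟩, thetaEval,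
      show (a + b + c) / 2 = p + q + r by omega,
      show (a + b - c) / 2 = p by omega, show (b + c - a) / 2 = r by omega,
      show (c + a - b) / 2 = q by omega]
    have h1 := hq a
    have h2 := hq b
    have h3 := hq c
    have h4 := hq p
    have h5 := hq q
    have h6 := hq r
    have h7 := hq (p + q + r + 1)
    have h8 := neg_one_pow_mul_self (p + q + r)
    have h9 : (-1 : ℂ) ^ (p + q + r) ≠ 0 := by simp
    field_simp
    linear_combination h8
  · rw [vertexFactor_of_not h, triSq_of_not h]; simp

lemma circleRoot_sq (hA : A ∈ Metric.ball (0 : ℂ) 1) (hA0 : A ≠ 0) (k : ℕ) :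
    (-1) ^ k * qz A (k + 1) = circleRoot k A ^ 2 := by
  rw [(isSqrtBranch_circleRoot k).2.1 A ⟨ball_subset_discS hA, hA0⟩, circleEval,
    qInt_eq_qz (isGeneric_of_mem_ball hA hA0)]
  push_cast; rfl

lemma racahSum_eq_sum {t₁ t₂ t₃ t₄ B₁ B₂ B₃ N : ℕ} {s : Finset ℕ}
    (hs : ∀ z, z ∈ s ↔ (t₁ ≤ z ∧ t₂ ≤ z ∧ t₃ ≤ z ∧ t₄ ≤ z) ∧ z ≤ B₁ ∧ z ≤ B₂ ∧ z ≤ B₃)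
    (hN : B₁ < N) :
    racahSum A t₁ t₂ t₃ t₄ B₁ B₂ B₃ N = ∑ z ∈ s, (-1) ^ z * (qFact (z + 1) A /
      ((qFact (z - t₁) A * qFact (z - t₂) A * qFact (z - t₃) A * qFact (z - t₄) A) *
        (qFact (B₁ - z) A * qFact (B₂ - z) A * qFact (B₃ - z) A))) := by
  rw [racahSum]
  symm
  trans ∑ z ∈ s, racahTerm A t₁ t₂ t₃ t₄ B₁ B₂ B₃ z
  · refine Finset.sum_congr rfl fun z hz => ?_
    obtain ⟨⟨h1, h2, h3, h4⟩, h5, h6, h7⟩ := (hs z).mp hz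
    rw [racahTerm, qInvFact_of_eq (Nat.cast_sub h1).symm, qInvFact_of_eq (Nat.cast_sub h2).symm,
      qInvFact_of_eq (Nat.cast_sub h3).symm, qInvFact_of_eq (Nat.cast_sub h4).symm,
      qInvFact_of_eq (Nat.cast_sub h5).symm, qInvFact_of_eq (Nat.cast_sub h6).symm,
      qInvFact_of_eq (Nat.cast_sub h7).symm]
    simp only [div_eq_mul_inv, mul_inv]
    ring
  · refine Finset.sum_subset (fun z hz => ?_) fun z _ hz => racahTerm_eq_zero ?_
    · rw [Finset.mem_range]
      exact ((hs z).mp hz).2.1.trans_lt hN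
    · rw [hs] at hz
      omega

lemma sum_tetRange {a b c d e f : ℕ} (h : TetAdm a b c d e f) :
    ∑ z ∈ tetRange a b c d e f, (-1) ^ z * (qFact (z + 1) A /
        ((∏ j : Fin 4, qFact (z - tri a b c d e f j) A) *
          (∏ i : Fin 3, qFact (box a b c d e f i - z) A) * qFact 1 A)) =
      racahS A a b c d e f := by
  have h1 : qFact 1 A = 1 := by simp [qFact, qInt]
  rw [racahS, if_pos h, racahSum_eq_sum (s := tetRange a b c d e f)
    (fun z => by
      rw [mem_tetRange]
      simp only [Fin.forall_fin_succ, tri, box]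
      simp) (by omega)]
  simp only [Fin.prod_univ_four, Fin.prod_univ_three, tri, box, Matrix.cons_val, h1, mul_one]

/-- The twelve differences are the half-defects of the triangle inequalities, three for each vertex,
so the product distributes over the vertex factors. -/
lemma prod_box_sub_tri (φ : ℕ → ℂ) {a b c d e f : ℕ} (h : TetAdm a b c d e f) :
    ∏ i, ∏ j, φ (box a b c d e f i - tri a b c d e f j) =
      (φ ((a + b - c) / 2) * φ ((b + c - a) / 2) * φ ((c + a - b) / 2)) *
      (φ ((a + e - f) / 2) * φ ((e + f - a) / 2) * φ ((f + a - e) / 2)) *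
      (φ ((d + b - f) / 2) * φ ((b + f - d) / 2) * φ ((f + d - b) / 2)) *
      (φ ((d + e - c) / 2) * φ ((e + c - d) / 2) * φ ((c + d - e) / 2)) := by
  have hsub : ∀ {x y z B t : ℕ}, z ≤ x + y → t % 2 = 0 → B + z = t + (x + y) →
      B / 2 - t / 2 = (x + y - z) / 2 := by
    intro x y z B t hz ht hB
    omega
  obtain ⟨h1, h2, h3, h4⟩ := h
  rw [adm_iff] at h1 h2 h3 h4
  obtain ⟨i1, j1, k1, e1⟩ := h1
  obtain ⟨i2, j2, k2, e2⟩ := h2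
  obtain ⟨i3, j3, k3, e3⟩ := h3
  obtain ⟨i4, j4, k4, e4⟩ := h4
  simp only [Fin.prod_univ_four, Fin.prod_univ_three, tri, box, Matrix.cons_val]
  rw [
    hsub (x := a) (y := b) (z := c) (B := a + b + d + e) (t := d + e + c) (by omega) e4 (by ring),
    hsub (x := b) (y := c) (z := a) (B := b + c + e + f) (t := a + e + f) (by omega) e2 (by ring),
    hsub (x := c) (y := a) (z := b) (B := a + c + d + f) (t := d + b + f) (by omega) e3 (by ring),
    hsub (x := a) (y := e) (z := f) (B := a + b + d + e) (t := d + b + f) (by omega) e3 (by ring),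
    hsub (x := e) (y := f) (z := a) (B := b + c + e + f) (t := a + b + c) (by omega) e1 (by ring),
    hsub (x := f) (y := a) (z := e) (B := a + c + d + f) (t := d + e + c) (by omega) e4 (by ring),
    hsub (x := d) (y := b) (z := f) (B := a + b + d + e) (t := a + e + f) (by omega) e2 (by ring),
    hsub (x := b) (y := f) (z := d) (B := b + c + e + f) (t := d + e + c) (by omega) e4 (by ring),
    hsub (x := f) (y := d) (z := b) (B := a + c + d + f) (t := a + b + c) (by omega) e1 (by ring),
    hsub (x := d) (y := e) (z := c) (B := a + b + d + e) (t := a + b + c) (by omega) e1 (by ring),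
    hsub (x := e) (y := c) (z := d) (B := b + c + e + f) (t := d + b + f) (by omega) e3 (by ring),
    hsub (x := c) (y := d) (z := e) (B := a + c + d + f) (t := a + e + f) (by omega) e2 (by ring)]
  ring

lemma sixJR_eq_racahS (hA : A ∈ Metric.ball (0 : ℂ) 1) (hA0 : A ≠ 0) (a b c d e f : ℕ) :
    sixJR a b c d e f A = racahS A a b c d e f *
      (vertexFactor a b c A * vertexFactor a e f A * vertexFactor d b f A *
        vertexFactor d e c A) * (circleRoot c A * circleRoot f A) /
      (qFact a A * qFact b A * qFact c A * qFact d A * qFact e A * qFact f A) := by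
  by_cases h : TetAdm a b c d e f
  swap
  · rw [sixJR_of_not h, racahS_of_not h]; simp
  have hA' : A ∈ discS \ {0} := ⟨ball_subset_discS hA, hA0⟩
  rw [sixJR, if_pos h, if_neg hA0, sixJFormula, sqrtCircle_eq _ hA', sqrtCircle_eq _ hA',
    sqrtTheta_eq h.1 hA', sqrtTheta_eq h.2.1 hA', sqrtTheta_eq h.2.2.1 hA',
    sqrtTheta_eq h.2.2.2 hA', tetEval, ← tetRange, sum_tetRange h]
  have hv : ∀ {x y z : ℕ}, Adm x y z → vertexFactor x y z A = qFact ((x + y - z) / 2) A *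
    qFact ((y + z - x) / 2) A * qFact ((z + x - y) / 2) A / thetaRoot x y z A :=
    fun h => if_pos h
  rw [hv h.1, hv h.2.1, hv h.2.2.1, hv h.2.2.2, prod_box_sub_tri (fun n => qFact n A) h]
  simp only [div_eq_mul_inv, mul_inv]
  ring

/-! ### Symmetry, orthogonality and Biedenharn-Elliott identity on `discS` -/

/-- An identity of continuous functions on the punctured disc extends to `discS`. -/
lemma eq_of_eq_on_ball {F G : ℂ → ℂ} (hA : A ∈ discS) (hF : ContinuousAt F A)
    (hG : ContinuousAt G A) (h : ∀ B ∈ Metric.ball (0 : ℂ) 1, B ≠ 0 → F B = G B) : F A = G A := by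
  have hcl : A ∈ closure (Metric.ball (0 : ℂ) 1 ∩ {0}ᶜ) := by
    have h1 : closure (Metric.ball (0 : ℂ) 1) ⊆ closure (Metric.ball (0 : ℂ) 1 ∩ {0}ᶜ) :=
      closure_minimal ((dense_compl_singleton (0 : ℂ)).open_subset_closure_inter Metric.isOpen_ball)
        isClosed_closure
    apply h1
    rw [closure_ball _ one_ne_zero]
    exact hA.1
  have := mem_closure_iff_nhdsWithin_neBot.mp hcl
  refine tendsto_nhds_unique (hF.tendsto.mono_left
    (nhdsWithin_le_nhds (s := Metric.ball (0 : ℂ) 1 ∩ {0}ᶜ)))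
    ((hG.tendsto.mono_left nhdsWithin_le_nhds).congr' ?_)
  filter_upwards [self_mem_nhdsWithin] with B hB
  exact (h B hB.1 hB.2).symm

lemma continuousAt_sixJR (hA : A ∈ discS) (a b c d e f : ℕ) :
    ContinuousAt (sixJR a b c d e f) A := (analyticOnNhd_sixJR a b c d e f A hA).continuousAt

theorem sixJR_flip (hA : A ∈ discS) (a b c d e f : ℕ) :
    sixJR a b c d e f A = sixJR a e f d b c A := by
  refine eq_of_eq_on_ball hA (continuousAt_sixJR hA _ _ _ _ _ _) (continuousAt_sixJR hA _ _ _ _ _ _)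
    fun B hB hB0 => ?_
  rw [sixJR_eq_racahS hB hB0, sixJR_eq_racahS hB hB0, racahS_flip]
  simp only [div_eq_mul_inv, mul_inv]
  ring

theorem sixJR_orthogonality (hA : A ∈ discS) {a b c d e : ℕ} (g : ℕ) (h₁ : Adm a b c)
    (h₂ : Adm d e c) :
    HasSum (fun f : ℕ => sixJR a b c d e f A * sixJR a b g d e f A) (if c = g then 1 else 0) := by
  have key : ∑ f ∈ Finset.range (a + e + 1), sixJR a b c d e f A * sixJR a b g d e f A =
      if c = g then 1 else 0 := by
    refine eq_of_eq_on_ball (F := fun A => ∑ f ∈ Finset.range (a + e + 1),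
      sixJR a b c d e f A * sixJR a b g d e f A) hA
      (tendsto_finsetSum _ fun f _ => (continuousAt_sixJR hA _ _ _ _ _ _).mul
        (continuousAt_sixJR hA _ _ _ _ _ _)) continuousAt_const fun B hB hB0 => ?_
    have hg := isGeneric_of_mem_ball hB hB0
    have hq := fun n => qFact_ne_zero hg n
    have ho := racahS_orthogonality hg (g := g) (N := a + e + 1) h₁ h₂ (by omega)
    simp only [circleRoot_sq hB hB0, triSq_eq_vertexFactor hB hB0, ← Finset.sum_mul] at ho
    have hsum : ∑ f ∈ Finset.range (a + e + 1), sixJR a b c d e f B * sixJR a b g d e f B =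
        (∑ f ∈ Finset.range (a + e + 1), circleRoot f B ^ 2 *
          (vertexFactor a e f B ^ 2 / (qFact a B * qFact e B * qFact f B) *
            (vertexFactor d b f B ^ 2 / (qFact d B * qFact b B * qFact f B))) *
          (racahS B a b c d e f * racahS B a b g d e f)) *
        (vertexFactor a b c B * vertexFactor d e c B * vertexFactor a b g B * vertexFactor d e g B *
          circleRoot c B * circleRoot g B /
          (qFact a B * qFact b B * qFact c B * qFact d B * qFact e B * qFact g B)) := by
      rw [Finset.sum_mul]
      refine Finset.sum_congr rfl fun f _ => ?_
      rw [sixJR_eq_racahS hB hB0, sixJR_eq_racahS hB hB0]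
      simp only [div_eq_mul_inv, mul_inv]
      ring
    rw [hsum]
    split_ifs with hcg
    · subst hcg
      rw [if_pos rfl] at ho
      rw [← ho]
      simp only [div_eq_mul_inv, mul_inv]
      ring
    · rw [if_neg hcg] at ho
      have hv : ∀ {x y z : ℕ}, Adm x y z → vertexFactor x y z B ≠ 0 := fun h => by
        rw [vertexFactor, if_pos h]
        exact div_ne_zero (by simp [hq]) (thetaRoot_ne_zero _ _ _ ⟨ball_subset_discS hB, hB0⟩)
      have hne := circleRoot_ne_zero c ⟨ball_subset_discS hB, hB0⟩
      have := hv h₁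
      have := hv h₂
      -- The factors depending on `c` alone are nonzero, so the Racah orthogonality forces the inner
      -- sum to vanish; nothing is needed about the factors depending on `g`.
      rw [mul_eq_zero, mul_eq_zero] at ho
      rw [(ho.resolve_right (by simp [hne])).resolve_right (by simp [*]), zero_mul]
  rw [← key]
  refine hasSum_sum_of_ne_finset_zero fun f hf => ?_
  rw [Finset.mem_range, not_lt] at hf
  rw [sixJR_of_not, zero_mul]
  simp only [TetAdm, adm_iff]; omega

lemma vertexFactor_reverse (a b c : ℕ) : vertexFactor a b c A = vertexFactor c b a A := by
  rw [vertexFactor_swap, vertexFactor_rotate, vertexFactor_rotate]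

theorem sixJR_biedenharn_elliott (hA : A ∈ discS) (a b c d e f g h i : ℕ) :
    HasSum (fun l : ℕ =>
        sixJR c e d h i l A * sixJR b a c l i g A * sixJR a g l h e f A)
      (sixJR a b c d e f A * sixJR b f d h i g A) := by
  have key : ∑ l ∈ Finset.range (a + g + 1),
      sixJR c e d h i l A * sixJR b a c l i g A * sixJR a g l h e f A =
      sixJR a b c d e f A * sixJR b f d h i g A := by
    refine eq_of_eq_on_ball (F := fun A => ∑ l ∈ Finset.range (a + g + 1),
      sixJR c e d h i l A * sixJR b a c l i g A * sixJR a g l h e f A) (G := fun A =>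
      sixJR a b c d e f A * sixJR b f d h i g A) hA
      (tendsto_finsetSum _ fun f _ => ((continuousAt_sixJR hA _ _ _ _ _ _).mul
        (continuousAt_sixJR hA _ _ _ _ _ _)).mul (continuousAt_sixJR hA _ _ _ _ _ _))
      ((continuousAt_sixJR hA _ _ _ _ _ _).mul (continuousAt_sixJR hA _ _ _ _ _ _))
      fun B hB hB0 => ?_
    have hg := isGeneric_of_mem_ball hB hB0
    have hp := pentagon hg a b c f e g d i h (a + g + 1) (by omega)
    simp only [pentagonTerm, circleRoot_sq hB hB0, triSq_eq_vertexFactor hB hB0] at hp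
    -- `K` collects the normalization independent of `l`. The vertex `(d, b, f)` lies in both
    -- symbols on the left, so its factor is already supplied by `triSq` in the Racah identity.
    obtain ⟨K, hK⟩ : ∃ K, K = vertexFactor a b c B * vertexFactor a e f B * vertexFactor d e c B *
      vertexFactor b i g B * vertexFactor h f g B * vertexFactor h i d B *
      (circleRoot c B * circleRoot f B * circleRoot d B * circleRoot g B) /
      (qFact a B * qFact b B * qFact c B * qFact d B * qFact e B * qFact f B * qFact g B *
        qFact h B * qFact i B) := ⟨_, rfl⟩
    have hR := congrArg (K * ·) hp
    simp only [Finset.mul_sum] at hR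
    refine Eq.trans (Finset.sum_congr rfl fun l _ => ?_) (hR.symm.trans ?_)
    · rw [sixJR_eq_racahS hB hB0, sixJR_eq_racahS hB hB0, sixJR_eq_racahS hB hB0, hK,
        racahS_swap b a, racahS_flip a g, racahS_swap_right a e,
        vertexFactor_reverse c e d, vertexFactor_swap b a c, vertexFactor_rotate l a g,
        vertexFactor_swap c i l, vertexFactor_rotate l i c, vertexFactor_rotate h g f,
        vertexFactor_reverse g f h]
      simp only [div_eq_mul_inv, mul_inv]
      ring
    · rw [sixJR_eq_racahS hB hB0, sixJR_eq_racahS hB hB0, hK, ← vertexFactor_rotate d b f]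
      simp only [div_eq_mul_inv, mul_inv]
      ring
  rw [← key]
  refine hasSum_sum_of_ne_finset_zero fun l hl => ?_
  rw [Finset.mem_range, not_lt] at hl
  rw [sixJR_of_not (a := a), mul_zero]
  simp only [TetAdm, adm_iff]; omega

/-! ### Reality on the axes -/

lemma exists_sq_eq_of_mem_axes (h : A.im = 0 ∨ A.re = 0) : ∃ s : ℝ, A ^ 2 = s := by
  rcases h with h | h
  · exact ⟨A.re ^ 2, by apply Complex.ext <;> simp [pow_two, h]⟩
  · exact ⟨-A.im ^ 2, by apply Complex.ext <;> simp [pow_two, h]⟩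

/-- On the axes `A ^ 4` is the square of a real number. Positivity is what matters: every complex
square root of the value is then real. -/
lemma exists_qPoly_eq (h : A.im = 0 ∨ A.re = 0) {n : ℕ} (hn : 0 < n) :
    ∃ r : ℝ, 0 < r ∧ qPoly n A = r := by
  obtain ⟨s, hs⟩ := exists_sq_eq_of_mem_axes h
  refine ⟨∑ k ∈ Finset.range n, (s ^ 2) ^ k, ?_, ?_⟩
  · exact Finset.sum_pos' (fun _ _ => by positivity) ⟨0, by simp [hn]⟩
  · rw [qPoly]
    push_cast
    refine Finset.sum_congr rfl fun k _ => ?_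
    rw [← hs]; ring

lemma qRoot_mem_real (h : A.im = 0 ∨ A.re = 0) {n : ℕ} (hn : 0 < n) :
    qRoot n A ∈ Complex.ofRealHom.fieldRange := by
  obtain ⟨r, hr, hq⟩ := exists_qPoly_eq h hn
  have hsq : qRoot n A ^ 2 = (Real.sqrt r : ℂ) ^ 2 := by
    rw [qRoot_sq hn, hq]
    exact_mod_cast (Real.sq_sqrt hr.le).symm
  rcases sq_eq_sq_iff_eq_or_eq_neg.mp hsq with h | h <;> rw [h]
  · exact ⟨Real.sqrt r, rfl⟩
  · exact neg_mem ⟨Real.sqrt r, rfl⟩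

lemma qRootFact_mem_real (h : A.im = 0 ∨ A.re = 0) (n : ℕ) :
    qRootFact n A ∈ Complex.ofRealHom.fieldRange :=
  prod_mem fun _ _ => qRoot_mem_real h (Nat.succ_pos _)

lemma qPolyFact_mem_real (h : A.im = 0 ∨ A.re = 0) (n : ℕ) :
    qPolyFact n A ∈ Complex.ofRealHom.fieldRange := by
  rw [← qRootFact_sq]
  exact pow_mem (qRootFact_mem_real h n) 2

theorem sixJR_im (hA : A ∈ discS) (h : A.im = 0 ∨ A.re = 0) (a b c d e f : ℕ) :
    (sixJR a b c d e f A).im = 0 := by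
  by_cases hadm : TetAdm a b c d e f
  swap
  · rw [sixJR_of_not hadm, Complex.zero_im]
  suffices hmem : sixJExplicit a b c d e f A ∈ Complex.ofRealHom.fieldRange by
    obtain ⟨r, hr⟩ := hmem
    rw [sixJR_eq_explicit hadm hA, ← hr]
    exact Complex.ofReal_im r
  have hsq : A ^ 2 ∈ Complex.ofRealHom.fieldRange := by
    obtain ⟨s, hs⟩ := exists_sq_eq_of_mem_axes h
    exact ⟨s, hs.symm⟩
  have hR := qRootFact_mem_real h
  have hP := qPolyFact_mem_real h
  refine mul_mem (div_mem (mul_mem (prod_mem fun _ _ => prod_mem fun _ _ => hR _)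
    (mul_mem (qRoot_mem_real h (Nat.succ_pos _)) (qRoot_mem_real h (Nat.succ_pos _))))
    (prod_mem fun _ _ => hR _)) (sum_mem fun z _ => ?_)
  refine mul_mem (mul_mem (pow_mem (neg_mem (one_mem _)) _) ?_)
    (div_mem (hP _) (mul_mem (prod_mem fun _ _ => hP _) (prod_mem fun _ _ => hP _)))
  -- The order is even, so only the real number `A ^ 2` enters.
  rw [sixJOrder, pow_mul]
  exact pow_mem hsq _

/-! ### The leading term and the value at zero -/

lemma tri_le_box {a b c d e f : ℕ} (h : TetAdm a b c d e f) (i : Fin 3) (j : Fin 4) :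
    tri a b c d e f j ≤ box a b c d e f i := by
  obtain ⟨h1, h2, h3, h4⟩ := h
  obtain ⟨i1, j1, k1, -⟩ := h1
  obtain ⟨i2, j2, k2, -⟩ := h2
  obtain ⟨i3, j3, k3, -⟩ := h3
  obtain ⟨i4, j4, k4, -⟩ := h4
  fin_cases i <;> fin_cases j <;> refine Nat.div_le_div_right ?_ <;> omega

/-- The largest element of the range of summation. -/
lemma exists_top {a b c d e f : ℕ} (h : TetAdm a b c d e f) : ∃ (u : Fin 3 → ℕ) (v : Fin 4 → ℕ)
    (m : ℕ), m = Finset.univ.inf' Finset.univ_nonempty (box a b c d e f) ∧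
      m ∈ tetRange a b c d e f ∧ (∀ z ∈ tetRange a b c d e f, z ≤ m) ∧
      (u 0 = 0 ∨ u 1 = 0 ∨ u 2 = 0) ∧ (∀ i, box a b c d e f i = m + u i) ∧
      (∀ j, tri a b c d e f j + v j = m) ∧ m = u 0 + u 1 + u 2 + (v 0 + v 1 + v 2 + v 3) ∧
      a = u 0 + u 1 + v 2 + v 3 ∧ b = u 0 + u 2 + v 1 + v 3 ∧ c = u 1 + u 2 + v 1 + v 2 ∧
      d = u 0 + u 1 + v 0 + v 1 ∧ e = u 0 + u 2 + v 0 + v 2 ∧ f = u 1 + u 2 + v 0 + v 3 := by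
  have hle : ∀ i, Finset.univ.inf' Finset.univ_nonempty (box a b c d e f) ≤ box a b c d e f i :=
    fun i => Finset.inf'_le _ (Finset.mem_univ i)
  obtain ⟨i₀, -, hi₀⟩ := Finset.exists_mem_eq_inf' Finset.univ_nonempty (box a b c d e f)
  obtain ⟨m, hm⟩ : ∃ m, m = Finset.univ.inf' Finset.univ_nonempty (box a b c d e f) := ⟨_, rfl⟩
  rw [← hm] at hle hi₀
  have hmem : m ∈ tetRange a b c d e f :=
    mem_tetRange.mpr ⟨fun j => hi₀ ▸ tri_le_box h i₀ j, hle⟩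
  obtain ⟨u, v, hu, huv⟩ := exists_of_mem_tetRange h hmem
  refine ⟨u, v, m, hm, hmem, fun z hz => hi₀ ▸ (mem_tetRange.mp hz).2 i₀, ?_, hu, huv⟩
  have h0 : u i₀ = 0 := by have := hu i₀; omega
  fin_cases i₀
  · exact Or.inl h0
  · exact Or.inr (Or.inl h0)
  · exact Or.inr (Or.inr h0)

/-- Lowering `z` by `k` raises all `uᵢ` by `k`. Only the largest `z` contributes to the leading
order, and the remaining terms are dominated by a geometric series. -/
lemma sixJOrder_add (u : Fin 3 → ℕ) (k : ℕ) : sixJOrder u + k ≤ sixJOrder (fun i => u i + k) := by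
  simp only [sixJOrder]
  nlinarith [Nat.zero_le (u 0 * k), Nat.zero_le (u 1 * k), Nat.zero_le (u 2 * k),
    Nat.zero_le (k * k)]

lemma qPolyFact_zero (n : ℕ) : qPolyFact n 0 = 1 := by
  rw [← qRootFact_sq, qRootFact_zero, one_pow]

theorem sixJR_zero {a b c d e f : ℕ} (h : TetAdm a b c d e f) :
    sixJR a b c d e f 0 = if c + f = max (a + d) (b + e) then 1 else 0 := by
  obtain ⟨u, v, m, -, hm, hmax, h0, hu, -, -, ha, hb, hc, hd, he, hf⟩ := exists_top h
  rw [sixJR_eq_explicit h zero_mem_discS, sixJExplicit, Finset.sum_eq_single_of_mem m hm]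
  · have hu' : (fun i => box a b c d e f i - m) = u := by
      funext i; rw [hu]; omega
    simp only [sixJPrefactor, sixJTerm, qRootFact_zero, qRoot_zero, qPolyFact_zero, hu',
      Finset.prod_const_one, mul_one, div_one, one_mul]
    -- Here `c + f - (a + d) = 2 (u 2 - u 0)` and `c + f - (b + e) = 2 (u 1 - u 0)`. Since some `u
    -- i` is zero, the condition says `u 0 = 0` and `u 1 * u 2 = 0`, that is, order zero.
    split_ifs with hcond
    · have h1 : u 0 = 0 := by omega
      have h2 : u 1 = 0 ∨ u 2 = 0 := by omega
      have h3 : sixJOrder u = 0 := by rcases h2 with h2 | h2 <;> simp [sixJOrder, h1, h2]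
      have h4 : box a b c d e f 0 - m = u 0 := congrFun hu' 0
      rw [h4, h1, h3]; simp
    · have h3 : sixJOrder u ≠ 0 := by
        intro h3
        simp only [sixJOrder, mul_eq_zero, Nat.add_eq_zero_iff] at h3
        omega
      rw [zero_pow h3, mul_zero]
  · intro z hz hne
    have hlt := lt_of_le_of_ne (hmax z hz) hne
    have hu' : (fun i => box a b c d e f i - z) = fun i => u i + (m - z) := by
      funext i; rw [hu]; omega
    have := sixJOrder_add u (m - z)
    rw [sixJTerm, hu', zero_pow (by omega), mul_zero, zero_mul]

/-! ### The uniform estimate on the open disc -/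

/-- A bound for the partial products of Euler's function and for their inverses. -/
noncomputable def eulerBound (x : ℝ) : ℝ := Real.exp (x / (1 - x) ^ 2)

lemma one_sub_pow_four_mul_qPolyFact (n : ℕ) (A : ℂ) :
    qPolyFact n A * (1 - A ^ 4) ^ n = ∏ k ∈ Finset.range n, (1 - (A ^ 4) ^ (k + 1)) := by
  have : (1 - A ^ 4) ^ n = ∏ k ∈ Finset.range n, (1 - A ^ 4) := by simp
  rw [qPolyFact, this, ← Finset.prod_mul_distrib]
  refine Finset.prod_congr rfl fun k _ => ?_
  have := mul_neg_geom_sum (A ^ 4) (k + 1)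
  rw [← this, qPoly]
  simp only [pow_mul]
  ring

lemma sum_pow_succ_le {x : ℝ} (hx0 : 0 ≤ x) (hx : x < 1) (n : ℕ) :
    ∑ k ∈ Finset.range n, x ^ (k + 1) ≤ x / (1 - x) := by
  have h := (summable_geometric_of_lt_one hx0 hx).sum_le_tsum (Finset.range n)
    (fun k _ => pow_nonneg hx0 k)
  rw [tsum_geometric_of_lt_one hx0 hx] at h
  calc ∑ k ∈ Finset.range n, x ^ (k + 1) = x * ∑ k ∈ Finset.range n, x ^ k := by
        rw [Finset.mul_sum]; exact Finset.sum_congr rfl fun k _ => pow_succ' x k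
    _ ≤ x * (1 - x)⁻¹ := mul_le_mul_of_nonneg_left h hx0
    _ = x / (1 - x) := rfl

/-- The lower bound rests on `(1 - y) (1 + y / (1 - x)) ≥ 1` for `0 ≤ y ≤ x < 1`. Exponential form
makes products of such bounds additive in the exponents. -/
lemma norm_one_sub_le {x : ℝ} {w : ℂ} {y : ℝ} (hx : x < 1) (hy : 0 ≤ y) (hyx : y ≤ x)
    (hw : ‖w‖ ≤ y) : Real.exp (-(y / (1 - x))) ≤ ‖1 - w‖ ∧ ‖1 - w‖ ≤ Real.exp (y / (1 - x)) := by
  have h1x : 0 < 1 - x := by linarith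
  constructor
  · have h1 : 1 - y ≤ ‖1 - w‖ := by
      have := norm_sub_norm_le (1 : ℂ) w
      rw [norm_one] at this; linarith
    have h2 : 1 + y / (1 - x) ≤ Real.exp (y / (1 - x)) := by
      linarith [Real.add_one_le_exp (y / (1 - x))]
    have h3 : 1 ≤ (1 - y) * (1 + y / (1 - x)) := by
      have : y * (1 - x) ≤ y * (1 - y) := mul_le_mul_of_nonneg_left (by linarith) hy
      have h4 : y ≤ (1 - y) * (y / (1 - x)) := by
        rw [mul_div_assoc', le_div_iff₀ h1x]; linarith
      linarith
    have h4 : 1 ≤ (1 - y) * Real.exp (y / (1 - x)) :=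
      h3.trans (mul_le_mul_of_nonneg_left h2 (by linarith))
    rw [Real.exp_neg]
    refine le_trans ?_ h1
    rwa [inv_le_iff_one_le_mul₀ (Real.exp_pos _)]
  · have h1 : ‖1 - w‖ ≤ 1 + y := by
      have := norm_sub_le (1 : ℂ) w
      rw [norm_one] at this; linarith
    have h2 : y ≤ y / (1 - x) := by
      rw [le_div_iff₀ h1x]; nlinarith
    linarith [Real.add_one_le_exp (y / (1 - x))]

lemma norm_euler_prod (hA : ‖A‖ < 1) (n : ℕ) :
    (eulerBound ‖A‖)⁻¹ ≤ ‖∏ k ∈ Finset.range n, (1 - (A ^ 4) ^ (k + 1))‖ ∧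
      ‖∏ k ∈ Finset.range n, (1 - (A ^ 4) ^ (k + 1))‖ ≤ eulerBound ‖A‖ := by
  have hx0 := norm_nonneg A
  have h1x : 0 < 1 - ‖A‖ := by linarith
  have hk : ∀ k : ℕ, Real.exp (-(‖A‖ ^ (k + 1) / (1 - ‖A‖))) ≤ ‖1 - (A ^ 4) ^ (k + 1)‖ ∧
      ‖1 - (A ^ 4) ^ (k + 1)‖ ≤ Real.exp (‖A‖ ^ (k + 1) / (1 - ‖A‖)) := fun k => by
    refine norm_one_sub_le hA (by positivity) ?_ ?_
    · exact pow_le_of_le_one hx0 hA.le k.succ_ne_zero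
    · rw [← pow_mul, norm_pow]
      exact pow_le_pow_of_le_one hx0 hA.le (by omega)
  have hsum : ∑ k ∈ Finset.range n, ‖A‖ ^ (k + 1) / (1 - ‖A‖) ≤ ‖A‖ / (1 - ‖A‖) ^ 2 := by
    rw [← Finset.sum_div, pow_two, ← div_div]
    exact div_le_div_of_nonneg_right (sum_pow_succ_le hx0 hA n) h1x.le
  rw [norm_prod, eulerBound, ← Real.exp_neg]
  constructor
  · refine le_trans ?_ (Finset.prod_le_prod (fun k _ => (Real.exp_pos _).le) fun k _ => (hk k).1)
    rw [← Real.exp_sum, Finset.sum_neg_distrib]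
    exact Real.exp_le_exp.mpr (neg_le_neg hsum)
  · refine le_trans (Finset.prod_le_prod (fun k _ => norm_nonneg _) fun k _ => (hk k).2) ?_
    rw [← Real.exp_sum]
    exact Real.exp_le_exp.mpr hsum

lemma one_le_eulerBound {x : ℝ} (hx0 : 0 ≤ x) : 1 ≤ eulerBound x :=
  Real.one_le_exp (by positivity)

/-- The square root of `|1 - A ^ 4|`. -/
noncomputable def rootNorm (A : ℂ) : ℝ := Real.sqrt ‖1 - A ^ 4‖

lemma rootNorm_sq (A : ℂ) : rootNorm A ^ 2 = ‖1 - A ^ 4‖ := Real.sq_sqrt (norm_nonneg _)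

lemma rootNorm_pos (hA : ‖A‖ < 1) : 0 < rootNorm A := by
  refine Real.sqrt_pos.mpr (norm_pos_iff.mpr (sub_ne_zero.mpr fun h => ?_))
  rw [Complex.norm_eq_one_of_pow_eq_one h.symm (by norm_num)] at hA
  exact lt_irrefl _ hA

/-- Multiplied by the `n`-th power of `rootNorm A`, the norm squares to a partial Euler product,
bounded above and below independently of `n`. As `eulerBound` is at least 1, it can stand in for its
own square root. -/
lemma norm_qRootFact (hA : ‖A‖ < 1) (n : ℕ) :
    (eulerBound ‖A‖)⁻¹ / rootNorm A ^ n ≤ ‖qRootFact n A‖ ∧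
      ‖qRootFact n A‖ ≤ eulerBound ‖A‖ / rootNorm A ^ n := by
  have hs := pow_pos (rootNorm_pos hA) n
  have hsq : (‖qRootFact n A‖ * rootNorm A ^ n) ^ 2 =
      ‖∏ k ∈ Finset.range n, (1 - (A ^ 4) ^ (k + 1))‖ := by
    rw [← one_sub_pow_four_mul_qPolyFact, norm_mul, norm_pow, ← rootNorm_sq, ← qRootFact_sq,
      norm_pow]
    ring
  obtain ⟨h1, h2⟩ := norm_euler_prod hA n
  rw [← hsq] at h1 h2
  have hE := one_le_eulerBound (norm_nonneg A)
  have hpos : 0 ≤ ‖qRootFact n A‖ * rootNorm A ^ n := mul_nonneg (norm_nonneg _) hs.le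
  rw [div_le_iff₀ hs, le_div_iff₀ hs]
  constructor
  · have hi : (eulerBound ‖A‖)⁻¹ ≤ 1 := inv_le_one_of_one_le₀ hE
    have hi0 : 0 ≤ (eulerBound ‖A‖)⁻¹ := by positivity
    refine le_of_sq_le_sq ?_ hpos
    refine le_trans ?_ h1
    nlinarith
  · refine le_of_sq_le_sq (h2.trans ?_) (by linarith)
    nlinarith

section
variable {ι : Type*} (S : Finset ι) (w : ι → ℕ)

lemma norm_prod_qRootFact_le (hA : ‖A‖ < 1) :
    ‖∏ i ∈ S, qRootFact (w i) A‖ ≤ eulerBound ‖A‖ ^ S.card / rootNorm A ^ ∑ i ∈ S, w i := by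
  rw [norm_prod, ← Finset.prod_pow_eq_pow_sum, ← Finset.prod_const, ← Finset.prod_div_distrib]
  exact Finset.prod_le_prod (fun _ _ => norm_nonneg _) fun i _ => (norm_qRootFact hA _).2

lemma le_norm_prod_qRootFact (hA : ‖A‖ < 1) :
    (eulerBound ‖A‖)⁻¹ ^ S.card / rootNorm A ^ ∑ i ∈ S, w i ≤ ‖∏ i ∈ S, qRootFact (w i) A‖ := by
  rw [norm_prod, ← Finset.prod_pow_eq_pow_sum, ← Finset.prod_const, ← Finset.prod_div_distrib]
  have := one_le_eulerBound (norm_nonneg A)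
  have := rootNorm_pos hA
  exact Finset.prod_le_prod (fun _ _ => by positivity) fun i _ => (norm_qRootFact hA _).1

end

lemma norm_qRoot_le (hA : ‖A‖ < 1) (n : ℕ) : ‖qRoot (n + 1) A‖ ≤ 2 / rootNorm A := by
  have hs := rootNorm_pos hA
  rw [le_div_iff₀ hs]
  refine le_of_sq_le_sq ?_ zero_le_two
  rw [mul_pow, rootNorm_sq, ← norm_pow, qRoot_sq n.succ_pos, ← norm_mul]
  have : qPoly (n + 1) A * (1 - A ^ 4) = 1 - (A ^ 4) ^ (n + 1) := by
    rw [← mul_neg_geom_sum (A ^ 4) (n + 1), qPoly]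
    simp only [pow_mul]; ring
  rw [this]
  have h1 := norm_sub_le (1 : ℂ) ((A ^ 4) ^ (n + 1))
  rw [norm_one, ← pow_mul, norm_pow] at h1
  have h2 : ‖A‖ ^ (4 * (n + 1)) ≤ 1 := pow_le_one₀ (norm_nonneg _) hA.le
  rw [← pow_mul]
  linarith

lemma norm_sixJPrefactor_le (hA : ‖A‖ < 1) {B : Fin 3 → ℕ} {t : Fin 4 → ℕ} {u : Fin 3 → ℕ}
    {v : Fin 4 → ℕ} {m : ℕ} (hu : ∀ i, B i = m + u i) (hv : ∀ j, t j + v j = m)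
    (hm : m = u 0 + u 1 + u 2 + (v 0 + v 1 + v 2 + v 3)) (c f : ℕ) :
    ‖sixJPrefactor B t c f A‖ ≤ 4 * eulerBound ‖A‖ ^ 16 * rootNorm A ^ 2 := by
  have hs := rootNorm_pos hA
  have hE := one_le_eulerBound (norm_nonneg A)
  have hE0 : 0 < eulerBound ‖A‖ := by linarith
  -- The powers of `rootNorm A` are `W + 2` in the numerator, 2 of them from the edge roots, against
  -- `W + 4` in the denominator; the net factor does not depend on the colors.
  obtain ⟨W, hW⟩ : ∃ W, W = 4 * (u 0 + u 1 + u 2) + 3 * (v 0 + v 1 + v 2 + v 3) := ⟨_, rfl⟩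
  have hnum := norm_prod_qRootFact_le (A := A) (Finset.univ : Finset (Fin 3 × Fin 4))
    (fun p => B p.1 - t p.2) hA
  have hden := le_norm_prod_qRootFact (A := A) (Finset.univ : Finset (Fin 4))
    (fun j => t j + 1) hA
  have hW1 : ∑ p : Fin 3 × Fin 4, (B p.1 - t p.2) = W := by
    have : ∀ i j, B i - t j = u i + v j := fun i j => by
      have := hu i; have := hv j; omega
    simp only [this, Fintype.sum_prod_type, Fin.sum_univ_three, Fin.sum_univ_four]
    omega
  have hW2 : ∑ j : Fin 4, (t j + 1) = W + 4 := by
    have h0 := hv 0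
    have h1 := hv 1
    have h2 := hv 2
    have h3 := hv 3
    simp only [Fin.sum_univ_four]
    omega
  rw [hW1, Fintype.prod_prod_type] at hnum
  rw [hW2] at hden
  simp only [Finset.card_univ, Fintype.card_prod, Fintype.card_fin] at hnum hden
  rw [sixJPrefactor, norm_div, norm_mul, norm_mul]
  calc _ ≤ eulerBound ‖A‖ ^ (3 * 4) / rootNorm A ^ W * (2 / rootNorm A * (2 / rootNorm A)) /
        ((eulerBound ‖A‖)⁻¹ ^ 4 / rootNorm A ^ (W + 4)) := by
        refine div_le_div₀ (by positivity) ?_ (by positivity) hden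
        exact mul_le_mul hnum (mul_le_mul (norm_qRoot_le hA c) (norm_qRoot_le hA f)
          (norm_nonneg _) (by positivity)) (by positivity) (by positivity)
    _ = _ := by
        field_simp
        ring

/-- Since `z` is the sum of all `u` and `v`, the quotient of factorial roots keeps a single power of
`1 / rootNorm A`. It carries `eulerBound` to the power `1 + 4 + 3 = 8`, and the term contains its
square. -/
lemma norm_sixJTerm_le (hA : ‖A‖ < 1) {u : Fin 3 → ℕ} {v : Fin 4 → ℕ} {z : ℕ}
    (hz : z = u 0 + u 1 + u 2 + (v 0 + v 1 + v 2 + v 3)) :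
    ‖sixJTerm u v z A‖ ≤ ‖A‖ ^ sixJOrder u * (eulerBound ‖A‖ ^ 16 / rootNorm A ^ 2) := by
  have hs := rootNorm_pos hA
  have hE := one_le_eulerBound (norm_nonneg A)
  have hE0 : 0 < eulerBound ‖A‖ := by linarith
  have h1 := le_norm_prod_qRootFact (A := A) (Finset.univ : Finset (Fin 4)) v hA
  have h2 := le_norm_prod_qRootFact (A := A) (Finset.univ : Finset (Fin 3)) u hA
  have h3 := (norm_qRootFact hA (z + 1)).2
  simp only [Finset.card_univ, Fintype.card_fin] at h1 h2
  have hquot : qPolyFact (z + 1) A / ((∏ j, qPolyFact (v j) A) * ∏ i, qPolyFact (u i) A) =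
      (qRootFact (z + 1) A / ((∏ j, qRootFact (v j) A) * ∏ i, qRootFact (u i) A)) ^ 2 := by
    rw [div_pow, mul_pow, ← Finset.prod_pow, ← Finset.prod_pow]
    simp only [qRootFact_sq]
  rw [sixJTerm, hquot, norm_mul, norm_mul, norm_pow (-1 : ℂ), norm_neg, norm_one, one_pow, one_mul,
    norm_pow, norm_pow, norm_div, norm_mul]
  refine mul_le_mul_of_nonneg_left ?_ (by positivity)
  have hle : ‖qRootFact (z + 1) A‖ / (‖∏ j, qRootFact (v j) A‖ * ‖∏ i, qRootFact (u i) A‖) ≤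
      eulerBound ‖A‖ ^ 8 / rootNorm A := by
    calc _ ≤ eulerBound ‖A‖ / rootNorm A ^ (z + 1) /
          ((eulerBound ‖A‖)⁻¹ ^ 4 / rootNorm A ^ (∑ j, v j) *
            ((eulerBound ‖A‖)⁻¹ ^ 3 / rootNorm A ^ (∑ i, u i))) :=
          div_le_div₀ (by positivity) h3 (by positivity)
            (mul_le_mul h1 h2 (by positivity) (norm_nonneg _))
      _ = _ := by
          have : z = (∑ j, v j) + ∑ i, u i := by
            rw [Fin.sum_univ_three, Fin.sum_univ_four, hz]; ring
          rw [this, pow_succ, pow_add]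
          field_simp
  calc _ ≤ (eulerBound ‖A‖ ^ 8 / rootNorm A) ^ 2 := by gcongr
    _ = _ := by rw [div_pow, ← pow_mul]

lemma sum_pow_sub_le {x : ℝ} (hx0 : 0 ≤ x) (hx : x < 1) {s : Finset ℕ} {m : ℕ}
    (hs : ∀ z ∈ s, z ≤ m) : ∑ z ∈ s, x ^ (m - z) ≤ (1 - x)⁻¹ := by
  rw [← tsum_geometric_of_lt_one hx0 hx]
  have hsub : s ⊆ Finset.range (m + 1) := fun z hz => by
    have := hs z hz
    rw [Finset.mem_range]; omega
  refine (Finset.sum_le_sum_of_subset_of_nonneg hsub fun _ _ _ => pow_nonneg hx0 _).trans ?_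
  have := Finset.sum_range_reflect (fun k => x ^ k) (m + 1)
  simp only [Nat.add_sub_cancel] at this
  rw [this]
  exact (summable_geometric_of_lt_one hx0 hx).sum_le_tsum _ fun k _ => pow_nonneg hx0 k

open Classical in
/-- The exponent in the estimate of the renormalized symbol. -/
noncomputable def sixJExponent (a b c d e f : ℕ) : ℕ :=
  if TetAdm a b c d e f then
    sixJOrder fun i =>
      box a b c d e f i - Finset.univ.inf' Finset.univ_nonempty (box a b c d e f)
  -- Any value is harmless for the estimate where the symbol is zero; `f` is taken so that these
  -- colorings add at most one element to each fiber.
  else f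

/-- The constant in the estimate of the renormalized symbol. -/
noncomputable def sixJBound (A : ℂ) : ℝ := 4 * eulerBound ‖A‖ ^ 32 * (1 - ‖A‖)⁻¹

lemma continuousOn_sixJBound : ContinuousOn sixJBound (Metric.ball 0 1) := by
  have h : ∀ A ∈ Metric.ball (0 : ℂ) 1, 1 - ‖A‖ ≠ 0 := fun A hA => by
    rw [mem_ball_zero_iff] at hA
    linarith
  unfold sixJBound eulerBound
  have h1 : ContinuousOn (fun A : ℂ => 1 - ‖A‖) (Metric.ball 0 1) := by fun_prop
  refine ContinuousOn.mul (continuousOn_const.mul (ContinuousOn.pow ?_ _)) (h1.inv₀ h)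
  exact Real.continuous_exp.comp_continuousOn
    (continuous_norm.continuousOn.div (h1.pow 2) fun A hA => pow_ne_zero 2 (h A hA))

theorem norm_sixJR_le (hA : A ∈ Metric.ball (0 : ℂ) 1) (a b c d e f : ℕ) :
    ‖sixJR a b c d e f A‖ ≤ ‖A‖ ^ sixJExponent a b c d e f * sixJBound A := by
  have hx := mem_ball_zero_iff.mp hA
  have hx0 := norm_nonneg A
  have h1x : 0 < 1 - ‖A‖ := by linarith
  have hs := rootNorm_pos hx
  have hE := one_le_eulerBound hx0
  have hE0 : 0 < eulerBound ‖A‖ := by linarith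
  by_cases h : TetAdm a b c d e f
  swap
  · rw [sixJR_of_not h, norm_zero, sixJBound]
    positivity
  obtain ⟨u, v, m, hm, -, hmax, -, hu, hv, huv, -⟩ := exists_top h
  have hQ : sixJExponent a b c d e f = sixJOrder u := by
    rw [sixJExponent, if_pos h, ← hm]
    congr 1
    funext i
    rw [hu]; omega
  rw [sixJR_eq_explicit h (ball_subset_discS hA), sixJExplicit, norm_mul, hQ]
  have hsum : ‖∑ z ∈ tetRange a b c d e f,
      sixJTerm (fun i => box a b c d e f i - z) (fun j => z - tri a b c d e f j) z A‖ ≤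
      ‖A‖ ^ sixJOrder u * (1 - ‖A‖)⁻¹ * (eulerBound ‖A‖ ^ 16 / rootNorm A ^ 2) := by
    calc _ ≤ ∑ z ∈ tetRange a b c d e f,
          ‖A‖ ^ sixJOrder u * ‖A‖ ^ (m - z) * (eulerBound ‖A‖ ^ 16 / rootNorm A ^ 2) := by
          refine norm_sum_le_of_le _ fun z hz => ?_
          obtain ⟨u', v', hu', hv', hz', -⟩ := exists_of_mem_tetRange h hz
          have e1 : (fun i => box a b c d e f i - z) = fun i => u i + (m - z) := by
            funext i
            have := hmax z hz
            rw [hu]; omega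
          have e2 : (fun i => box a b c d e f i - z) = u' := by
            funext i
            rw [hu']; omega
          have e3 : (fun j => z - tri a b c d e f j) = v' := by
            funext j
            have := hv' j
            omega
          rw [e2, e3]
          refine (norm_sixJTerm_le hx hz').trans (mul_le_mul_of_nonneg_right ?_ (by positivity))
          rw [← e2, e1, ← pow_add]
          exact pow_le_pow_of_le_one hx0 hx.le (sixJOrder_add u (m - z))
      _ ≤ _ := by
          rw [← Finset.sum_mul, ← Finset.mul_sum]
          exact mul_le_mul_of_nonneg_right (mul_le_mul_of_nonneg_left
            (sum_pow_sub_le hx0 hx hmax) (by positivity)) (by positivity)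
  -- The two powers of `rootNorm A` cancel, leaving a constant that depends on `A` only through its
  -- norm.
  calc _ ≤ 4 * eulerBound ‖A‖ ^ 16 * rootNorm A ^ 2 *
        (‖A‖ ^ sixJOrder u * (1 - ‖A‖)⁻¹ * (eulerBound ‖A‖ ^ 16 / rootNorm A ^ 2)) :=
        mul_le_mul (norm_sixJPrefactor_le hx hu hv huv c f) hsum (norm_nonneg _) (by positivity)
    _ = _ := by
        rw [sixJBound]
        field_simp

/-! ### Fibers of the exponent -/

/-- The fiber splits according to whether the first quadrilateral half-sum, which does not involve
`f`, is the minimum. On each admissible piece the exponent is strictly monotone in `f`, so each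
piece has at most one element; with the non-admissible value this gives at most 3. -/
lemma encard_sixJExponent_eq_le (a b c d e n : ℕ) :
    {f : ℕ | sixJExponent a b c d e f = n}.encard ≤ 12 := by
  let μ : ℕ → ℕ := fun f => Finset.univ.inf' Finset.univ_nonempty (box a b c d e f)
  let S₁ : Set ℕ := {f | TetAdm a b c d e f ∧ sixJExponent a b c d e f = n ∧
    box a b c d e f 0 = μ f}
  let S₂ : Set ℕ := {f | TetAdm a b c d e f ∧ sixJExponent a b c d e f = n ∧
    box a b c d e f 0 ≠ μ f}
  have hexp : ∀ {f : ℕ} {u : Fin 3 → ℕ} {m : ℕ}, TetAdm a b c d e f →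
      sixJExponent a b c d e f = n → m = μ f →
      (∀ i, box a b c d e f i = m + u i) → sixJOrder u = n := by
    intro f u m h hn hm hu
    rw [← hn, sixJExponent, if_pos h]
    congr 1
    funext i
    change _ = _ - μ f
    rw [← hm, hu]; omega
  have hsub : {f : ℕ | sixJExponent a b c d e f = n} ⊆ S₁ ∪ S₂ ∪ {n} := by
    intro f hf
    by_cases h : TetAdm a b c d e f
    · by_cases h0 : box a b c d e f 0 = μ f
      · exact Or.inl (Or.inl ⟨h, hf, h0⟩)
      · exact Or.inl (Or.inr ⟨h, hf, h0⟩)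
    · right
      rwa [Set.mem_ofPred_eq, sixJExponent, if_neg h] at hf
  have hS₁ : ∀ f ∈ S₁, ∀ f' ∈ S₁, ¬ f < f' := by
    rintro f ⟨h, hn, h0⟩ f' ⟨h', hn', h0'⟩ hlt
    obtain ⟨u, v, m, hm, -, -, -, hu, -, hm1, ha, hb, hc, hd, he, hf⟩ := exists_top h
    obtain ⟨u', v', m', hm', -, -, -, hu', -, hm1', ha', hb', hc', hd', he', hf'⟩ := exists_top h'
    have ho := hexp h hn hm hu
    have ho' := hexp h' hn' hm' hu'
    have hu0 := hu 0
    have hu0' := hu' 0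
    rw [h0] at hu0
    rw [h0'] at hu0'
    have z0 : u 0 = 0 := by change m = μ f at hm; omega
    have z0' : u' 0 = 0 := by change m' = μ f' at hm'; omega
    -- With `u 0 = 0` one has `2 u 1 = c + f - (b + e)` and `2 u 2 = c + f - (a + d)`, both
    -- increasing in `f`, and the exponent is `2 * (u 1 * u 2)`.
    have h1 : u 1 < u' 1 := by omega
    have h2 : u 2 < u' 2 := by omega
    have := Nat.mul_lt_mul'' h1 h2
    rw [sixJOrder, z0] at ho
    rw [sixJOrder, z0'] at ho'
    omega
  have hS₂ : ∀ f ∈ S₂, ∀ f' ∈ S₂, ¬ f < f' := by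
    rintro f ⟨h, hn, h0⟩ f' ⟨h', hn', h0'⟩ hlt
    obtain ⟨u, v, m, hm, -, -, hz, hu, -, hm1, ha, hb, hc, hd, he, hf⟩ := exists_top h
    obtain ⟨u', v', m', hm', -, -, hz', hu', -, hm1', ha', hb', hc', hd', he', hf'⟩ :=
      exists_top h'
    have ho := hexp h hn hm hu
    have ho' := hexp h' hn' hm' hu'
    rw [hu 0] at h0
    rw [hu' 0] at h0'
    have z0 : u 0 ≠ 0 := by change m = μ f at hm; omega
    have z0' : u' 0 ≠ 0 := by change m' = μ f' at hm'; omega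
    have hz := hz.resolve_left z0
    have hz' := hz'.resolve_left z0'
    -- If `u 0 > 0`, one of `u 1`, `u 2` vanishes, so `u 1 + u 2` is the distance between the other
    -- two half-sums and is independent of `f`, while `u 0` decreases with `f`.
    have hlt0 : u' 0 < u 0 := by omega
    have hw : u 1 + u 2 = u' 1 + u' 2 := by omega
    have hp : u 1 * u 2 = 0 := by rcases hz with hz | hz <;> simp [hz]
    have hp' : u' 1 * u' 2 = 0 := by rcases hz' with hz' | hz' <;> simp [hz']
    have e1 : sixJOrder u = 2 * (u 0 * (1 + (u 1 + u 2))) := by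
      rw [sixJOrder, hp]; ring
    have e2 : sixJOrder u' = 2 * (u' 0 * (1 + (u 1 + u 2))) := by
      rw [sixJOrder, hp', hw]; ring
    have := Nat.mul_lt_mul_of_pos_right hlt0 (show 0 < 1 + (u 1 + u 2) by omega)
    omega
  have hone : ∀ S : Set ℕ, (∀ f ∈ S, ∀ f' ∈ S, ¬ f < f') → S.encard ≤ 1 := fun S hS =>
    Set.encard_le_one_iff.mpr fun f f' hf hf' =>
      le_antisymm (not_lt.mp (hS _ hf' _ hf)) (not_lt.mp (hS _ hf _ hf'))
  calc _ ≤ (S₁ ∪ S₂ ∪ {n}).encard := Set.encard_le_encard hsub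
    _ ≤ S₁.encard + S₂.encard + ({n} : Set ℕ).encard :=
        (Set.encard_union_le _ _).trans (add_le_add_left (Set.encard_union_le _ _) _)
    _ ≤ 1 + 1 + 1 := add_le_add (add_le_add (hone _ hS₁) (hone _ hS₂)) (Set.encard_singleton n).le
    _ ≤ 12 := by norm_num

end QuantumSixJ

theorem mainTheorem11 :
    -- the square roots in the definition of the renormalized symbols exist
    (∀ a : ℕ, IsSqrtBranch (circleEval a) (Complex.I ^ a) a (sqrtCircle a)) ∧
    (∀ a b c : ℕ, Adm a b c →
      IsSqrtBranch (thetaEval a b c) (Complex.I ^ ((a + b + c) / 2)) ((a + b + c) / 2)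
        (sqrtTheta a b c)) ∧
    -- analyticity on the closed disc minus the roots of unity different from ±1, ±i
    (∀ a b c d e f : ℕ, AnalyticOnNhd ℂ (sixJR a b c d e f) discS) ∧
    -- orthogonality relations
    (∀ A ∈ discS, ∀ a b c d e g : ℕ, Adm a b c → Adm d e c →
      HasSum (fun f : ℕ => sixJR a b c d e f A * sixJR a b g d e f A)
        (if c = g then 1 else 0)) ∧
    -- Biedenharn-Elliott identity
    (∀ A ∈ discS, ∀ a b c d e f g h i : ℕ,
      HasSum (fun l : ℕ =>
          sixJR c e d h i l A * sixJR b a c l i g A * sixJR a g l h e f A)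
        (sixJR a b c d e f A * sixJR b f d h i g A)) ∧
    -- symmetry
    (∀ A ∈ discS, ∀ a b c d e f : ℕ, sixJR a b c d e f A = sixJR a e f d b c A) ∧
    -- reality
    (∀ A ∈ discS, A.im = 0 ∨ A.re = 0 →
      ∀ a b c d e f : ℕ, (sixJR a b c d e f A).im = 0) ∧
    -- value at zero
    (∀ a b c d e f : ℕ, TetAdm a b c d e f →
      sixJR a b c d e f 0 = if c + f = max (a + d) (b + e) then 1 else 0) ∧
    -- estimate on the open disc
    (∃ (Q : ℕ → ℕ → ℕ → ℕ → ℕ → ℕ → ℕ) (K : ℂ → ℝ),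
      ContinuousOn K (Metric.ball 0 1) ∧
      (∀ a b c d e f : ℕ, ∀ A ∈ Metric.ball (0 : ℂ) 1,
        ‖sixJR a b c d e f A‖ ≤ ‖A‖ ^ Q a b c d e f * K A) ∧
      (∀ a b c d e n : ℕ, {f : ℕ | Q a b c d e f = n}.encard ≤ 12)) := by
  exact ⟨QuantumSixJ.isSqrtBranch_sqrtCircle,
    fun _ _ _ h => QuantumSixJ.isSqrtBranch_sqrtTheta h,
    QuantumSixJ.analyticOnNhd_sixJR,
    fun _ hA _ _ _ _ _ g h₁ h₂ => QuantumSixJ.sixJR_orthogonality hA g h₁ h₂,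
    fun _ hA => QuantumSixJ.sixJR_biedenharn_elliott hA,
    fun _ hA => QuantumSixJ.sixJR_flip hA,
    fun _ hA h => QuantumSixJ.sixJR_im hA h,
    fun _ _ _ _ _ _ h => QuantumSixJ.sixJR_zero h,
    QuantumSixJ.sixJExponent, QuantumSixJ.sixJBound, QuantumSixJ.continuousOn_sixJBound,
    fun a b c d e f _ hA => QuantumSixJ.norm_sixJR_le hA a b c d e f,
    QuantumSixJ.encard_sixJExponent_eq_le⟩
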